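/- **Setting.** Let $\mu$ be a distribution over prompts $x\in\mathcal X$, let $\mathcal Y$ be a finite nonempty set of responses, $N:=|\mathcal Y|$, and let $\phi:\mathcal X\times\mathcal Y\to\mathbb R^d$ be a (measurable) feature map with $\|\phi(x,y)\|_2\le 1$. For $\theta\in\mathbb R^d$ let $\pi_\theta(y\mid x)\propto\exp\langle\phi(x,y),\theta\rangle$, and let $\Pi_{\phi,B}:=\{\pi_\theta:\|\theta\|_2\le B\}$. For a base model $\pi_{\mathrm{base}}$ let $\mathbf y^\star(x):=\arg\max_{y}\pi_{\mathrm{base}}(y\mid x)\subseteq\mathcal Y$. A model $\hat\pi$ is *$(\epsilon,\delta)$-sharpened* if $\mathbb P_{x\sim\mu}[\hat\pi(\mathbf y^\star(x)\mid x)\ge 1-\delta]\ge 1-\epsilon$. The *margin condition* with parameter $\gamma$ says that for $\mu$-almost every $x$ and all $y'\notin\mathbf y^\star(x)$, $\max_y\pi_{\mathrm{base}}(y\mid x)\ge(1+\gamma)\,\pi_{\mathrm{base}}(y'\mid x)$. The coverage coefficient is $C_{\mathrm{cov}}:=\mathbb E_{x\sim\mu}[1/\pi_{\mathrm{base}}(\mathbf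 y^\star(x)\mid x)]$. **Algorithm (XPO)** with reward $r(x,y)=\log\pi_{\mathrm{base}}(y\mid x)$, class $\Pi$, iteration count $T$ and parameters $\beta,\alpha$. Put $\pi^{(1)}=\pi_{\mathrm{base}}$. For $t=1,\dots,T$: draw $x^{(t)}\sim\mu$ and, independently given $x^{(t)}$, $y^{(t)}\sim\pi^{(t)}(\cdot\mid x^{(t)})$ and $\tilde y^{(t)}\sim\pi_{\mathrm{base}}(\cdot\mid x^{(t)})$; with $\mathcal D^{(t)}$ the triples $(x,y,y')$ collected so far, let $\pi^{(t+1)}\in\Pi$ minimize $$\alpha\sum_{\mathcal D^{(t)}}\log\pi(y'\mid x)+\sum_{\mathcal D^{(t)}}\Big(\beta\log\tfrac{\pi(y\mid x)}{\pi_{\mathrm{base}}(y\mid x)}-\beta\log\tfrac{\pi(y'\mid x)}{\pi_{\mathrm{base}}(y'\mid x)}-(r(x,y)-r(x,y'))\Big)^2$$ over $\pi\in\Pi$ (ties broken by any measurable rule). Return a maximizer over $t\in[T+1]$ of $J_\beta(\pi^{(t)})$, where $J_\beta(\pi)=\mathbb E_\pi[r]-\beta\,\mathbb E_\pi[\log(\pi/\pi_{\mathrm{base}})]$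 with $\mathbb E_\pi$ over $x\sim\mu$, $y\sim\pi(\cdot\mid x)$. In the *validated* version, $J_\beta(\pi^{(t)})$ is replaced by its empirical average over $n$ fresh pairs $x\sim\mu$, $y\sim\pi^{(t)}(\cdot\mid x)$, drawn independently for each $t\in[T+1]$. The sample complexity is $m:=2T+n(T+1)$, the number of prompt-response pairs sampled and evaluated under $\pi_{\mathrm{base}}$ (the version with exact $J_\beta$ uses only $2T$ of them). **Theorem.** (a) For every constant $c>0$ there is a polynomial $p$ in six variables such that for all $\epsilon,\delta,\gamma,\rho\in(0,1)$, $B>0$ and all $d,N$ there are $T,n$ with $$m\le p\big(\epsilon^{-1},\delta^{-1},\gamma^{-1},d,B,\log(N/\rho)\big)$$ and the following property. Take any setting as above with $|\mathcal Y|=N$, and suppose that $\pi_{\mathrm{base}}=\pi_{\theta^\star}$ with $\|\theta^\star\|_2\le\frac{\gamma B}{3\log(2N/\delta)}$ and that $\pi_{\mathrm{base}}$ satisfies the margin condition with parameter $\gamma$. Then XPO with class $\Pi_{\phi,B}$, $\beta=\frac{\gamma}{2\log(2N/\delta)}$ and $$\alpha=c\,\frac{\beta}{B+\log N}\sqrt{\frac{d\log(BdT/(\epsilon\delta))+\log(T/\rho)}{dT\log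 T}}$$ returns an $(\epsilon,\delta)$-sharpened model with probability at least $1-\rho$, and so does its validated version. (b) This is exponentially better than SFT-Sharpening (which fits a model to best-of-$M$ responses) on examples with $C_{\mathrm{cov}}=\exp(\Omega(d))$: there are constants $c_0>0$, $\gamma_0\in(0,1)$, $C_0$ and $d_0$ such that for every $d\ge d_0$ there is a finite set $S$ of unit vectors in $\mathbb R^d$ with pairwise distances at least $1/4$ and $e^{c_0d}\le|S|\le e^{C_0d}$, such that for every $y^\star\in S$ the instance with one prompt, $\mathcal Y=S$, $\phi(x,y)=y$ and $\pi_{\mathrm{base}}=\pi_{\theta^\star}$, $\theta^\star=y^\star$, satisfies: the margin condition holds with parameter $\gamma_0$; for each $\delta\in(0,1)$ the norm condition of (a) holds with $\gamma=\gamma_0$ and $B=C_0(d+\log(1/\delta))$; $C_{\mathrm{cov}}\ge e^{c_0d}$; and for all $\epsilon,\delta\in(0,1)$, the distribution of the most likely (under $\pi_{\mathrm{base}}$) of $M$ independent responses drawn from $\pi_{\mathrm{base}}$, which SFT-Sharpening fits, is $(\epsilon,\delta)$-sharpened only if $M\ge(1-\delta)e^{c_0d}$. -/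

import Mathlib

open MeasureTheory
open scoped ENNReal

noncomputable section

namespace Sharpening

/-- A (conditional) model `π`: the number `π x y` is the probability `π(y ∣ x)` of the response `y`
given the prompt `x`. -/
abbrev Model (X Y : Type*) := X → Y → ℝ

/-- The linear softmax model `π_θ(y ∣ x) ∝ exp ⟨φ(x, y), θ⟩`. -/
def linSoftmax {X Y : Type*} [Fintype Y] {d : ℕ} (φ : X → Y → EuclideanSpace ℝ (Fin d))
    (θ : EuclideanSpace ℝ (Fin d)) : Model X Y :=
  fun x y => Real.exp (inner ℝ (φ x y) θ) / ∑ y', Real.exp (inner ℝ (φ x y') θ)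

/-- The class of linear softmax models with parameter of Euclidean norm at most `B`. -/
def softmaxClass {X Y : Type*} [Fintype Y] {d : ℕ} (φ : X → Y → EuclideanSpace ℝ (Fin d))
    (B : ℝ) : Set (Model X Y) :=
  {π | ∃ θ : EuclideanSpace ℝ (Fin d), ‖θ‖ ≤ B ∧ π = linSoftmax φ θ}

/-- The set of most likely responses to `x` under `πb`. -/
def argmaxSet {X Y : Type*} (πb : Model X Y) (x : X) : Set Y :=
  {y | ∀ y', πb x y' ≤ πb x y}

/-- The probability `π(S ∣ x)` of a set `S` of responses. -/
def mass {X Y : Type*} [Fintype Y] (π : Model X Y) (x : X) (S : Set Y) : ℝ :=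
  ∑ y, S.indicator (π x) y

/-- `π` is `(ε, δ)`-sharpened relative to `πb`, for the prompt distribution `μ`. -/
def IsSharpened {X Y : Type*} [MeasurableSpace X] [Fintype Y] (μ : Measure X) (πb : Model X Y)
    (ε δ : ℝ) (π : Model X Y) : Prop :=
  ENNReal.ofReal (1 - ε) ≤ μ {x | 1 - δ ≤ mass π x (argmaxSet πb x)}

/-- The margin condition with parameter `γ`: for almost every prompt, the largest probability
exceeds that of every non-maximal response by the factor `1 + γ`. -/
def MarginCondition {X Y : Type*} [MeasurableSpace X] (μ : Measure X) (πb : Model X Y)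
    (γ : ℝ) : Prop :=
  ∀ᵐ x ∂μ, ∀ y' ∉ argmaxSet πb x, (1 + γ) * πb x y' ≤ ⨆ y, πb x y

/-- The coverage coefficient `E_{x ∼ μ} [1 / πb(y⋆(x) ∣ x)]`. -/
def coverage {X Y : Type*} [MeasurableSpace X] [Fintype Y] (μ : Measure X)
    (πb : Model X Y) : ℝ :=
  ∫ x, 1 / mass πb x (argmaxSet πb x) ∂μ

/-- The expectation of `f(x, y)` over `x ∼ μ`, `y ∼ π(· ∣ x)`. -/
def expect {X Y : Type*} [MeasurableSpace X] [Fintype Y] (μ : Measure X) (π : Model X Y)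
    (f : X → Y → ℝ) : ℝ :=
  ∫ x, ∑ y, π x y * f x y ∂μ

/-- The KL-regularized objective `J_β(π) = E_π[r(x, y)] - β · KL(π ‖ πb)`. -/
def klObjective {X Y : Type*} [MeasurableSpace X] [Fintype Y] (μ : Measure X) (πb : Model X Y)
    (r : X → Y → ℝ) (β : ℝ) (π : Model X Y) : ℝ :=
  expect μ π r - β * expect μ π fun x y => Real.log (π x y / πb x y)

/-! ### The XPO algorithm -/

/-- The loss that XPO minimizes over the model class, for a dataset `D` of triples
`(x, y, y')`: the optimism term plus the squared loss of the reward differences. -/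
def xpoLoss {X Y : Type*} (πb : Model X Y) (r : X → Y → ℝ) (β α : ℝ) {t : ℕ}
    (D : Fin t → X × Y × Y) (π : Model X Y) : ℝ :=
  α * ∑ i, Real.log (π (D i).1 (D i).2.2) +
    ∑ i, (β * Real.log (π (D i).1 (D i).2.1 / πb (D i).1 (D i).2.1)
      - β * Real.log (π (D i).1 (D i).2.2 / πb (D i).1 (D i).2.2)
      - (r (D i).1 (D i).2.1 - r (D i).1 (D i).2.2)) ^ 2

/-- `A` is a model-update rule of XPO with base model `πb`, reward `r` and model class `C`:
`A t D` is the model `π^(t+1)` computed from the first `t` collected triples `D`. It is `πb` for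
`t = 0`, and an exact minimizer of the loss over `C` afterwards, with ties broken arbitrarily
(but measurably). -/
structure IsXPORule {X Y : Type*} [MeasurableSpace X] [MeasurableSpace Y] (C : Set (Model X Y))
    (πb : Model X Y) (r : X → Y → ℝ) (β α : ℝ)
    (A : (t : ℕ) → (Fin t → X × Y × Y) → Model X Y) : Prop where
  init : ∀ D, A 0 D = πb
  mem : ∀ t, 1 ≤ t → ∀ D, A t D ∈ C
  isMin : ∀ t, 1 ≤ t → ∀ D, ∀ π ∈ C, xpoLoss πb r β α D (A t D) ≤ xpoLoss πb r β α D π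
  measurable : ∀ t y, Measurable fun p : (Fin t → X × Y × Y) × X => A t p.1 p.2 y

/-- The law of `(x, y, y')` with `x ∼ μ` and, given `x`, independent responses `y ∼ π(· ∣ x)` and
`y' ∼ πb(· ∣ x)`. -/
def tripleLaw {X Y : Type*} [MeasurableSpace X] [MeasurableSpace Y] [Fintype Y] (μ : Measure X)
    (π πb : Model X Y) : Measure (X × Y × Y) :=
  ∑ y, ∑ y', (μ.withDensity fun x => ENNReal.ofReal (π x y * πb x y')).map fun x => (x, y, y')

/-- The law of `(x, y)` with `x ∼ μ` and `y ∼ π(· ∣ x)`. -/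
def pairLaw {X Y : Type*} [MeasurableSpace X] [MeasurableSpace Y] [Fintype Y] (μ : Measure X)
    (π : Model X Y) : Measure (X × Y) :=
  ∑ y, (μ.withDensity fun x => ENNReal.ofReal (π x y)).map fun x => (x, y)

/-- The law of the first `t` triples collected by XPO: given the first `t` triples `D`, the next one
consists of `x ∼ μ`, `y ∼ π^(t+1)(· ∣ x)` for the current model `π^(t+1) = A t D`, and
`y' ∼ πb(· ∣ x)`. -/
def trainLaw {X Y : Type*} [MeasurableSpace X] [MeasurableSpace Y] [Fintype Y] (μ : Measure X)
    (πb : Model X Y) (A : (t : ℕ) → (Fin t → X × Y × Y) → Model X Y) :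
    (t : ℕ) → Measure (Fin t → X × Y × Y)
  | 0 => Measure.dirac Fin.elim0
  | t + 1 => (trainLaw μ πb A t).bind fun D =>
      (tripleLaw μ (A t D) πb).map fun z => Fin.snoc (α := fun _ => X × Y × Y) D z

/-- The `T + 1` models `π^(1), …, π^(T+1)` computed along the dataset `D` of a run with `T`
iterations; `iterate A D s` is `π^(s+1)` and depends on the first `s` triples only. -/
def iterate {X Y : Type*} (A : (t : ℕ) → (Fin t → X × Y × Y) → Model X Y) {T : ℕ}
    (D : Fin T → X × Y × Y) (s : Fin (T + 1)) : Model X Y :=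
  A s fun i => D (Fin.castLE (Nat.lt_succ_iff.mp s.isLt) i)

/-- The probability that XPO with `T` iterations, returning a maximizer of `J_β` among its `T + 1`
models (whichever of them), returns an `(ε, δ)`-sharpened model. -/
def xpoSuccess {X Y : Type*} [MeasurableSpace X] [MeasurableSpace Y] [Fintype Y] (μ : Measure X)
    (πb : Model X Y) (r : X → Y → ℝ) (β ε δ : ℝ)
    (A : (t : ℕ) → (Fin t → X × Y × Y) → Model X Y) (T : ℕ) : ℝ≥0∞ :=
  trainLaw μ πb A T {D | ∀ s, (∀ s', klObjective μ πb r β (iterate A D s') ≤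
    klObjective μ πb r β (iterate A D s)) → IsSharpened μ πb ε δ (iterate A D s)}

/-- The estimate of `J_β(π)` from `n` validation pairs `(x, y)` drawn from `π`. -/
def klEstimate {X Y : Type*} (πb : Model X Y) (r : X → Y → ℝ) (β : ℝ) {n : ℕ} (π : Model X Y)
    (V : Fin n → X × Y) : ℝ :=
  (∑ i, (r (V i).1 (V i).2 - β * Real.log (π (V i).1 (V i).2 / πb (V i).1 (V i).2))) / n

/-- The probability that XPO with `T` iterations returns an `(ε, δ)`-sharpened model when `J_β` is
estimated from validation data: after the `T` iterations, `n` fresh independent pairs `(x, y)` are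
drawn from each of the `T + 1` models, and a model with the largest estimate (whichever of them) is
returned. -/
def xpoSuccessVal {X Y : Type*} [MeasurableSpace X] [MeasurableSpace Y] [Fintype Y]
    (μ : Measure X) (πb : Model X Y) (r : X → Y → ℝ) (β ε δ : ℝ)
    (A : (t : ℕ) → (Fin t → X × Y × Y) → Model X Y) (T n : ℕ) : ℝ≥0∞ :=
  ∫⁻ D, (Measure.pi fun q : Fin (T + 1) × Fin n => pairLaw μ (iterate A D q.1))
    {V | ∀ s, (∀ s', klEstimate πb r β (iterate A D s') (fun i => V (s', i)) ≤
      klEstimate πb r β (iterate A D s) (fun i => V (s, i))) →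
        IsSharpened μ πb ε δ (iterate A D s)} ∂(trainLaw μ πb A T)

/-- The number of prompt-response pairs that are sampled, and whose likelihood under the base model
is evaluated: two in each of the `T` iterations, and `n` validation pairs for each of the `T + 1`
models. -/
def xpoSampleComplexity (T n : ℕ) : ℕ := 2 * T + n * (T + 1)

/-- The regularization parameter `β = γ / (2 log(2N/δ))`, where `N` is the number of responses. -/
def xpoBeta (N : ℕ) (δ γ : ℝ) : ℝ := γ / (2 * Real.log (2 * N / δ))

/-- The optimism parameter for `T` iterations, with the constant of proportionality `c`. -/
def xpoAlpha (c : ℝ) (d N : ℕ) (ε δ γ ρ B : ℝ) (T : ℕ) : ℝ :=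
  c * (xpoBeta N δ γ / (B + Real.log N)) *
    Real.sqrt ((d * Real.log (B * d * T / (ε * δ)) + Real.log (T / ρ)) / (d * T * Real.log T))

/-! ### Best-of-`N` responses, the training data of SFT-Sharpening -/

/-- `s` selects, from `N` responses to a prompt `x`, one with the largest likelihood under `πb`. -/
def IsBestOfN {X Y : Type*} (N : ℕ) (πb : Model X Y) (s : X → (Fin N → Y) → Y) : Prop :=
  ∀ x ys, (∃ i, s x ys = ys i) ∧ ∀ i, πb x (ys i) ≤ πb x (s x ys)

/-- The distribution of the response selected by `s` from `N` independent draws from `πb(· ∣ x)`. -/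
def bestOfN {X Y : Type*} [Fintype Y] (N : ℕ) (πb : Model X Y) (s : X → (Fin N → Y) → Y) :
    Model X Y :=
  fun x y => ∑ ys : Fin N → Y, {ys | s x ys = y}.indicator (fun ys => ∏ i, πb x (ys i)) ys

end Sharpening

end

/-! Part (a). Since the reward is `log πb`, the ideal policy for `J_β` is proportional to `πb ^ (1 +
1/β)`, which is again a softmax model, with parameter `θb = (1 + 1/β) • θs`. The norm condition puts
it in the class (`norm_tilt_le`), and `J_β(π)` is a constant minus `β` times the expected divergence
of `π` from it (`klObjective_linSoftmax`). The margin leaves it mass at most `δ/2` outside the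
argmax set (`mass_compl_argmax_le`), so a softmax model at expected divergence at most `εδ/10` is
sharpened (`isSharpened_of_klExpect_le`). It therefore suffices that one iterate has divergence at
most `εδ/20`: selection by `J_β`, exact or estimated, loses at most `εδ/20` more.

Such an iterate comes from a regret bound. The ideal policy fits the reward differences exactly, so
the regression is noise-free: the squared loss of `π_θ` is `β² ∑ ⟨ψ_i, θ - θb⟩²`, where `ψ_i` is the
feature difference of the `i`-th triple (`xpoLoss_linSoftmax`). Comparing the minimizer with the
ideal policy, and replacing the optimism term by its mean, gives `α (s h_s - E) + β² ∑_{i<s} ⟨ψ_i,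
v_s⟩² ≤ 0`, where `v_s = θ_s - θb` and `h_s` is the base-model mean of the log-ratio of the iterate
to the ideal policy. The divergence of the iterate is `h_s` plus the conditional mean of `⟨ψ_s,
v_s⟩`. The elliptic potential bounds `⟨ψ_s, v_s⟩` by the squares at earlier directions, which the
quadratic term above absorbs, plus terms whose sum is of order `d log T`
(`exists_elliptic_potential`, `regret_sum_le`). No coverage coefficient enters. The two deviations
are controlled by the Azuma-Hoeffding inequality, uniformly over a net because `θ_s` depends on the
data (`IsXPORule.trainLaw_regret_le`).

The choice `T = R ^ 8` makes `√T = R ^ 4` exact: `α` is of order `R ^ (-4)`, the total divergence is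
of order `R ^ 6` up to powers of the parameters, and its average falls below `εδ/20` once `R` is a
large enough polynomial in them. If `d = 0`, `B < 1` or there is at most one response, the margin
condition makes all responses equally likely and no iteration is needed.

Part (b). A volume argument gives `2 ^ d` separated unit vectors. All inner products lie in `[-1,
1]`, so each response has probability at most `e² 2 ^ (-d)`, while separation gives a constant
margin. Best-of-`M` finds a given response with probability at most `M` times its own
(`bestOfN_le`). -/

noncomputable section

namespace Sharpening

/-! ### Separated unit vectors -/

/-- Fewer than `2 ^ d` balls of radius `1/4` do not cover the unit sphere of `ℝ^d`. -/
theorem exists_unit_far {d : ℕ} (hd : 10 ≤ d) (S : Finset (EuclideanSpace ℝ (Fin d)))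
    (hS : S.card ≤ 2 ^ d) :
    ∃ x : EuclideanSpace ℝ (Fin d), ‖x‖ = 1 ∧ ∀ y ∈ S, 1 / 4 ≤ dist x y := by
  have : Nonempty (Fin d) := ⟨⟨0, by omega⟩⟩
  by_contra! H
  -- Normalizing a point of norm in `[7/8, 1)` moves it by at most `1/8`, and `1/8 + 1/4 = 3/8`.
  -- Comparing volumes then gives `1 ≤ (7/8)^d + 2^d (3/8)^d`, which is false for `d ≥ 10`.
  have hsub : Metric.ball (0 : EuclideanSpace ℝ (Fin d)) 1 ⊆
      Metric.ball 0 (7 / 8) ∪ ⋃ y ∈ S, Metric.ball y (3 / 8) := by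
    intro x hx
    by_cases h : ‖x‖ < 7 / 8
    · left; simpa using h
    · right
      push Not at h
      have hx1 : ‖x‖ < 1 := by simpa using hx
      have hx0 : 0 < ‖x‖ := by linarith
      obtain ⟨y, hy, hxy⟩ := H (‖x‖⁻¹ • x) (by
        rw [norm_smul, norm_inv, norm_norm, inv_mul_cancel₀ hx0.ne'])
      simp only [Set.mem_iUnion, Metric.mem_ball]
      refine ⟨y, hy, ?_⟩
      have h1 : dist x (‖x‖⁻¹ • x) ≤ 1 / 8 := by
        have : x - ‖x‖⁻¹ • x = (1 - ‖x‖⁻¹) • x := by rw [sub_smul, one_smul]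
        rw [dist_eq_norm, this, norm_smul, Real.norm_eq_abs, ← abs_of_pos hx0, ← abs_mul,
          abs_of_pos hx0, sub_mul, inv_mul_cancel₀ hx0.ne', one_mul, abs_of_nonpos (by linarith)]
        linarith
      linarith [dist_triangle x (‖x‖⁻¹ • x) y]
  have hvol := (measure_mono (μ := volume) hsub).trans ((measure_union_le _ _).trans
    (add_le_add_right (measure_biUnion_finset_le S _) _))
  have hb : ∀ (y : EuclideanSpace ℝ (Fin d)) (r : ℝ), 0 < r →
      volume (Metric.ball y r) =
        ENNReal.ofReal (r ^ d) * volume (Metric.ball (0 : EuclideanSpace ℝ (Fin d)) 1) := by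
    intro y r hr
    rw [Measure.addHaar_ball_of_pos volume y hr, finrank_euclideanSpace_fin]
  have hsum : ∑ y ∈ S, volume (Metric.ball y (3 / 8)) =
      S.card * (ENNReal.ofReal ((3 / 8) ^ d) *
        volume (Metric.ball (0 : EuclideanSpace ℝ (Fin d)) 1)) := by
    rw [Finset.sum_congr rfl fun y _ => hb y (3 / 8) (by norm_num), Finset.sum_const, nsmul_eq_mul]
  rw [hsum, hb 0 (7 / 8) (by norm_num), ← mul_assoc, ← add_mul] at hvol
  have hpos : volume (Metric.ball (0 : EuclideanSpace ℝ (Fin d)) 1) ≠ 0 :=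
    (Metric.measure_ball_pos _ _ one_pos).ne'
  have hfin : volume (Metric.ball (0 : EuclideanSpace ℝ (Fin d)) 1) ≠ ∞ :=
    measure_ball_lt_top.ne
  have h1 : (1 : ℝ≥0∞) ≤ ENNReal.ofReal ((7 / 8) ^ d) + S.card * ENNReal.ofReal ((3 / 8) ^ d) := by
    by_contra! hlt
    have := ENNReal.mul_lt_mul_left hpos hfin hlt
    rw [one_mul] at this
    exact absurd hvol (not_le.mpr this)
  rw [← ENNReal.ofReal_natCast, ← ENNReal.ofReal_mul (by positivity),
    ← ENNReal.ofReal_add (by positivity) (by positivity), ← ENNReal.ofReal_one,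
    ENNReal.ofReal_le_ofReal_iff (by positivity)] at h1
  have hS' : (S.card : ℝ) ≤ 2 ^ d := by exact_mod_cast hS
  have h2 : (S.card : ℝ) * (3 / 8) ^ d ≤ (3 / 4) ^ d := by
    calc _ ≤ (2 : ℝ) ^ d * (3 / 8) ^ d := by gcongr
      _ = _ := by rw [← mul_pow]; norm_num
  have h3 : (3 / 4 : ℝ) ^ d ≤ (3 / 4) ^ 10 := pow_le_pow_of_le_one (by norm_num) (by norm_num) hd
  have h4 : (7 / 8 : ℝ) ^ d ≤ (7 / 8) ^ 10 := pow_le_pow_of_le_one (by norm_num) (by norm_num) hd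
  norm_num at h3 h4
  linarith

/-- Greedy choice: `exists_unit_far` supplies the next point as long as fewer than `2 ^ d` have been
placed. -/
theorem exists_separated_unit {d : ℕ} (hd : 10 ≤ d) (m : ℕ) (hm : m ≤ 2 ^ d) :
    ∃ S : Finset (EuclideanSpace ℝ (Fin d)), S.card = m ∧ (∀ y ∈ S, ‖y‖ = 1) ∧
      ∀ y ∈ S, ∀ y' ∈ S, y ≠ y' → 1 / 4 ≤ dist y y' := by
  classical
  induction m with
  | zero => exact ⟨∅, by simp⟩
  | succ m ih =>
    obtain ⟨S, hc, hu, hs⟩ := ih (by omega)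
    obtain ⟨x, hx, hxS⟩ := exists_unit_far hd S (by omega)
    have hx' : x ∉ S := fun h => by have := hxS x h; norm_num at this
    refine ⟨insert x S, by rw [Finset.card_insert_of_notMem hx', hc], ?_, ?_⟩
    · simpa [hx] using hu
    · intro y hy y' hy' hne
      rw [Finset.mem_insert] at hy hy'
      rcases hy with rfl | hy <;> rcases hy' with rfl | hy'
      · exact absurd rfl hne
      · exact hxS _ hy'
      · rw [dist_comm]; exact hxS _ hy
      · exact hs _ hy _ hy' hne

/-! ### Best-of-`N` sampling -/

/-- A response is among `M` independent draws with probability at most `M` times its own. -/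
theorem bestOfN_le {X Y : Type*} [Fintype Y] (M : ℕ) (πb : Model X Y) (s : X → (Fin M → Y) → Y)
    (hs : IsBestOfN M πb s) (x : X) (y : Y) (h0 : ∀ y, 0 ≤ πb x y) (h1 : ∑ y, πb x y = 1) :
    bestOfN M πb s x y ≤ M * πb x y := by
  classical
  have hcoord : ∀ i : Fin M, ∑ ys : Fin M → Y, (if ys i = y then ∏ j, πb x (ys j) else 0) =
      πb x y := by
    intro i
    -- Moving the constraint into the `i`-th factor keeps the summand a product over coordinates, so
    -- the sum factorizes.
    have : ∀ ys : Fin M → Y, (if ys i = y then ∏ j, πb x (ys j) else 0) =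
        ∏ j, (if j = i then (if ys j = y then πb x (ys j) else 0) else πb x (ys j)) := by
      intro ys
      split_ifs with h
      · refine Finset.prod_congr rfl fun j _ => ?_
        split_ifs with h1 h2
        · rfl
        · exact absurd (h1 ▸ h) h2
        · rfl
      · exact (Finset.prod_eq_zero (Finset.mem_univ i) (by simp [h])).symm
    simp_rw [this]
    have hprod := Finset.prod_univ_sum (fun _ : Fin M => (Finset.univ : Finset Y))
      (fun j y' => if j = i then (if y' = y then πb x y' else 0) else πb x y')
    rw [Fintype.piFinset_univ] at hprod
    rw [← hprod, Finset.prod_eq_single i]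
    · simp
    · intro j _ hj; simp [hj, h1]
    · simp
  calc bestOfN M πb s x y
      ≤ ∑ ys : Fin M → Y, ∑ i, (if ys i = y then ∏ j, πb x (ys j) else 0) := by
        refine Finset.sum_le_sum fun ys _ => ?_
        have hp : 0 ≤ ∏ j, πb x (ys j) := Finset.prod_nonneg fun j _ => h0 _
        by_cases h : s x ys = y
        · rw [Set.indicator_of_mem (by exact h)]
          obtain ⟨i, hi⟩ := (hs x ys).1
          refine le_trans ?_ (Finset.single_le_sum
            (f := fun i => if ys i = y then ∏ j, πb x (ys j) else 0)
            (fun j _ => by positivity) (Finset.mem_univ i))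
          simp [← hi, h]
        · rw [Set.indicator_of_notMem (by exact h)]
          exact Finset.sum_nonneg fun j _ => by positivity
    _ = M * πb x y := by
        rw [Finset.sum_comm, Finset.sum_congr rfl fun i _ => hcoord i]
        simp

/-! ### The comparison with SFT-Sharpening -/

/-- The instance has `2 ^ d` responses whose weights `exp ⟨y, y⋆⟩` all lie between `e⁻¹` and `e`, so
even the most likely one has exponentially small probability, although it beats the others by a
constant factor. -/
theorem sft_comparison :
    ∃ (c₀ γ₀ C₀ : ℝ) (d₀ : ℕ), 0 < c₀ ∧ γ₀ ∈ Set.Ioo 0 1 ∧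
      ∀ d : ℕ, d₀ ≤ d →
      ∃ S : Finset (EuclideanSpace ℝ (Fin d)),
        (∀ y ∈ S, ‖y‖ = 1) ∧ (∀ y ∈ S, ∀ y' ∈ S, y ≠ y' → 1 / 4 ≤ dist y y') ∧
        Real.exp (c₀ * d) ≤ S.card ∧ (S.card : ℝ) ≤ Real.exp (C₀ * d) ∧
        ∀ (ys : S) (φ : Unit → S → EuclideanSpace ℝ (Fin d)) (πb : Sharpening.Model Unit S),
          (∀ x y, φ x y = (y : EuclideanSpace ℝ (Fin d))) → πb = Sharpening.linSoftmax φ ys →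
          (∀ δ ∈ Set.Ioo (0 : ℝ) 1, ‖(ys : EuclideanSpace ℝ (Fin d))‖ ≤
            γ₀ * (C₀ * (d + Real.log (1 / δ))) / (3 * Real.log (2 * S.card / δ))) ∧
          Sharpening.MarginCondition (Measure.dirac ()) πb γ₀ ∧
          Real.exp (c₀ * d) ≤ Sharpening.coverage (Measure.dirac ()) πb ∧
          ∀ ε ∈ Set.Ioo (0 : ℝ) 1, ∀ δ ∈ Set.Ioo (0 : ℝ) 1,
            ∀ (M : ℕ) (s : Unit → (Fin M → S) → S), Sharpening.IsBestOfN M πb s →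
              Sharpening.IsSharpened (Measure.dirac ()) πb ε δ (Sharpening.bestOfN M πb s) →
              (1 - δ) * Real.exp (c₀ * d) ≤ M := by
  -- `2 + d/4 ≤ d log 2` for `d ≥ 10` allows `c₀ = 1/4`. Separation `1/4` lowers inner products by
  -- `(1/4)²/2 = 1/32`, which is `γ₀`. With `C₀ = 192` one has `γ₀ C₀ = 6`, enough room for `3
  -- log(2|S|/δ)`.
  refine ⟨1 / 4, 1 / 32, 192, 10, by norm_num, by norm_num, fun d hd => ?_⟩
  obtain ⟨S, hcard, hunit, hsep⟩ := exists_separated_unit hd (2 ^ d) le_rfl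
  have hd' : (10 : ℝ) ≤ d := by exact_mod_cast hd
  have hl2 := Real.log_two_gt_d9
  have hl2' := Real.log_two_lt_d9
  have hcardR : (S.card : ℝ) = Real.exp (d * Real.log 2) := by
    rw [hcard, mul_comm, Real.exp_mul, Real.exp_log two_pos, Real.rpow_natCast]
    norm_num
  refine ⟨S, hunit, hsep, ?_, ?_, ?_⟩
  · rw [hcardR, Real.exp_le_exp]; nlinarith
  · rw [hcardR, Real.exp_le_exp]; nlinarith
  intro ys φ πb hφ hπb
  obtain ⟨u, hu⟩ := ys
  set ys : S := ⟨u, hu⟩ with hys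
  have : Nonempty S := ⟨ys⟩
  set Z : ℝ := ∑ y : S, Real.exp (inner ℝ (y : EuclideanSpace ℝ (Fin d)) u) with hZ
  have hπ : ∀ y : S, πb () y = Real.exp (inner ℝ (y : EuclideanSpace ℝ (Fin d)) u) / Z := by
    intro y; simp [hπb, linSoftmax, hφ, hZ, hys]
  have hZpos : 0 < Z := Finset.sum_pos (fun y _ => Real.exp_pos _) Finset.univ_nonempty
  have hZge : S.card * Real.exp (-1) ≤ Z := by
    have : ∀ y : S, Real.exp (-1) ≤ Real.exp (inner ℝ (y : EuclideanSpace ℝ (Fin d)) u) := by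
      intro y
      have := (abs_le.mp (abs_real_inner_le_norm (y : EuclideanSpace ℝ (Fin d)) u)).1
      rw [hunit _ y.2, hunit _ hu] at this
      exact Real.exp_le_exp.mpr (by linarith)
    have := Finset.card_nsmul_le_sum Finset.univ _ _ fun y _ => this y
    simpa only [Finset.card_univ, Fintype.card_coe, nsmul_eq_mul] using this
  have huu : inner ℝ u u = (1 : ℝ) := by rw [real_inner_self_eq_norm_sq, hunit _ hu]; norm_num
  have hyu : ∀ y : S, y ≠ ys → inner ℝ (y : EuclideanSpace ℝ (Fin d)) u ≤ (1 - 1 / 32 : ℝ) := by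
    intro y hy
    have h1 := hsep y y.2 u hu fun h => hy (Subtype.ext h)
    rw [dist_eq_norm] at h1
    have h2 := norm_sub_sq_real (y : EuclideanSpace ℝ (Fin d)) u
    rw [hunit _ y.2, hunit _ hu] at h2
    nlinarith
  have hlt : ∀ y : S, y ≠ ys → πb () y < πb () ys := by
    intro y hy
    rw [hπ, hπ]
    refine div_lt_div_of_pos_right (Real.exp_lt_exp.mpr ?_) hZpos
    show _ < inner ℝ u u
    rw [huu]; linarith [hyu y hy]
  have hargmax : argmaxSet πb () = {ys} := by
    ext y
    simp only [argmaxSet, Set.mem_ofPred_eq, Set.mem_singleton_iff]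
    constructor
    · intro h
      by_contra hne
      exact absurd (h ys) (not_le.mpr (hlt y hne))
    · rintro rfl y'
      by_cases h : y' = ys
      · rw [h]
      · exact (hlt y' h).le
  have hmass : ∀ π : Model Unit S, mass π () (argmaxSet πb ()) = π () ys := by
    intro π
    rw [hargmax, mass, Finset.sum_eq_single ys]
    · simp
    · intro y _ hy; simp [hy]
    · simp
  have hbase : πb () ys * Real.exp (1 / 4 * d) ≤ 1 := by
    rw [hπ, div_mul_eq_mul_div, div_le_one hZpos]
    refine le_trans ?_ hZge
    show Real.exp (inner ℝ u u) * _ ≤ _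
    rw [huu, hcardR, ← Real.exp_add, ← Real.exp_add, Real.exp_le_exp]
    nlinarith
  have hbpos : 0 < πb () ys := by rw [hπ]; positivity
  refine ⟨?_, ?_, ?_, ?_⟩
  · rintro δ ⟨hδ0, hδ1⟩
    have hl : 0 ≤ Real.log (1 / δ) := Real.log_nonneg (by rw [le_div_iff₀ hδ0]; linarith)
    have : Real.log (2 * S.card / δ) = Real.log 2 + d * Real.log 2 + Real.log (1 / δ) := by
      rw [hcardR, mul_div_assoc, Real.log_mul (by norm_num) (by positivity), div_eq_mul_one_div,
        Real.log_mul (by positivity) (by positivity), Real.log_exp]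
      ring
    rw [hunit _ hu, this, le_div_iff₀ (by positivity)]
    nlinarith
  · refine (ae_dirac_iff (by simp)).mpr fun y' hy' => ?_
    rw [hargmax, Set.mem_singleton_iff] at hy'
    refine le_trans ?_ (le_ciSup (f := fun y => πb () y) (Set.finite_range _).bddAbove ys)
    rw [hπ, hπ, mul_div_assoc']
    refine div_le_div_of_nonneg_right ?_ hZpos.le
    have h1 : (1 + 1 / 32 : ℝ) ≤ Real.exp (1 / 32) := by
      linarith [Real.add_one_le_exp (1 / 32 : ℝ)]
    calc _ ≤ Real.exp (1 / 32) * Real.exp (1 - 1 / 32) := by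
          gcongr
          exact hyu y' hy'
      _ = Real.exp (inner ℝ u u) := by rw [← Real.exp_add, huu]; norm_num
  · rw [coverage, integral_dirac, hmass, le_div_iff₀ hbpos]
    linarith
  · rintro ε ⟨hε0, hε1⟩ δ ⟨hδ0, hδ1⟩ M s hs hsh
    -- With a single prompt the sharpening event has probability `0` or `1`, and `ε < 1` excludes
    -- `0`.
    have hle : 1 - δ ≤ bestOfN M πb s () ys := by
      by_contra hlt'
      rw [IsSharpened, Measure.dirac_apply' _ (by simp), Set.indicator_of_notMem] at hsh
      · simp only [nonpos_iff_eq_zero, ENNReal.ofReal_eq_zero] at hsh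
        linarith
      · rwa [Set.mem_ofPred_eq, hmass]
    have hsum : ∑ y, πb () y = 1 := by
      simp_rw [hπ]
      rw [← Finset.sum_div, div_self hZpos.ne']
    have hb := bestOfN_le M πb s hs () ys (fun y => by rw [hπ]; positivity) hsum
    calc (1 - δ) * Real.exp (1 / 4 * d) ≤ M * πb () ys * Real.exp (1 / 4 * d) := by
          gcongr; linarith
      _ ≤ M := by
          rw [mul_assoc]
          exact mul_le_of_le_one_right (by positivity) hbase

/-! ### Linear softmax models -/

section Softmax

variable {X Y : Type*} [Fintype Y] {d : ℕ} {φ : X → Y → EuclideanSpace ℝ (Fin d)}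

/-- The normalizing constant of `linSoftmax`. -/
def partition (φ : X → Y → EuclideanSpace ℝ (Fin d)) (θ : EuclideanSpace ℝ (Fin d)) (x : X) : ℝ :=
  ∑ y, Real.exp (inner ℝ (φ x y) θ)

theorem partition_pos [Nonempty Y] (θ : EuclideanSpace ℝ (Fin d)) (x : X) :
    0 < partition φ θ x :=
  Finset.sum_pos (fun _ _ => Real.exp_pos _) Finset.univ_nonempty

theorem linSoftmax_pos [Nonempty Y] (θ : EuclideanSpace ℝ (Fin d)) (x : X) (y : Y) :
    0 < linSoftmax φ θ x y :=
  div_pos (Real.exp_pos _) (partition_pos θ x)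

theorem sum_linSoftmax [Nonempty Y] (θ : EuclideanSpace ℝ (Fin d)) (x : X) :
    ∑ y, linSoftmax φ θ x y = 1 := by
  simp_rw [linSoftmax, ← Finset.sum_div]
  exact div_self (partition_pos θ x).ne'

theorem log_linSoftmax [Nonempty Y] (θ : EuclideanSpace ℝ (Fin d)) (x : X) (y : Y) :
    Real.log (linSoftmax φ θ x y) = inner ℝ (φ x y) θ - Real.log (partition φ θ x) := by
  change Real.log (_ / partition φ θ x) = _
  rw [Real.log_div (Real.exp_pos _).ne' (partition_pos θ x).ne', Real.log_exp]

theorem log_linSoftmax_div [Nonempty Y] (θ θ' : EuclideanSpace ℝ (Fin d)) (x : X) (y : Y) :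
    Real.log (linSoftmax φ θ x y / linSoftmax φ θ' x y) =
      inner ℝ (φ x y) (θ - θ') -
        (Real.log (partition φ θ x) - Real.log (partition φ θ' x)) := by
  rw [Real.log_div (linSoftmax_pos _ _ _).ne' (linSoftmax_pos _ _ _).ne', log_linSoftmax,
    log_linSoftmax, inner_sub_right]
  ring

theorem log_linSoftmax_div_sub [Nonempty Y] (θ θ' : EuclideanSpace ℝ (Fin d)) (x : X) (y y' : Y) :
    Real.log (linSoftmax φ θ x y / linSoftmax φ θ' x y) -
      Real.log (linSoftmax φ θ x y' / linSoftmax φ θ' x y') =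
      inner ℝ (φ x y - φ x y') (θ - θ') := by
  rw [log_linSoftmax_div, log_linSoftmax_div, inner_sub_left]
  ring

theorem abs_inner_le_of_norm_le_one {E : Type*} [NormedAddCommGroup E] [InnerProductSpace ℝ E]
    {u v : E} (hu : ‖u‖ ≤ 1) : |inner ℝ u v| ≤ ‖v‖ :=
  (abs_real_inner_le_norm _ _).trans (mul_le_of_le_one_left (norm_nonneg _) hu)

/-- As features have norm at most one, a change of parameter multiplies each summand of the
partition function by at most `exp ‖θ - θ'‖`. -/
theorem log_partition_sub_le [Nonempty Y] (hφ : ∀ x y, ‖φ x y‖ ≤ 1)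
    (θ θ' : EuclideanSpace ℝ (Fin d)) (x : X) :
    Real.log (partition φ θ x) - Real.log (partition φ θ' x) ≤ ‖θ - θ'‖ := by
  have h : partition φ θ x ≤ Real.exp ‖θ - θ'‖ * partition φ θ' x := by
    rw [partition, partition, Finset.mul_sum]
    refine Finset.sum_le_sum fun y _ => ?_
    rw [← Real.exp_add, Real.exp_le_exp]
    have := (abs_le.mp (abs_inner_le_of_norm_le_one (v := θ - θ') (hφ x y))).2
    rw [inner_sub_right] at this
    linarith
  have := Real.log_le_log (partition_pos θ x) h
  rw [Real.log_mul (Real.exp_pos _).ne' (partition_pos θ' x).ne', Real.log_exp] at this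
  linarith

theorem abs_log_linSoftmax_div_le [Nonempty Y] (hφ : ∀ x y, ‖φ x y‖ ≤ 1)
    (θ θ' : EuclideanSpace ℝ (Fin d)) (x : X) (y : Y) :
    |Real.log (linSoftmax φ θ x y / linSoftmax φ θ' x y)| ≤ 2 * ‖θ - θ'‖ := by
  have h1 := abs_le.mp (abs_inner_le_of_norm_le_one (v := θ - θ') (hφ x y))
  have h2 := log_partition_sub_le hφ θ θ' x
  have h3 := log_partition_sub_le hφ θ' θ x
  rw [norm_sub_rev θ' θ] at h3
  rw [log_linSoftmax_div, abs_le]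
  constructor <;> linarith [h1.1, h1.2]

/-- Comparison with the parameter `0`, whose model is uniform. -/
theorem abs_log_linSoftmax_le [Nonempty Y] (hφ : ∀ x y, ‖φ x y‖ ≤ 1)
    (θ : EuclideanSpace ℝ (Fin d)) (x : X) (y : Y) :
    |Real.log (linSoftmax φ θ x y)| ≤ 2 * ‖θ‖ + Real.log (Fintype.card Y) := by
  have h1 := abs_log_linSoftmax_div_le hφ θ 0 x y
  rw [Real.log_div (linSoftmax_pos _ _ _).ne' (linSoftmax_pos _ _ _).ne', sub_zero] at h1
  have h2 : Real.log (linSoftmax φ 0 x y) = - Real.log (Fintype.card Y) := by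
    simp [linSoftmax]
  rw [h2] at h1
  have h3 : 0 ≤ Real.log (Fintype.card Y) := Real.log_natCast_nonneg _
  rw [abs_le] at h1 ⊢
  constructor <;> linarith [h1.1, h1.2]

theorem measurable_linSoftmax [MeasurableSpace X] (hφ : ∀ y, Measurable fun x => φ x y)
    (θ : EuclideanSpace ℝ (Fin d)) (y : Y) : Measurable fun x => linSoftmax φ θ x y := by
  have : ∀ y, Measurable fun x => Real.exp (inner ℝ (φ x y) θ) := fun y =>
    ((hφ y).inner measurable_const).exp
  exact (this y).div (Finset.measurable_sum _ fun y' _ => this y')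

theorem linSoftmax_le_one [Nonempty Y] (θ : EuclideanSpace ℝ (Fin d)) (x : X) (y : Y) :
    linSoftmax φ θ x y ≤ 1 := by
  rw [← sum_linSoftmax (φ := φ) θ x]
  exact Finset.single_le_sum (fun y _ => (linSoftmax_pos θ x y).le) (Finset.mem_univ y)

/-- The parameter of the optimal KL-regularized policy `∝ πb ^ (1 + 1/β)`. -/
theorem log_linSoftmax_tilt [Nonempty Y] {β : ℝ} (hβ : β ≠ 0) (θ θs : EuclideanSpace ℝ (Fin d))
    (x : X) (y : Y) :
    Real.log (linSoftmax φ θs x y) -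
        β * Real.log (linSoftmax φ θ x y / linSoftmax φ θs x y) =
      (β * Real.log (partition φ ((1 + 1 / β) • θs) x) -
        (1 + β) * Real.log (partition φ θs x)) -
        β * Real.log (linSoftmax φ θ x y / linSoftmax φ ((1 + 1 / β) • θs) x y) := by
  rw [log_linSoftmax_div, log_linSoftmax_div, log_linSoftmax, inner_sub_right, inner_sub_right,
    real_inner_smul_right]
  field_simp
  ring

end Softmax

/-! ### Relative entropy of finite distributions -/

/-- The Donsker-Varadhan lower bound, in its linearized form. -/
theorem sum_mul_log_div_ge {Y : Type*} [Fintype Y] {p q : Y → ℝ} (hp : ∀ y, 0 < p y)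
    (hq : ∀ y, 0 < q y) (hp1 : ∑ y, p y = 1) (g : Y → ℝ) :
    ∑ y, p y * g y + 1 - ∑ y, q y * Real.exp (g y) ≤ ∑ y, p y * Real.log (p y / q y) := by
  rw [← hp1, ← Finset.sum_add_distrib, ← Finset.sum_sub_distrib]
  refine Finset.sum_le_sum fun y _ => ?_
  -- The inequality `log t ≤ t - 1` at `t = q e^g / p`, weighted by `p`, is the claim term by term.
  have h := Real.log_le_sub_one_of_pos
    (show 0 < q y * Real.exp (g y) / p y from by have := hp y; have := hq y; positivity)
  rw [Real.log_div (mul_pos (hq y) (Real.exp_pos _)).ne' (hp y).ne',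
    Real.log_mul (hq y).ne' (Real.exp_pos _).ne', Real.log_exp] at h
  rw [Real.log_div (hp y).ne' (hq y).ne']
  have h2 := mul_le_mul_of_nonneg_left h (hp y).le
  have h3 : p y * (q y * Real.exp (g y) / p y - 1) = q y * Real.exp (g y) - p y := by
    have := (hp y).ne'
    field_simp
  rw [h3] at h2
  linarith

theorem sum_mul_log_div_nonneg {Y : Type*} [Fintype Y] {p q : Y → ℝ} (hp : ∀ y, 0 < p y)
    (hq : ∀ y, 0 < q y) (hp1 : ∑ y, p y = 1) (hq1 : ∑ y, q y = 1) :
    0 ≤ ∑ y, p y * Real.log (p y / q y) := by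
  have := sum_mul_log_div_ge hp hq hp1 fun _ => 0
  simpa [hq1] using this

theorem mass_add_mass_compl {X Y : Type*} [Fintype Y] (π : Model X Y) (x : X) (S : Set Y) :
    mass π x S + mass π x Sᶜ = ∑ y, π x y := by
  rw [mass, mass, ← Finset.sum_add_distrib]
  exact Finset.sum_congr rfl fun y _ => congrFun (Set.indicator_self_add_compl S (π x)) y

/-- Testing the Donsker-Varadhan bound with `log 2` times the indicator of `Sᶜ` gives `p(Sᶜ) log 2 -
q(Sᶜ)`, which exceeds `δ (log 2 - 1/2)`. -/
theorem klDiv_ge_of_mass_lt {X Y : Type*} [Fintype Y] {p q : Model X Y} {x : X} {S : Set Y} {δ : ℝ}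
    (hδ : 0 < δ) (hp : ∀ y, 0 < p x y) (hq : ∀ y, 0 < q x y) (hp1 : ∑ y, p x y = 1)
    (hq1 : ∑ y, q x y = 1) (hqS : mass q x Sᶜ ≤ δ / 2) (hpS : mass p x S < 1 - δ) :
    δ / 10 ≤ ∑ y, p x y * Real.log (p x y / q x y) := by
  classical
  have h := sum_mul_log_div_ge hp hq hp1 (Sᶜ.indicator fun _ => Real.log 2)
  have h1 : ∑ y, p x y * Sᶜ.indicator (fun _ => Real.log 2) y = mass p x Sᶜ * Real.log 2 := by
    rw [mass, Finset.sum_mul]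
    refine Finset.sum_congr rfl fun y _ => ?_
    by_cases hy : y ∈ Sᶜ <;> simp only [Set.indicator_of_mem, Set.indicator_of_notMem, hy,
      not_false_eq_true, mul_zero, zero_mul]
  have h2 : ∑ y, q x y * Real.exp (Sᶜ.indicator (fun _ => Real.log 2) y) =
      1 + mass q x Sᶜ := by
    rw [mass, ← hq1, ← Finset.sum_add_distrib]
    refine Finset.sum_congr rfl fun y _ => ?_
    by_cases hy : y ∈ Sᶜ
    · rw [Set.indicator_of_mem hy, Set.indicator_of_mem hy, Real.exp_log two_pos]; ring
    · rw [Set.indicator_of_notMem hy, Set.indicator_of_notMem hy, Real.exp_zero]; ring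
  have h3 := mass_add_mass_compl p x S
  have := Real.log_two_gt_d9
  rw [h1, h2] at h
  nlinarith

/-! ### Sharpening from a small divergence to the optimal policy -/

section Margin

variable {X Y : Type*} [Fintype Y] {d : ℕ} {φ : X → Y → EuclideanSpace ℝ (Fin d)}

theorem half_le_log_one_add {γ : ℝ} (hγ : 0 < γ) (hγ1 : γ < 1) : γ / 2 ≤ Real.log (1 + γ) := by
  have h := Real.one_sub_inv_le_log_of_pos (show 0 < 1 + γ by linarith)
  have : γ / 2 ≤ 1 - (1 + γ)⁻¹ := by
    rw [div_le_iff₀ two_pos]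
    have h1 : (1 + γ)⁻¹ * (1 + γ) = 1 := inv_mul_cancel₀ (by linarith)
    nlinarith [inv_pos.mpr (show 0 < 1 + γ by linarith)]
  linarith

/-- The margin, in terms of the parameter of the base model. -/
theorem inner_sub_le_of_margin [Nonempty Y] {θs : EuclideanSpace ℝ (Fin d)} {γ : ℝ} (hγ : 0 < γ)
    {x : X} (hm : ∀ y' ∉ argmaxSet (linSoftmax φ θs) x,
      (1 + γ) * linSoftmax φ θs x y' ≤ ⨆ y, linSoftmax φ θs x y) :
    ∃ y₀, ∀ y' ∉ argmaxSet (linSoftmax φ θs) x,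
      Real.log (1 + γ) ≤ inner ℝ (φ x y₀ - φ x y') θs := by
  obtain ⟨y₀, hy₀⟩ := Finite.exists_max (linSoftmax φ θs x)
  refine ⟨y₀, fun y' hy' => ?_⟩
  have h := (hm y' hy').trans (ciSup_le hy₀)
  have h2 := Real.log_le_log (mul_pos (by linarith) (linSoftmax_pos θs x y')) h
  rw [Real.log_mul (by linarith) (linSoftmax_pos _ _ _).ne', log_linSoftmax, log_linSoftmax] at h2
  rw [inner_sub_left]
  linarith

/-- This is what `β` is tuned for: the tilt raises the margin `1 + γ` to the power `1 + 1/β`, and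
`(1/β) (γ/2) = log (2N/δ)`. Each non-maximal response keeps at most `δ/(2N)`. -/
theorem mass_compl_argmax_le [Nonempty Y] {θs : EuclideanSpace ℝ (Fin d)} {γ δ : ℝ} (hγ : 0 < γ)
    (hγ1 : γ < 1) (hδ : 0 < δ) (hδ1 : δ < 1) {x : X}
    (hm : ∀ y' ∉ argmaxSet (linSoftmax φ θs) x,
      (1 + γ) * linSoftmax φ θs x y' ≤ ⨆ y, linSoftmax φ θs x y) :
    mass (linSoftmax φ ((1 + 1 / xpoBeta (Fintype.card Y) δ γ) • θs)) x
      (argmaxSet (linSoftmax φ θs) x)ᶜ ≤ δ / 2 := by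
  obtain ⟨y₀, hy₀⟩ := inner_sub_le_of_margin hγ hm
  set N := Fintype.card Y
  have hN : (1 : ℝ) ≤ N := by exact_mod_cast Fintype.card_pos
  set θ := (1 + 1 / xpoBeta N δ γ) • θs with hθ
  have hL : 0 < Real.log (2 * N / δ) := Real.log_pos (by rw [lt_div_iff₀ hδ]; linarith)
  have hpt : ∀ y, (argmaxSet (linSoftmax φ θs) x)ᶜ.indicator (linSoftmax φ θ x) y ≤
      δ / (2 * N) := by
    intro y
    by_cases hy : y ∈ (argmaxSet (linSoftmax φ θs) x)ᶜ
    · rw [Set.indicator_of_mem hy]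
      have h1 := hy₀ y hy
      have h2 := half_le_log_one_add hγ hγ1
      have h3 : Real.log (linSoftmax φ θ x y) ≤ Real.log (δ / (2 * N)) := by
        have h4 : Real.log (linSoftmax φ θ x y₀) ≤ 0 :=
          Real.log_nonpos (linSoftmax_pos _ _ _).le (linSoftmax_le_one _ _ _)
        have h5 : Real.log (linSoftmax φ θ x y₀) - Real.log (linSoftmax φ θ x y) =
            (1 + 1 / xpoBeta N δ γ) * inner ℝ (φ x y₀ - φ x y) θs := by
          rw [log_linSoftmax, log_linSoftmax, inner_sub_left, hθ, real_inner_smul_right,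
            real_inner_smul_right]
          ring
        have h6 : Real.log (δ / (2 * N)) = - Real.log (2 * N / δ) := by
          rw [← Real.log_inv, inv_div]
        have h7 : Real.log (2 * N / δ) ≤
            (1 + 1 / xpoBeta N δ γ) * inner ℝ (φ x y₀ - φ x y) θs := by
          calc Real.log (2 * N / δ) = 1 / xpoBeta N δ γ * (γ / 2) := by
                rw [xpoBeta]; field_simp
            _ ≤ (1 + 1 / xpoBeta N δ γ) * inner ℝ (φ x y₀ - φ x y) θs := by
                have : 0 < xpoBeta N δ γ := by rw [xpoBeta]; positivity
                have : 0 < 1 / xpoBeta N δ γ := by positivity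
                refine mul_le_mul ?_ ?_ ?_ ?_ <;> linarith
        linarith
      exact (Real.log_le_log_iff (linSoftmax_pos _ _ _) (by positivity)).mp h3
    · rw [Set.indicator_of_notMem hy]; positivity
  calc mass (linSoftmax φ θ) x _ ≤ ∑ _y : Y, δ / (2 * N) := Finset.sum_le_sum fun y _ => hpt y
    _ = δ / 2 := by
      rw [Finset.sum_const, Finset.card_univ, nsmul_eq_mul]
      field_simp
      rfl

variable [MeasurableSpace X]

/-- The expected divergence `E_{x ∼ μ} KL(π(· ∣ x) ‖ π'(· ∣ x))`. -/
def klExpect (μ : Measure X) (π π' : Model X Y) : ℝ :=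
  expect μ π fun x y => Real.log (π x y / π' x y)

theorem integrable_of_bounded {μ : Measure X} [IsFiniteMeasure μ] {f : X → ℝ} (hf : Measurable f)
    (C : ℝ) (hC : ∀ x, |f x| ≤ C) : Integrable f μ :=
  Integrable.of_bound hf.aestronglyMeasurable C (Filter.Eventually.of_forall hC)

theorem abs_sum_mul_le {p f : Y → ℝ} (hp : ∀ y, 0 ≤ p y) (hp1 : ∑ y, p y = 1) {C : ℝ}
    (hf : ∀ y, |f y| ≤ C) : |∑ y, p y * f y| ≤ C := by
  calc _ ≤ ∑ y, |p y * f y| := Finset.abs_sum_le_sum_abs _ _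
    _ ≤ ∑ y, p y * C := Finset.sum_le_sum fun y _ => by
        rw [abs_mul, abs_of_nonneg (hp y)]; exact mul_le_mul_of_nonneg_left (hf y) (hp y)
    _ = C := by rw [← Finset.sum_mul, hp1, one_mul]

theorem measurable_log_linSoftmax_div (hφm : ∀ y, Measurable fun x => φ x y)
    (θ θ' : EuclideanSpace ℝ (Fin d)) (y : Y) :
    Measurable fun x => Real.log (linSoftmax φ θ x y / linSoftmax φ θ' x y) :=
  ((measurable_linSoftmax hφm θ y).div (measurable_linSoftmax hφm θ' y)).log

theorem integrable_expect [Nonempty Y] (μ : Measure X) [IsFiniteMeasure μ]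
    (hφm : ∀ y, Measurable fun x => φ x y) (θ : EuclideanSpace ℝ (Fin d)) {f : X → Y → ℝ}
    (hf : ∀ y, Measurable fun x => f x y) {C : ℝ} (hC : ∀ x y, |f x y| ≤ C) :
    Integrable (fun x => ∑ y, linSoftmax φ θ x y * f x y) μ :=
  integrable_of_bounded (Finset.measurable_sum _ fun y _ =>
      (measurable_linSoftmax hφm θ y).mul (hf y)) C fun x =>
    abs_sum_mul_le (fun y => (linSoftmax_pos θ x y).le) (sum_linSoftmax θ x) (hC x)

/-- By Markov's inequality the divergence at `x` reaches `δ/10` with probability at most `ε`; at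
almost every other prompt, `klDiv_ge_of_mass_lt` leaves no room for mass below `1 - δ`. -/
theorem isSharpened_of_klExpect_le [Nonempty Y] {μ : Measure X} [IsProbabilityMeasure μ]
    (hφm : ∀ y, Measurable fun x => φ x y) (hφ : ∀ x y, ‖φ x y‖ ≤ 1)
    {θ θs : EuclideanSpace ℝ (Fin d)} {γ δ ε : ℝ} (hγ : 0 < γ)
    (hγ1 : γ < 1) (hδ : 0 < δ) (hδ1 : δ < 1)
    (hm : MarginCondition μ (linSoftmax φ θs) γ)
    (hkl : klExpect μ (linSoftmax φ θ)
      (linSoftmax φ ((1 + 1 / xpoBeta (Fintype.card Y) δ γ) • θs)) ≤ ε * δ / 10) :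
    IsSharpened μ (linSoftmax φ θs) ε δ (linSoftmax φ θ) := by
  set θb := (1 + 1 / xpoBeta (Fintype.card Y) δ γ) • θs
  set F : X → ℝ := fun x => ∑ y, linSoftmax φ θ x y *
    Real.log (linSoftmax φ θ x y / linSoftmax φ θb x y) with hF
  have hint : Integrable F μ := integrable_expect μ hφm θ
    (fun y => measurable_log_linSoftmax_div hφm θ θb y)
    fun x y => abs_log_linSoftmax_div_le hφ θ θb x y
  have hmeas : Measurable F := Finset.measurable_sum _ fun y _ =>
      (measurable_linSoftmax hφm θ y).mul (measurable_log_linSoftmax_div hφm θ θb y)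
  have hnn : ∀ x, 0 ≤ F x := fun x => sum_mul_log_div_nonneg (linSoftmax_pos θ x)
    (linSoftmax_pos θb x) (sum_linSoftmax θ x) (sum_linSoftmax θb x)
  have hmark := mul_meas_ge_le_integral_of_nonneg (Filter.Eventually.of_forall hnn) hint (δ / 10)
  have hle : μ.real {x | δ / 10 ≤ F x} ≤ ε := by
    have h1 : δ / 10 * μ.real {x | δ / 10 ≤ F x} ≤ δ / 10 * ε := hmark.trans
      (hkl.trans (le_of_eq (by ring)))
    exact le_of_mul_le_mul_left h1 (by positivity)
  have hms : MeasurableSet {x | δ / 10 ≤ F x} := measurableSet_le measurable_const hmeas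
  have hc : ENNReal.ofReal (1 - ε) ≤ μ {x | δ / 10 ≤ F x}ᶜ := by
    rw [← ofReal_measureReal, probReal_compl_eq_one_sub hms]
    exact ENNReal.ofReal_le_ofReal (by linarith)
  refine hc.trans (measure_mono_ae ?_)
  filter_upwards [hm] with x hx hx2
  by_contra hx3
  change ¬ (1 - δ ≤ mass (linSoftmax φ θ) x (argmaxSet (linSoftmax φ θs) x)) at hx3
  exact hx2 (klDiv_ge_of_mass_lt hδ (linSoftmax_pos θ x) (linSoftmax_pos θb x)
    (sum_linSoftmax θ x) (sum_linSoftmax θb x)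
    (mass_compl_argmax_le hγ hγ1 hδ hδ1 hx) (not_le.mp hx3))

theorem isSharpened_of_argmaxSet_eq_univ {μ : Measure X} [IsProbabilityMeasure μ]
    {π πb : Model X Y} {ε δ : ℝ} (hε : 0 ≤ ε) (hδ : 0 ≤ δ) (hπ : ∀ x, ∑ y, π x y = 1)
    (h : ∀ᵐ x ∂μ, argmaxSet πb x = Set.univ) : IsSharpened μ πb ε δ π := by
  have h1 : μ {x | 1 - δ ≤ mass π x (argmaxSet πb x)} = 1 := by
    rw [← measure_univ (μ := μ)]
    refine measure_congr ?_
    filter_upwards [h] with x hx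
    refine propext (iff_of_true ?_ trivial)
    change 1 - δ ≤ mass π x (argmaxSet πb x)
    rw [hx, mass, Set.indicator_univ, hπ]
    linarith
  rw [IsSharpened, h1, ← ENNReal.ofReal_one]
  exact ENNReal.ofReal_le_ofReal (by linarith)

/-- The margin condition fails for small parameters unless all responses are equally likely. -/
theorem argmaxSet_eq_univ_of_margin [Nonempty Y] {μ : Measure X} (hφ : ∀ x y, ‖φ x y‖ ≤ 1)
    {θs : EuclideanSpace ℝ (Fin d)} {γ : ℝ} (hγ : 0 < γ) (hγ1 : γ < 1)
    (hθ : ‖θs‖ < γ / 4) (hm : MarginCondition μ (linSoftmax φ θs) γ) :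
    ∀ᵐ x ∂μ, argmaxSet (linSoftmax φ θs) x = Set.univ := by
  filter_upwards [hm] with x hx
  obtain ⟨y₀, hy₀⟩ := inner_sub_le_of_margin hγ hx
  refine Set.eq_univ_of_forall fun y => ?_
  by_contra hy
  have h1 := hy₀ y hy
  have h2 := half_le_log_one_add hγ hγ1
  rw [inner_sub_left] at h1
  have h3 := abs_le.mp (abs_inner_le_of_norm_le_one (v := θs) (hφ x y))
  have h4 := abs_le.mp (abs_inner_le_of_norm_le_one (v := θs) (hφ x y₀))
  linarith [h3.1, h4.2]

/-- The summand of the objective equals `-β` times the log-ratio to the tilted model plus a function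
of the prompt alone (`log_linSoftmax_tilt`). Maximizing the objective is thus minimizing a
divergence. -/
theorem klObjective_linSoftmax [Nonempty Y] (μ : Measure X) [IsProbabilityMeasure μ]
    (hφm : ∀ y, Measurable fun x => φ x y) (hφ : ∀ x y, ‖φ x y‖ ≤ 1)
    (θs : EuclideanSpace ℝ (Fin d)) {β : ℝ} (hβ : β ≠ 0) :
    ∃ C : ℝ, ∀ θ, klObjective μ (linSoftmax φ θs) (fun x y => Real.log (linSoftmax φ θs x y)) β
      (linSoftmax φ θ) = C - β * klExpect μ (linSoftmax φ θ)
        (linSoftmax φ ((1 + 1 / β) • θs)) := by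
  set θb := (1 + 1 / β) • θs with hθb
  have hpm : ∀ θ, Measurable (partition φ θ) := fun θ => Finset.measurable_sum _ fun y _ =>
    ((hφm y).inner measurable_const).exp
  set G : X → ℝ := fun x => β * Real.log (partition φ θb x) - (1 + β) * Real.log (partition φ θs x)
    with hG
  refine ⟨∫ x, G x ∂μ, fun θ => ?_⟩
  have hi1 : Integrable (fun x => ∑ y, linSoftmax φ θ x y * Real.log (linSoftmax φ θs x y)) μ :=
    integrable_expect μ hφm θ (fun y => (measurable_linSoftmax hφm θs y).log)
      fun x y => abs_log_linSoftmax_le hφ θs x y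
  have hi2 : ∀ θ', Integrable (fun x => ∑ y, linSoftmax φ θ x y *
      Real.log (linSoftmax φ θ x y / linSoftmax φ θ' x y)) μ := fun θ' =>
    integrable_expect μ hφm θ (fun y => measurable_log_linSoftmax_div hφm θ θ' y)
      fun x y => abs_log_linSoftmax_div_le hφ θ θ' x y
  rw [klObjective, klExpect, expect, expect, expect, ← integral_const_mul,
    ← integral_sub hi1 ((hi2 θs).const_mul β)]
  have heq : ∀ x, (∑ y, linSoftmax φ θ x y * Real.log (linSoftmax φ θs x y)) -
      β * ∑ y, linSoftmax φ θ x y * Real.log (linSoftmax φ θ x y / linSoftmax φ θs x y) =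
      G x - β * ∑ y, linSoftmax φ θ x y *
        Real.log (linSoftmax φ θ x y / linSoftmax φ θb x y) := by
    intro x
    have h1 : G x = ∑ y, linSoftmax φ θ x y * G x := by
      rw [← Finset.sum_mul, sum_linSoftmax, one_mul]
    rw [h1, Finset.mul_sum, Finset.mul_sum, ← Finset.sum_sub_distrib, ← Finset.sum_sub_distrib]
    refine Finset.sum_congr rfl fun y _ => ?_
    have := log_linSoftmax_tilt (φ := φ) hβ θ θs x y
    calc _ = linSoftmax φ θ x y * (Real.log (linSoftmax φ θs x y) -
        β * Real.log (linSoftmax φ θ x y / linSoftmax φ θs x y)) := by ring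
      _ = _ := by rw [this]; ring
  -- The pointwise identity writes `G` as a combination of integrable functions, so the partition
  -- functions need no bounds of their own.
  have hGint : Integrable G μ := by
    have : G = fun x => ((∑ y, linSoftmax φ θ x y * Real.log (linSoftmax φ θs x y)) -
      β * ∑ y, linSoftmax φ θ x y * Real.log (linSoftmax φ θ x y / linSoftmax φ θs x y)) +
      β * ∑ y, linSoftmax φ θ x y *
        Real.log (linSoftmax φ θ x y / linSoftmax φ θb x y) := by
      funext x; rw [heq]; ring
    rw [this]
    exact (hi1.sub ((hi2 θs).const_mul β)).add ((hi2 θb).const_mul β)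
  rw [← integral_const_mul, ← integral_sub hGint ((hi2 θb).const_mul β)]
  exact integral_congr_ae (Filter.Eventually.of_forall heq)

end Margin

/-! ### Adaptively sampled sequences -/

section Adaptive

open ProbabilityTheory

variable {Z : Type*} [MeasurableSpace Z]

/-- The law of the first `t` elements of a sequence whose next element, given the history `D`, is
drawn from `κ t D`. -/
def adaptiveLaw (κ : (t : ℕ) → (Fin t → Z) → Measure Z) : (t : ℕ) → Measure (Fin t → Z)
  | 0 => Measure.dirac Fin.elim0
  | t + 1 => (adaptiveLaw κ t).bind fun D =>
      (κ t D).map fun z => Fin.snoc (α := fun _ => Z) D z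

/-- The first `s` elements of a sequence. -/
def history {T : ℕ} (D : Fin T → Z) (s : ℕ) (hs : s ≤ T) : Fin s → Z :=
  fun j => D (Fin.castLE hs j)

/-- The sum over a sequence of a function of the history and the current element. -/
def adaptedSum (g : (t : ℕ) → (Fin t → Z) → Z → ℝ) {T : ℕ} (D : Fin T → Z) : ℝ :=
  ∑ i : Fin T, g i (history D i i.isLt.le) (D i)

theorem measurable_snoc (t : ℕ) :
    Measurable fun p : (Fin t → Z) × Z => (Fin.snoc (α := fun _ => Z) p.1 p.2 : Fin (t + 1) → Z) := by
  refine measurable_pi_lambda _ fun i => ?_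
  refine Fin.lastCases ?_ (fun i => ?_) i
  · simpa using! measurable_snd
  · simpa using! (measurable_pi_apply i).comp measurable_fst

theorem adaptedSum_snoc {Z : Type*} (g : (t : ℕ) → (Fin t → Z) → Z → ℝ) {T : ℕ} (D : Fin T → Z) (z : Z) :
    adaptedSum g (Fin.snoc (α := fun _ => Z) D z : Fin (T + 1) → Z) =
      adaptedSum g D + g T D z := by
  have hs : ∀ (s : ℕ) (hs : s ≤ T), history (Fin.snoc (α := fun _ => Z) D z : Fin (T + 1) → Z) s
      (hs.trans T.le_succ) = history D s hs := by
    intro s hs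
    funext j
    simp only [history]
    have : Fin.castLE (hs.trans T.le_succ) j = Fin.castSucc (Fin.castLE hs j) := rfl
    rw [this, Fin.snoc_castSucc]
  rw [adaptedSum, Fin.sum_univ_castSucc, adaptedSum]
  congr 1
  · refine Finset.sum_congr rfl fun i _ => ?_
    rw [Fin.snoc_castSucc]
    exact congrFun (congrArg (g i) (hs i i.isLt.le)) _
  · rw [Fin.snoc_last]
    exact congrFun (congrArg (g T) (hs T le_rfl)) z

theorem measurable_history {T : ℕ} (s : ℕ) (hs : s ≤ T) :
    Measurable fun D : Fin T → Z => history D s hs :=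
  measurable_pi_lambda _ fun j => measurable_pi_apply (Fin.castLE hs j)

theorem measurable_adaptedSum {g : (t : ℕ) → (Fin t → Z) → Z → ℝ}
    (hg : ∀ t, Measurable fun p : (Fin t → Z) × Z => g t p.1 p.2) (T : ℕ) :
    Measurable fun D : Fin T → Z => adaptedSum g D :=
  Finset.measurable_sum _ fun i _ => (hg i).comp
    ((measurable_history (i : ℕ) i.isLt.le).prodMk (measurable_pi_apply i))

variable {κ : (t : ℕ) → (Fin t → Z) → Measure Z}

theorem measurable_map_snoc (hκ : ∀ t, Measurable (κ t)) (hκp : ∀ t D, IsProbabilityMeasure (κ t D))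
    (t : ℕ) : Measurable fun D => (κ t D).map fun z => (Fin.snoc (α := fun _ => Z) D z :
      Fin (t + 1) → Z) := by
  refine Measure.measurable_of_measurable_coe _ fun s hs => ?_
  let K : Kernel (Fin t → Z) Z := ⟨κ t, hκ t⟩
  have : IsMarkovKernel K := ⟨hκp t⟩
  have h := Kernel.measurable_kernel_prodMk_left (κ := K) (measurable_snoc t hs)
  convert h using 2 with D
  have hD : Measurable fun z => (Fin.snoc (α := fun _ => Z) D z : Fin (t + 1) → Z) :=
    (measurable_snoc t).comp measurable_prodMk_left
  rw [Measure.map_apply hD hs]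
  rfl

theorem lintegral_adaptiveLaw_succ (hκ : ∀ t, Measurable (κ t))
    (hκp : ∀ t D, IsProbabilityMeasure (κ t D)) (t : ℕ) {f : (Fin (t + 1) → Z) → ℝ≥0∞}
    (hf : Measurable f) :
    ∫⁻ D, f D ∂(adaptiveLaw κ (t + 1)) =
      ∫⁻ D, ∫⁻ z, f (Fin.snoc (α := fun _ => Z) D z) ∂(κ t D) ∂(adaptiveLaw κ t) := by
  rw [adaptiveLaw, Measure.lintegral_bind (measurable_map_snoc hκ hκp t).aemeasurable
    hf.aemeasurable]
  refine lintegral_congr fun D => ?_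
  have hD : Measurable fun z => (Fin.snoc (α := fun _ => Z) D z : Fin (t + 1) → Z) :=
    (measurable_snoc t).comp measurable_prodMk_left
  rw [lintegral_map hf hD]

theorem isProbabilityMeasure_adaptiveLaw (hκ : ∀ t, Measurable (κ t))
    (hκp : ∀ t D, IsProbabilityMeasure (κ t D)) (t : ℕ) :
    IsProbabilityMeasure (adaptiveLaw κ t) := by
  induction t with
  | zero => rw [adaptiveLaw]; infer_instance
  | succ t ih =>
    refine ⟨?_⟩
    rw [← lintegral_one, lintegral_adaptiveLaw_succ hκ hκp t measurable_const]
    simp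

/-- Hoeffding's lemma, in terms of `lintegral`. -/
theorem lintegral_exp_le_of_abs_le {ν : Measure Z} [IsProbabilityMeasure ν] {f : Z → ℝ}
    (hf : Measurable f) {b : ℝ} (hb : ∀ z, |f z| ≤ b) (h0 : ∫ z, f z ∂ν = 0) (l : ℝ) :
    ∫⁻ z, ENNReal.ofReal (Real.exp (l * f z)) ∂ν ≤
      ENNReal.ofReal (Real.exp (b ^ 2 * l ^ 2 / 2)) := by
  have h := hasSubgaussianMGF_of_mem_Icc_of_integral_eq_zero (a := -b) (b := b) (μ := ν)
    hf.aemeasurable (Filter.Eventually.of_forall fun z => abs_le.mp (hb z)) h0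
  rw [← ofReal_integral_eq_lintegral_ofReal (h.integrable_exp_mul l)
    (Filter.Eventually.of_forall fun z => (Real.exp_pos _).le)]
  refine ENNReal.ofReal_le_ofReal ((h.mgf_le l).trans (Real.exp_le_exp.mpr (le_of_eq ?_)))
  -- The interval `[-b, b]` has length `2b`, so the variance proxy is `(2b/2)²`.
  have : (((‖b - -b‖₊ / 2) ^ 2 : NNReal) : ℝ) = b ^ 2 := by
    push_cast
    rw [Real.norm_eq_abs, div_pow, sq_abs]
    ring
  rw [this]

/-- The supermartingale argument behind Azuma's inequality: given the history, the last increment is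
bounded and centered, so by Hoeffding's lemma it contributes one factor `exp (b² l² / 2)`. -/
theorem lintegral_exp_adaptedSum_le (hκ : ∀ t, Measurable (κ t))
    (hκp : ∀ t D, IsProbabilityMeasure (κ t D)) {g : (t : ℕ) → (Fin t → Z) → Z → ℝ}
    (hg : ∀ t, Measurable fun p : (Fin t → Z) × Z => g t p.1 p.2) {b : ℝ}
    (hb : ∀ t D z, |g t D z| ≤ b) (h0 : ∀ t D, ∫ z, g t D z ∂(κ t D) = 0) (l : ℝ) (T : ℕ) :
    ∫⁻ D, ENNReal.ofReal (Real.exp (l * adaptedSum g D)) ∂(adaptiveLaw κ T) ≤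
      ENNReal.ofReal (Real.exp (T * (b ^ 2 * l ^ 2 / 2))) := by
  induction T with
  | zero => simp [adaptiveLaw, adaptedSum]
  | succ T ih =>
    have hm : ∀ T, Measurable fun D : Fin T → Z =>
        ENNReal.ofReal (Real.exp (l * adaptedSum g D)) := fun T =>
      ((measurable_adaptedSum hg T).const_mul l).exp.ennreal_ofReal
    rw [lintegral_adaptiveLaw_succ hκ hκp T (hm (T + 1))]
    have hstep : ∀ D : Fin T → Z, ∫⁻ z, ENNReal.ofReal (Real.exp (l * adaptedSum g
        (Fin.snoc (α := fun _ => Z) D z : Fin (T + 1) → Z))) ∂(κ T D) ≤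
        ENNReal.ofReal (Real.exp (l * adaptedSum g D)) *
          ENNReal.ofReal (Real.exp (b ^ 2 * l ^ 2 / 2)) := by
      intro D
      have hgD : Measurable fun z => g T D z := (hg T).comp measurable_prodMk_left
      have : ∀ z, ENNReal.ofReal (Real.exp (l * adaptedSum g
          (Fin.snoc (α := fun _ => Z) D z : Fin (T + 1) → Z))) =
          ENNReal.ofReal (Real.exp (l * adaptedSum g D)) *
            ENNReal.ofReal (Real.exp (l * g T D z)) := by
        intro z
        rw [adaptedSum_snoc, mul_add, Real.exp_add, ENNReal.ofReal_mul (Real.exp_pos _).le]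
      simp_rw [this]
      rw [lintegral_const_mul _ (hgD.const_mul l).exp.ennreal_ofReal]
      gcongr
      have := hκp T D
      exact lintegral_exp_le_of_abs_le hgD (hb T D) (h0 T D) l
    refine (lintegral_mono hstep).trans ?_
    rw [lintegral_mul_const _ (hm T)]
    refine (mul_le_mul_left ih _).trans ?_
    rw [← ENNReal.ofReal_mul (Real.exp_pos _).le, ← Real.exp_add]
    refine ENNReal.ofReal_le_ofReal (Real.exp_le_exp.mpr (le_of_eq ?_))
    push_cast
    ring

/-- The Azuma-Hoeffding inequality for adaptively sampled sequences. -/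
theorem adaptiveLaw_adaptedSum_ge_le (hκ : ∀ t, Measurable (κ t))
    (hκp : ∀ t D, IsProbabilityMeasure (κ t D)) {g : (t : ℕ) → (Fin t → Z) → Z → ℝ}
    (hg : ∀ t, Measurable fun p : (Fin t → Z) × Z => g t p.1 p.2) {b : ℝ} (hb0 : 0 < b)
    (hb : ∀ t D z, |g t D z| ≤ b) (h0 : ∀ t D, ∫ z, g t D z ∂(κ t D) = 0) {T : ℕ} (hT : 0 < T)
    {s : ℝ} (hs : 0 ≤ s) :
    adaptiveLaw κ T {D | s ≤ adaptedSum g D} ≤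
      ENNReal.ofReal (Real.exp (-(s ^ 2 / (2 * T * b ^ 2)))) := by
  have hT' : (0 : ℝ) < T := by exact_mod_cast hT
  -- The minimizer of the Chernoff exponent `T b² l² / 2 - l s`.
  set l := s / (T * b ^ 2) with hl
  have hl0 : 0 ≤ l := by positivity
  have h1 := lintegral_exp_adaptedSum_le hκ hκp hg hb h0 l T
  have hm : Measurable fun D : Fin T → Z => ENNReal.ofReal (Real.exp (l * adaptedSum g D)) :=
    ((measurable_adaptedSum hg T).const_mul l).exp.ennreal_ofReal
  have h2 := (mul_meas_ge_le_lintegral (μ := adaptiveLaw κ T) hm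
    (ENNReal.ofReal (Real.exp (l * s)))).trans h1
  have h3 : adaptiveLaw κ T {D | s ≤ adaptedSum g D} ≤
      adaptiveLaw κ T {D | ENNReal.ofReal (Real.exp (l * s)) ≤
        ENNReal.ofReal (Real.exp (l * adaptedSum g D))} := by
    refine measure_mono fun D hD => ?_
    exact ENNReal.ofReal_le_ofReal (Real.exp_le_exp.mpr (mul_le_mul_of_nonneg_left hD hl0))
  have h4 : ENNReal.ofReal (Real.exp (-(s ^ 2 / (2 * T * b ^ 2)))) =
      ENNReal.ofReal (Real.exp (-(l * s))) *
        ENNReal.ofReal (Real.exp (T * (b ^ 2 * l ^ 2 / 2))) := by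
    rw [← ENNReal.ofReal_mul (Real.exp_pos _).le, ← Real.exp_add]
    congr 2
    rw [hl]
    field_simp
    ring
  rw [h4]
  refine h3.trans ?_
  calc _ = ENNReal.ofReal (Real.exp (-(l * s))) * (ENNReal.ofReal (Real.exp (l * s)) *
        adaptiveLaw κ T {D | ENNReal.ofReal (Real.exp (l * s)) ≤
        ENNReal.ofReal (Real.exp (l * adaptedSum g D))}) := by
        rw [← mul_assoc, ← ENNReal.ofReal_mul (Real.exp_pos _).le, ← Real.exp_add]
        simp
    _ ≤ _ := by gcongr

end Adaptive

/-! ### The sampling laws of XPO -/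

section Laws

variable {X Y : Type*} [MeasurableSpace X] [MeasurableSpace Y] [Fintype Y]

theorem trainLaw_eq_adaptiveLaw (μ : Measure X) (πb : Model X Y)
    (A : (t : ℕ) → (Fin t → X × Y × Y) → Model X Y) (T : ℕ) :
    trainLaw μ πb A T = adaptiveLaw (fun t D => tripleLaw μ (A t D) πb) T := by
  induction T with
  | zero => rfl
  | succ T ih => rw [trainLaw, ih, adaptiveLaw]

theorem measurable_triple {X Y : Type*} [MeasurableSpace X] [MeasurableSpace Y] (y y' : Y) :
    Measurable fun x : X => (x, y, y') :=
  measurable_id.prodMk measurable_const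

theorem lintegral_tripleLaw (μ : Measure X) {π πb : Model X Y}
    (hπ : ∀ y, Measurable fun x => π x y) (hπb : ∀ y, Measurable fun x => πb x y)
    {f : X × Y × Y → ℝ≥0∞} (hf : Measurable f) :
    ∫⁻ z, f z ∂(tripleLaw μ π πb) =
      ∑ y, ∑ y', ∫⁻ x, ENNReal.ofReal (π x y * πb x y') * f (x, y, y') ∂μ := by
  rw [tripleLaw, lintegral_finsetSum_measure]
  refine Finset.sum_congr rfl fun y _ => ?_
  rw [lintegral_finsetSum_measure]
  refine Finset.sum_congr rfl fun y' _ => ?_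
  have hp : Measurable fun x => ENNReal.ofReal (π x y * πb x y') :=
    ((hπ y).mul (hπb y')).ennreal_ofReal
  rw [lintegral_map hf (measurable_triple y y')]
  exact lintegral_withDensity_eq_lintegral_mul _ hp (hf.comp (measurable_triple y y'))

theorem lintegral_pairLaw (μ : Measure X) {π : Model X Y}
    (hπ : ∀ y, Measurable fun x => π x y) {f : X × Y → ℝ≥0∞} (hf : Measurable f) :
    ∫⁻ z, f z ∂(pairLaw μ π) = ∑ y, ∫⁻ x, ENNReal.ofReal (π x y) * f (x, y) ∂μ := by
  rw [pairLaw, lintegral_finsetSum_measure]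
  refine Finset.sum_congr rfl fun y _ => ?_
  have hy : Measurable fun x : X => (x, y) := measurable_id.prodMk measurable_const
  rw [lintegral_map hf hy]
  exact lintegral_withDensity_eq_lintegral_mul _ (hπ y).ennreal_ofReal (hf.comp hy)

theorem isProbabilityMeasure_tripleLaw (μ : Measure X) [IsProbabilityMeasure μ] {π πb : Model X Y}
    (hπ : ∀ y, Measurable fun x => π x y) (hπb : ∀ y, Measurable fun x => πb x y)
    (hπ0 : ∀ x y, 0 ≤ π x y) (hπb0 : ∀ x y, 0 ≤ πb x y)
    (hπ1 : ∀ x, ∑ y, π x y = 1) (hπb1 : ∀ x, ∑ y, πb x y = 1) :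
    IsProbabilityMeasure (tripleLaw μ π πb) := by
  refine ⟨?_⟩
  rw [← lintegral_one, lintegral_tripleLaw μ hπ hπb measurable_const]
  have hm : ∀ y y', Measurable fun x => ENNReal.ofReal (π x y * πb x y') := fun y y' =>
    ((hπ y).mul (hπb y')).ennreal_ofReal
  simp_rw [mul_one]
  simp_rw [← lintegral_finsetSum Finset.univ fun y' _ => hm _ y']
  rw [← lintegral_finsetSum Finset.univ fun y _ =>
    Finset.measurable_sum Finset.univ fun y' _ => hm y y']
  have : ∀ x, ∑ y, ∑ y', ENNReal.ofReal (π x y * πb x y') = 1 := by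
    intro x
    have : ∀ y, ∑ y', ENNReal.ofReal (π x y * πb x y') = ENNReal.ofReal (π x y) := by
      intro y
      rw [← ENNReal.ofReal_sum_of_nonneg fun y' _ => mul_nonneg (hπ0 x y) (hπb0 x y'),
        ← Finset.mul_sum, hπb1, mul_one]
    simp_rw [this]
    rw [← ENNReal.ofReal_sum_of_nonneg fun y _ => hπ0 x y, hπ1, ENNReal.ofReal_one]
  simp [this]

theorem isProbabilityMeasure_pairLaw (μ : Measure X) [IsProbabilityMeasure μ] {π : Model X Y}
    (hπ : ∀ y, Measurable fun x => π x y) (hπ0 : ∀ x y, 0 ≤ π x y) (hπ1 : ∀ x, ∑ y, π x y = 1) :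
    IsProbabilityMeasure (pairLaw μ π) := by
  refine ⟨?_⟩
  rw [← lintegral_one, lintegral_pairLaw μ hπ measurable_const]
  simp_rw [mul_one]
  rw [← lintegral_finsetSum Finset.univ fun y _ => (hπ y).ennreal_ofReal]
  have : ∀ x, ∑ y, ENNReal.ofReal (π x y) = 1 := fun x => by
    rw [← ENNReal.ofReal_sum_of_nonneg fun y _ => hπ0 x y, hπ1, ENNReal.ofReal_one]
  simp [this]

theorem integrable_mul_of_bounded {μ : Measure X} [IsFiniteMeasure μ] {p f : X → ℝ}
    (hp : Measurable p) (hf : Measurable f) (hp0 : ∀ x, 0 ≤ p x) (hp1 : ∀ x, p x ≤ 1)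
    {C : ℝ} (hC : ∀ x, |f x| ≤ C) : Integrable (fun x => p x * f x) μ :=
  integrable_of_bounded (hp.mul hf) C fun x => by
    rw [abs_mul, abs_of_nonneg (hp0 x)]
    exact (mul_le_of_le_one_left (abs_nonneg _) (hp1 x)).trans (hC x)

theorem integral_map_withDensity {W : Type*} [MeasurableSpace W] (μ : Measure X)
    {p : X → ℝ} (hp : Measurable p) (hp0 : ∀ x, 0 ≤ p x) {e : X → W} (he : Measurable e)
    {f : W → ℝ} (hf : Measurable f) :
    ∫ z, f z ∂((μ.withDensity fun x => ENNReal.ofReal (p x)).map e) = ∫ x, p x * f (e x) ∂μ := by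
  rw [integral_map he.aemeasurable hf.aestronglyMeasurable,
    integral_withDensity_eq_integral_toReal_smul hp.ennreal_ofReal
      (Filter.Eventually.of_forall fun x => ENNReal.ofReal_lt_top)]
  refine integral_congr_ae (Filter.Eventually.of_forall fun x => ?_)
  simp [ENNReal.toReal_ofReal (hp0 x)]

theorem integrable_map_withDensity {W : Type*} [MeasurableSpace W] (μ : Measure X)
    [IsFiniteMeasure μ] {p : X → ℝ} (hp1 : ∀ x, p x ≤ 1) {e : X → W} {f : W → ℝ} (hf : Measurable f) {C : ℝ} (hC : ∀ z, |f z| ≤ C) :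
    Integrable f ((μ.withDensity fun x => ENNReal.ofReal (p x)).map e) := by
  have : IsFiniteMeasure (μ.withDensity fun x => ENNReal.ofReal (p x)) := by
    refine isFiniteMeasure_withDensity (ne_of_lt ?_)
    calc ∫⁻ x, ENNReal.ofReal (p x) ∂μ ≤ ∫⁻ _, 1 ∂μ := lintegral_mono fun x => by
          simpa using hp1 x
      _ < ∞ := by simp
  exact integrable_of_bounded hf C hC

theorem integral_tripleLaw (μ : Measure X) [IsProbabilityMeasure μ] {π πb : Model X Y}
    (hπ : ∀ y, Measurable fun x => π x y) (hπb : ∀ y, Measurable fun x => πb x y)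
    (hπ0 : ∀ x y, 0 ≤ π x y) (hπb0 : ∀ x y, 0 ≤ πb x y)
    (hπ1 : ∀ x y, π x y ≤ 1) (hπb1 : ∀ x y, πb x y ≤ 1)
    {f : X × Y × Y → ℝ} (hf : Measurable f) {C : ℝ} (hC : ∀ z, |f z| ≤ C) :
    ∫ z, f z ∂(tripleLaw μ π πb) =
      ∫ x, ∑ y, ∑ y', π x y * πb x y' * f (x, y, y') ∂μ := by
  have hm : ∀ y y', Measurable fun x => π x y * πb x y' := fun y y' => (hπ y).mul (hπb y')
  have h0 : ∀ y y' x, 0 ≤ π x y * πb x y' := fun y y' x => mul_nonneg (hπ0 x y) (hπb0 x y')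
  have h1 : ∀ y y' x, π x y * πb x y' ≤ 1 := fun y y' x =>
    mul_le_one₀ (hπ1 x y) (hπb0 x y') (hπb1 x y')
  have hi : ∀ y y', Integrable (fun x => π x y * πb x y' * f (x, y, y')) μ := fun y y' =>
    integrable_mul_of_bounded (hm y y') (hf.comp (measurable_triple y y')) (h0 y y') (h1 y y')
      fun x => hC (x, y, y')
  have hi' : ∀ y y', Integrable f ((μ.withDensity fun x => ENNReal.ofReal
      (π x y * πb x y')).map fun x => (x, y, y')) := fun y y' =>
    integrable_map_withDensity μ (h1 y y') hf hC
  rw [tripleLaw, integral_finsetSum_measure fun y _ =>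
    integrable_finsetSum_measure.mpr fun y' _ => hi' y y',
    integral_finsetSum _ fun y _ => integrable_finsetSum _ fun y' _ => hi y y']
  refine Finset.sum_congr rfl fun y _ => ?_
  rw [integral_finsetSum_measure fun y' _ => hi' y y', integral_finsetSum _ fun y' _ => hi y y']
  exact Finset.sum_congr rfl fun y' _ =>
    integral_map_withDensity μ (hm y y') (h0 y y') (measurable_triple y y') hf

theorem integral_pairLaw (μ : Measure X) [IsProbabilityMeasure μ] {π : Model X Y}
    (hπ : ∀ y, Measurable fun x => π x y) (hπ0 : ∀ x y, 0 ≤ π x y)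
    (hπ1 : ∀ x y, π x y ≤ 1) {f : X → Y → ℝ} (hf : Measurable fun z : X × Y => f z.1 z.2) {C : ℝ}
    (hC : ∀ x y, |f x y| ≤ C) :
    ∫ z, f z.1 z.2 ∂(pairLaw μ π) = expect μ π f := by
  have he : ∀ y : Y, Measurable fun x : X => (x, y) := fun y =>
    measurable_id.prodMk measurable_const
  have hfy : ∀ y, Measurable fun x => f x y := fun y => hf.comp (he y)
  rw [pairLaw, integral_finsetSum_measure fun y _ => integrable_map_withDensity μ
    (fun x => hπ1 x y) hf (fun z => hC z.1 z.2), expect,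
    integral_finsetSum _ fun y _ => integrable_mul_of_bounded (hπ y) (hfy y)
      (fun x => hπ0 x y) (fun x => hπ1 x y) (fun x => hC x y)]
  exact Finset.sum_congr rfl fun y _ =>
    integral_map_withDensity μ (hπ y) (fun x => hπ0 x y) (he y) hf

/-- This makes the sampling step a genuine kernel in the history, as iterating `Measure.bind`
requires; the joint measurability demanded of the update rule enters here. -/
theorem measurable_tripleLaw {H : Type*} [MeasurableSpace H] (μ : Measure X) [SFinite μ]
    {π : H → Model X Y} {πb : Model X Y} (hπ : ∀ y, Measurable fun p : H × X => π p.1 p.2 y)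
    (hπb : ∀ y, Measurable fun x => πb x y) :
    Measurable fun D => tripleLaw μ (π D) πb := by
  refine Measure.measurable_of_measurable_coe _ fun s hs => ?_
  have : ∀ D, tripleLaw μ (π D) πb s =
      ∑ y, ∑ y', ∫⁻ x, ENNReal.ofReal (π D x y * πb x y') * s.indicator 1 (x, y, y') ∂μ := by
    intro D
    have hD : ∀ y, Measurable fun x => π D x y := fun y => (hπ y).comp measurable_prodMk_left
    rw [← lintegral_indicator_one hs,
      lintegral_tripleLaw μ hD hπb (measurable_one.indicator hs)]
  simp_rw [this]
  refine Finset.measurable_sum _ fun y _ => Finset.measurable_sum _ fun y' _ => ?_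
  refine Measurable.lintegral_prod_right' (f := fun p : H × X =>
    ENNReal.ofReal (π p.1 p.2 y * πb p.2 y') * s.indicator 1 (p.2, y, y')) ?_
  exact ((hπ y).mul ((hπb y').comp measurable_snd)).ennreal_ofReal.mul
    ((measurable_one.indicator hs).comp ((measurable_triple y y').comp measurable_snd))

end Laws

/-! ### The elliptic potential -/

section Elliptic

open Matrix

variable {d : ℕ}

/-- The regularized empirical covariance `4 I + ∑_{i < s} ψ_i ψ_iᵀ`. -/
def ridge (ψ : ℕ → Fin d → ℝ) (s : ℕ) : Matrix (Fin d) (Fin d) ℝ :=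
  (4 : ℝ) • 1 + ∑ i ∈ Finset.range s, vecMulVec (ψ i) (ψ i)

theorem ridge_succ (ψ : ℕ → Fin d → ℝ) (s : ℕ) :
    ridge ψ (s + 1) = ridge ψ s + vecMulVec (ψ s) (ψ s) := by
  rw [ridge, ridge, Finset.sum_range_succ, add_assoc]

theorem dotProduct_ridge_mulVec (ψ : ℕ → Fin d → ℝ) (s : ℕ) (v : Fin d → ℝ) :
    v ⬝ᵥ (ridge ψ s *ᵥ v) = 4 * (v ⬝ᵥ v) + ∑ i ∈ Finset.range s, (ψ i ⬝ᵥ v) ^ 2 := by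
  induction s with
  | zero => simp [ridge, smul_mulVec]
  | succ s ih =>
    rw [ridge_succ, add_mulVec, dotProduct_add, ih, Finset.sum_range_succ, vecMulVec_mulVec]
    simp [dotProduct_comm v (ψ s)]
    ring

theorem ridge_transpose (ψ : ℕ → Fin d → ℝ) (s : ℕ) : (ridge ψ s)ᵀ = ridge ψ s := by
  simp [ridge, transpose_sum, transpose_vecMulVec]

theorem ridge_posDef (ψ : ℕ → Fin d → ℝ) (s : ℕ) : (ridge ψ s).PosDef := by
  refine PosDef.of_dotProduct_mulVec_pos ?_ fun v hv => ?_
  · rw [IsHermitian, conjTranspose_eq_transpose_of_trivial, ridge_transpose]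
  · rw [star_trivial, dotProduct_ridge_mulVec]
    have : 0 < v ⬝ᵥ v := by simpa using (dotProduct_star_self_pos_iff (v := v)).mpr hv
    have : 0 ≤ ∑ i ∈ Finset.range s, (ψ i ⬝ᵥ v) ^ 2 := Finset.sum_nonneg fun i _ => sq_nonneg _
    linarith

/-- The squared norm of `ψ_s` in the metric given by the inverse of `ridge ψ s`. -/
def ellipticNorm (ψ : ℕ → Fin d → ℝ) (s : ℕ) : ℝ := ψ s ⬝ᵥ ((ridge ψ s)⁻¹ *ᵥ ψ s)

theorem ridge_mulVec_inv (ψ : ℕ → Fin d → ℝ) (s : ℕ) (v : Fin d → ℝ) :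
    ridge ψ s *ᵥ ((ridge ψ s)⁻¹ *ᵥ v) = v := by
  rw [mulVec_mulVec, mul_nonsing_inv _ (ridge_posDef ψ s).det_pos.ne'.isUnit, one_mulVec]

theorem dotProduct_ridge_comm (ψ : ℕ → Fin d → ℝ) (s : ℕ) (v w : Fin d → ℝ) :
    v ⬝ᵥ (ridge ψ s *ᵥ w) = w ⬝ᵥ (ridge ψ s *ᵥ v) := by
  rw [dotProduct_mulVec, ← mulVec_transpose, ridge_transpose, dotProduct_comm]

/-- Young's inequality in the metric of `V = ridge ψ s`: expand the nonnegative form of `V` at `η v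
- V⁻¹ ψ_s`. -/
theorem dotProduct_le_ellipticNorm (ψ : ℕ → Fin d → ℝ) (s : ℕ) (v : Fin d → ℝ) {η : ℝ}
    (hη : 0 < η) :
    ψ s ⬝ᵥ v ≤ η / 2 * (v ⬝ᵥ (ridge ψ s *ᵥ v)) + ellipticNorm ψ s / (2 * η) := by
  set w := (ridge ψ s)⁻¹ *ᵥ ψ s with hw
  have h := (ridge_posDef ψ s).posSemidef.dotProduct_mulVec_nonneg (η • v - w)
  rw [star_trivial, mulVec_sub, mulVec_smul, hw, ridge_mulVec_inv, ← hw, dotProduct_sub,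
    sub_dotProduct, sub_dotProduct, smul_dotProduct, smul_dotProduct, dotProduct_smul,
    dotProduct_smul, dotProduct_ridge_comm ψ s w v, hw, ridge_mulVec_inv, ← hw,
    dotProduct_comm v (ψ s), dotProduct_comm w (ψ s)] at h
  have h2 : ellipticNorm ψ s = ψ s ⬝ᵥ w := rfl
  simp only [smul_eq_mul] at h
  have h3 : ψ s ⬝ᵥ v * (2 * η) ≤
      (η / 2 * (v ⬝ᵥ (ridge ψ s *ᵥ v)) + ellipticNorm ψ s / (2 * η)) * (2 * η) := by
    rw [add_mul, div_mul_cancel₀ _ (by positivity), h2]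
    linarith
  exact le_of_mul_le_mul_right h3 (by positivity)

theorem ellipticNorm_eq (ψ : ℕ → Fin d → ℝ) (s : ℕ) :
    ellipticNorm ψ s = ((ridge ψ s)⁻¹ *ᵥ ψ s) ⬝ᵥ (ridge ψ s *ᵥ ((ridge ψ s)⁻¹ *ᵥ ψ s)) := by
  rw [ridge_mulVec_inv, dotProduct_comm]
  rfl

theorem ellipticNorm_nonneg (ψ : ℕ → Fin d → ℝ) (s : ℕ) : 0 ≤ ellipticNorm ψ s := by
  rw [ellipticNorm_eq]
  simpa using (ridge_posDef ψ s).posSemidef.dotProduct_mulVec_nonneg ((ridge ψ s)⁻¹ *ᵥ ψ s)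

/-- The regularizer `4 I` matches the bound on `ψ_s`. With `w = V⁻¹ ψ_s` and `u = ψ_s ⬝ᵥ w`,
Cauchy-Schwarz gives `u² ≤ 4 (w ⬝ᵥ w) ≤ u`. -/
theorem ellipticNorm_le_one (ψ : ℕ → Fin d → ℝ) (s : ℕ) (h : ψ s ⬝ᵥ ψ s ≤ 4) :
    ellipticNorm ψ s ≤ 1 := by
  have h0 := ellipticNorm_nonneg ψ s
  have h1 := ellipticNorm_eq ψ s
  rw [dotProduct_ridge_mulVec] at h1
  set w := (ridge ψ s)⁻¹ *ᵥ ψ s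
  have h2 : 0 ≤ ∑ i ∈ Finset.range s, (ψ i ⬝ᵥ w) ^ 2 := Finset.sum_nonneg fun i _ => sq_nonneg _
  have h3 : (ψ s ⬝ᵥ w) ^ 2 ≤ (ψ s ⬝ᵥ ψ s) * (w ⬝ᵥ w) := by
    have := Finset.sum_mul_sq_le_sq_mul_sq Finset.univ (ψ s) w
    simpa [dotProduct, sq] using this
  have h4 : ellipticNorm ψ s = ψ s ⬝ᵥ w := rfl
  rw [← h4] at h3
  have h5 : 0 ≤ w ⬝ᵥ w := by simpa using dotProduct_star_self_nonneg w
  nlinarith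

/-- The matrix determinant lemma for a rank-one update. -/
theorem det_ridge_succ (ψ : ℕ → Fin d → ℝ) (s : ℕ) :
    (ridge ψ (s + 1)).det = (ridge ψ s).det * (1 + ellipticNorm ψ s) := by
  rw [ridge_succ, vecMulVec_eq Unit,
    det_add_replicateCol_mul_replicateRow (ridge_posDef ψ s).det_pos.ne'.isUnit,
    det_unique (1 + replicateRow Unit (ψ s) * (ridge ψ s)⁻¹ * replicateCol Unit (ψ s)),
    Matrix.add_apply, one_apply_eq, Matrix.mul_assoc, ← replicateCol_mulVec,
    replicateRow_mul_replicateCol_apply]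
  rfl

theorem le_two_mul_log_one_add {u : ℝ} (h0 : 0 ≤ u) (h1 : u ≤ 1) :
    u ≤ 2 * Real.log (1 + u) := by
  have h := Real.one_sub_inv_le_log_of_pos (show 0 < 1 + u by linarith)
  have : u / 2 ≤ 1 - (1 + u)⁻¹ := by
    have h2 : (1 + u)⁻¹ * (1 + u) = 1 := inv_mul_cancel₀ (by linarith)
    nlinarith [inv_pos.mpr (show 0 < 1 + u by linarith)]
  linarith

/-- On `[0, 1]` one has `u ≤ 2 log (1 + u)`, and the logarithms telescope through `det_ridge_succ`.
-/
theorem sum_ellipticNorm_le_log_det (ψ : ℕ → Fin d → ℝ) (hψ : ∀ i, ψ i ⬝ᵥ ψ i ≤ 4) (T : ℕ) :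
    ∑ s ∈ Finset.range T, ellipticNorm ψ s ≤
      2 * (Real.log (ridge ψ T).det - Real.log (ridge ψ 0).det) := by
  induction T with
  | zero => simp
  | succ T ih =>
    have h0 := ellipticNorm_nonneg ψ T
    rw [Finset.sum_range_succ, det_ridge_succ,
      Real.log_mul (ridge_posDef ψ T).det_pos.ne' (by linarith)]
    linarith [le_two_mul_log_one_add h0 (ellipticNorm_le_one ψ T (hψ T))]

theorem abs_ridge_apply_le (ψ : ℕ → Fin d → ℝ) (hψ : ∀ i, ψ i ⬝ᵥ ψ i ≤ 4) (s : ℕ) (j k : Fin d) :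
    |ridge ψ s j k| ≤ 4 * (s + 1) := by
  have hsq : ∀ i j, ψ i j ^ 2 ≤ 4 := fun i j => by
    refine le_trans ?_ (hψ i)
    rw [dotProduct, sq]
    exact Finset.single_le_sum (f := fun j => ψ i j * ψ i j) (fun j _ => mul_self_nonneg _)
      (Finset.mem_univ j)
  have habs : ∀ i j, |ψ i j| ≤ 2 := fun i j =>
    abs_le_of_sq_le_sq (by linarith [hsq i j]) (by norm_num)
  induction s with
  | zero =>
    by_cases h : j = k <;> simp [ridge, h]
  | succ s ih =>
    rw [ridge_succ, Matrix.add_apply, vecMulVec_apply]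
    refine (abs_add_le _ _).trans ?_
    rw [abs_mul]
    have : |ψ s j| * |ψ s k| ≤ 2 * 2 :=
      mul_le_mul (habs s j) (habs s k) (abs_nonneg _) (by norm_num)
    push_cast
    linarith

/-- The crude Leibniz bound `d! (4 (T + 1))^d` on the determinant suffices: `d!` costs only `log d`
per dimension, and `4 ^ d` cancels against the initial determinant. -/
theorem sum_ellipticNorm_le (hd : 0 < d) (ψ : ℕ → Fin d → ℝ) (hψ : ∀ i, ψ i ⬝ᵥ ψ i ≤ 4) (T : ℕ) :
    ∑ s ∈ Finset.range T, ellipticNorm ψ s ≤ 2 * (d * Real.log (d * (T + 1))) := by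
  refine (sum_ellipticNorm_le_log_det ψ hψ T).trans ?_
  have hd' : (0 : ℝ) < d := by exact_mod_cast hd
  have h0 : (ridge ψ 0).det = 4 ^ d := by simp [ridge]
  have h1 : (ridge ψ T).det ≤ (d * (4 * (T + 1))) ^ d := by
    have := det_le (A := ridge ψ T) (abv := AbsoluteValue.abs) (abs_ridge_apply_le ψ hψ T)
    rw [Fintype.card_fin, nsmul_eq_mul] at this
    refine (le_abs_self _).trans (this.trans ?_)
    rw [mul_pow (d : ℝ)]
    gcongr
    exact_mod_cast Nat.factorial_le_pow d
  have h2 := Real.log_le_log (ridge_posDef ψ T).det_pos h1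
  rw [h0, Real.log_pow]
  rw [Real.log_pow, show (d : ℝ) * (4 * (T + 1)) = 4 * (d * (T + 1)) by ring,
    Real.log_mul (by norm_num) (by positivity), mul_add] at h2
  linarith

/-- The elliptic potential bounds the values of linear forms along a sequence of directions by
their values at the earlier directions. -/
theorem exists_elliptic_potential (hd : 0 < d) (ψ : ℕ → EuclideanSpace ℝ (Fin d))
    (hψ : ∀ i, ‖ψ i‖ ≤ 2) (T : ℕ) :
    ∃ u : ℕ → ℝ, (∀ s, 0 ≤ u s) ∧
      ∑ s ∈ Finset.range T, u s ≤ 2 * (d * Real.log (d * (T + 1))) ∧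
      ∀ (s : ℕ) (v : EuclideanSpace ℝ (Fin d)) (η : ℝ), 0 < η →
        inner ℝ (ψ s) v ≤ η / 2 * (4 * ‖v‖ ^ 2 + ∑ i ∈ Finset.range s, inner ℝ (ψ i) v ^ 2) +
          u s / (2 * η) := by
  have hinner : ∀ v w : EuclideanSpace ℝ (Fin d), inner ℝ v w = WithLp.ofLp v ⬝ᵥ WithLp.ofLp w :=
    fun v w => by rw [EuclideanSpace.inner_eq_star_dotProduct, star_trivial, dotProduct_comm]
  refine ⟨ellipticNorm fun i => WithLp.ofLp (ψ i), fun s => ellipticNorm_nonneg _ s,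
    sum_ellipticNorm_le hd _ (fun i => ?_) T, fun s v η hη => ?_⟩
  · rw [← hinner, real_inner_self_eq_norm_sq]
    nlinarith [hψ i, norm_nonneg (ψ i)]
  · have := dotProduct_le_ellipticNorm (fun i => WithLp.ofLp (ψ i)) s (WithLp.ofLp v) hη
    rw [dotProduct_ridge_mulVec] at this
    simpa only [hinner, ← real_inner_self_eq_norm_sq] using this

end Elliptic

/-! ### Concentration along a run of XPO -/

section Centered

open ProbabilityTheory

variable {Z : Type*} [MeasurableSpace Z] {κ : (t : ℕ) → (Fin t → Z) → Measure Z}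

/-- Subtracting the conditional mean at most doubles the bound on an increment; hence `2 * b` in the
exponent. -/
theorem adaptiveLaw_centeredSum_ge_le (hκ : ∀ t, Measurable (κ t))
    (hκp : ∀ t D, IsProbabilityMeasure (κ t D)) {f : (t : ℕ) → (Fin t → Z) → Z → ℝ}
    (hf : ∀ t, Measurable fun p : (Fin t → Z) × Z => f t p.1 p.2) {b : ℝ} (hb0 : 0 < b)
    (hb : ∀ t D z, |f t D z| ≤ b) {T : ℕ} (hT : 0 < T) {s : ℝ} (hs : 0 ≤ s) :
    adaptiveLaw κ T {D | s ≤ adaptedSum (fun t D z => ∫ z', f t D z' ∂(κ t D) - f t D z) D} ≤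
      ENNReal.ofReal (Real.exp (-(s ^ 2 / (2 * T * (2 * b) ^ 2)))) := by
  have hfD : ∀ t D, Measurable fun z => f t D z := fun t D => (hf t).comp measurable_prodMk_left
  have hint : ∀ t D, Integrable (fun z => f t D z) (κ t D) := fun t D => by
    have := hκp t D
    exact integrable_of_bounded (hfD t D) b (hb t D)
  refine adaptiveLaw_adaptedSum_ge_le hκ hκp (fun t => ?_) (by linarith) (fun t D z => ?_)
    (fun t D => ?_) hT hs
  · let K : Kernel (Fin t → Z) Z := ⟨κ t, hκ t⟩
    have : IsMarkovKernel K := ⟨hκp t⟩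
    have h := StronglyMeasurable.integral_kernel_prod_right' (κ := K) (hf t).stronglyMeasurable
    exact (h.measurable.comp measurable_fst).sub (hf t)
  · have := hκp t D
    have h1 : |∫ z', f t D z' ∂(κ t D)| ≤ b := by
      have := norm_integral_le_of_norm_le_const (μ := κ t D) (f := fun z => f t D z)
        (Filter.Eventually.of_forall fun z => hb t D z)
      simpa using this
    have h2 := hb t D z
    rw [abs_le] at h1 h2 ⊢
    constructor <;> linarith [h1.1, h1.2, h2.1, h2.2]
  · have := hκp t D
    rw [integral_sub (integrable_const _) (hint t D)]
    simp

end Centered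

/-! ### Nets of a parameter ball. -/

section Net

/-- A finite net of a ball, with the number of points that a cubic grid gives. -/
theorem exists_net {d : ℕ} (hd : 0 < d) {B t : ℝ} (hB : 0 < B) (ht : 0 < t) (h1 : 1 ≤ B * d * t) :
    ∃ F : Finset (EuclideanSpace ℝ (Fin d)), (∀ θ ∈ F, ‖θ‖ ≤ B) ∧
      (∀ θ, ‖θ‖ ≤ B → ∃ θ' ∈ F, ‖θ - θ'‖ ≤ 1 / t) ∧ (F.card : ℝ) ≤ (3 * (B * d * t)) ^ d := by
  classical
  have hd' : (0 : ℝ) < d := by exact_mod_cast hd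
  have hd1 : (1 : ℝ) ≤ d := by exact_mod_cast hd
  set m : ℕ := ⌊2 * (B * d * t)⌋₊ with hm
  -- Grid cells of side `1/(d t)`: two points of one cell are at distance at most `1/(√d t)`, which
  -- is at most `1/t`.
  let idx : EuclideanSpace ℝ (Fin d) → Fin d → ℕ := fun θ j => ⌊(θ j + B) * (d * t)⌋₊
  have hcoord : ∀ θ : EuclideanSpace ℝ (Fin d), ‖θ‖ ≤ B → ∀ j, |θ j| ≤ B := fun θ hθ j =>
    (PiLp.norm_apply_le θ j).trans hθ
  have hidx : ∀ θ, ‖θ‖ ≤ B → idx θ ∈ Fintype.piFinset fun _ : Fin d => Finset.range (m + 1) := by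
    intro θ hθ
    rw [Fintype.mem_piFinset]
    intro j
    rw [Finset.mem_range, Nat.lt_succ_iff]
    refine Nat.floor_le_floor ?_
    have := (abs_le.mp (hcoord θ hθ j)).2
    calc (θ j + B) * (d * t) ≤ (B + B) * (d * t) := by gcongr
      _ = _ := by ring
  have hclose : ∀ θ θ' : EuclideanSpace ℝ (Fin d), ‖θ‖ ≤ B → ‖θ'‖ ≤ B → idx θ = idx θ' →
      ‖θ - θ'‖ ≤ 1 / t := by
    intro θ θ' hθ hθ' h
    have hj : ∀ j, (θ j - θ' j) ^ 2 ≤ (1 / (d * t)) ^ 2 := by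
      intro j
      have h0 := congrFun h j
      simp only [idx] at h0
      have hn : 0 ≤ (θ j + B) * (d * t) := by
        have := (abs_le.mp (hcoord θ hθ j)).1
        have : 0 ≤ θ j + B := by linarith
        positivity
      have hn' : 0 ≤ (θ' j + B) * (d * t) := by
        have := (abs_le.mp (hcoord θ' hθ' j)).1
        have : 0 ≤ θ' j + B := by linarith
        positivity
      have h1 := Nat.floor_le hn
      have h2 := Nat.lt_floor_add_one ((θ j + B) * (d * t))
      have h3 := Nat.floor_le hn'
      have h4 := Nat.lt_floor_add_one ((θ' j + B) * (d * t))
      rw [h0] at h1 h2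
      have h5 : |(θ j - θ' j) * (d * t)| ≤ 1 := by rw [abs_le]; constructor <;> linarith
      rw [abs_mul, abs_of_pos (show 0 < d * t by positivity)] at h5
      rw [← sq_abs]
      have h6 : |θ j - θ' j| ≤ 1 / (d * t) := by rwa [le_div_iff₀ (by positivity)]
      gcongr
    rw [EuclideanSpace.norm_eq]
    refine Real.sqrt_le_iff.mpr ⟨by positivity, ?_⟩
    calc ∑ j, ‖(θ - θ') j‖ ^ 2 ≤ ∑ _j : Fin d, (1 / (d * t)) ^ 2 :=
          Finset.sum_le_sum fun j _ => by simpa using hj j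
      _ = (1 / t) ^ 2 / d := by
          rw [Finset.sum_const, Finset.card_univ, Fintype.card_fin, nsmul_eq_mul]
          field_simp
      _ ≤ (1 / t) ^ 2 := div_le_self (by positivity) hd1
  -- Representatives are taken inside the ball, since the concentration bounds apply only to
  -- parameters of norm at most `B`; the default `0` for an empty cell is harmless.
  let rep : (Fin d → ℕ) → EuclideanSpace ℝ (Fin d) := fun k =>
    if h : ∃ θ, ‖θ‖ ≤ B ∧ idx θ = k then h.choose else 0
  have hrep : ∀ k, ‖rep k‖ ≤ B := by
    intro k
    simp only [rep]
    split_ifs with h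
    · exact h.choose_spec.1
    · simpa using hB.le
  refine ⟨(Fintype.piFinset fun _ : Fin d => Finset.range (m + 1)).image rep, ?_, ?_, ?_⟩
  · intro θ hθ
    obtain ⟨k, -, rfl⟩ := Finset.mem_image.mp hθ
    exact hrep k
  · intro θ hθ
    refine ⟨rep (idx θ), Finset.mem_image_of_mem _ (hidx θ hθ), hclose θ _ hθ (hrep _) ?_⟩
    have h : ∃ θ', ‖θ'‖ ≤ B ∧ idx θ' = idx θ := ⟨θ, hθ, rfl⟩
    simp only [rep, dif_pos h]
    exact h.choose_spec.2.symm
  · have hcard := Finset.card_image_le (s := Fintype.piFinset fun _ : Fin d =>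
      Finset.range (m + 1)) (f := rep)
    rw [Fintype.card_piFinset_const, Finset.card_range] at hcard
    have hm1 : ((m : ℝ) + 1) ≤ 3 * (B * d * t) := by
      have := Nat.floor_le (show 0 ≤ 2 * (B * d * t) by positivity)
      rw [← hm] at this
      linarith
    calc (_ : ℝ) ≤ ((m + 1 : ℕ) : ℝ) ^ d := by exact_mod_cast hcard
      _ ≤ _ := by push_cast; gcongr

end Net

/-! ### Log-ratios of softmax models and their conditional means. -/

section LogRatio

variable {X Y : Type*} [Fintype Y] [Nonempty Y] {d : ℕ} {φ : X → Y → EuclideanSpace ℝ (Fin d)}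

/-- The log-ratio of two models. -/
def logRatio (π π' : Model X Y) (x : X) (y : Y) : ℝ := Real.log (π x y / π' x y)

theorem logRatio_sub (θ θ' θb : EuclideanSpace ℝ (Fin d)) (x : X) (y : Y) :
    logRatio (linSoftmax φ θ) (linSoftmax φ θb) x y -
      logRatio (linSoftmax φ θ') (linSoftmax φ θb) x y =
      Real.log (linSoftmax φ θ x y / linSoftmax φ θ' x y) := by
  have h : ∀ θ : EuclideanSpace ℝ (Fin d), linSoftmax φ θ x y ≠ 0 := fun θ =>
    (linSoftmax_pos θ x y).ne'
  rw [logRatio, logRatio, Real.log_div (h _) (h _), Real.log_div (h _) (h _),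
    Real.log_div (h _) (h _)]
  ring

theorem abs_logRatio_le (hφ : ∀ x y, ‖φ x y‖ ≤ 1) {B : ℝ} {θ θ' : EuclideanSpace ℝ (Fin d)}
    (hθ : ‖θ‖ ≤ B) (hθ' : ‖θ'‖ ≤ B) (x : X) (y : Y) :
    |logRatio (linSoftmax φ θ) (linSoftmax φ θ') x y| ≤ 4 * B :=
  (abs_log_linSoftmax_div_le hφ θ θ' x y).trans (by linarith [norm_sub_le θ θ'])

/-- The difference of the log-ratios of the two responses of a triple. -/
def ratioGap (π π' : Model X Y) (z : X × Y × Y) : ℝ :=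
  logRatio π π' z.1 z.2.1 - logRatio π π' z.1 z.2.2

/-- The partition functions cancel between the two responses, which leaves a linear form in the
parameter. This linearity is what the elliptic potential exploits. -/
theorem ratioGap_linSoftmax (θ θ' : EuclideanSpace ℝ (Fin d)) (z : X × Y × Y) :
    ratioGap (linSoftmax φ θ) (linSoftmax φ θ') z =
      inner ℝ (φ z.1 z.2.1 - φ z.1 z.2.2) (θ - θ') :=
  log_linSoftmax_div_sub θ θ' z.1 z.2.1 z.2.2

end LogRatio

theorem measurable_uncurry_response {H X Y : Type*} [MeasurableSpace H]
    [MeasurableSpace X] [MeasurableSpace Y] [DiscreteMeasurableSpace Y] [Finite Y] {F : H → X → Y → ℝ}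
    (hF : ∀ y, Measurable fun p : H × X => F p.1 p.2 y) :
    Measurable fun q : (H × X) × Y => F q.1.1 q.1.2 q.2 :=
  measurable_from_prod_countable_left fun y => hF y

theorem measurable_logRatio_triple {H X Y : Type*} [MeasurableSpace H]
    [MeasurableSpace X] [MeasurableSpace Y] [DiscreteMeasurableSpace Y] [Finite Y] {π : H → Model X Y}
    {π' : Model X Y} (hπ : ∀ y, Measurable fun p : H × X => π p.1 p.2 y)
    (hπ' : ∀ y, Measurable fun x => π' x y) :
    (Measurable fun p : H × X × Y × Y => logRatio (π p.1) π' p.2.1 p.2.2.1) ∧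
      Measurable fun p : H × X × Y × Y => logRatio (π p.1) π' p.2.1 p.2.2.2 := by
  have h := measurable_uncurry_response (F := fun D => logRatio (π D) π') fun y =>
    ((hπ y).div ((hπ' y).comp measurable_snd)).log
  exact ⟨h.comp ((measurable_fst.prodMk (measurable_fst.comp measurable_snd)).prodMk
      (measurable_fst.comp (measurable_snd.comp measurable_snd))),
    h.comp ((measurable_fst.prodMk (measurable_fst.comp measurable_snd)).prodMk
      (measurable_snd.comp (measurable_snd.comp measurable_snd)))⟩

theorem measurable_logRatio_uncurry {X Y : Type*} [MeasurableSpace X] [MeasurableSpace Y]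
    [DiscreteMeasurableSpace Y] [Finite Y] {π π' : Model X Y}
    (hπ : ∀ y, Measurable fun x => π x y) (hπ' : ∀ y, Measurable fun x => π' x y) :
    Measurable fun z : X × Y => logRatio π π' z.1 z.2 :=
  measurable_from_prod_countable_left fun y => ((hπ y).div (hπ' y)).log

theorem measurable_logRatio_snd {X Y : Type*} [MeasurableSpace X] [MeasurableSpace Y]
    [DiscreteMeasurableSpace Y] [Finite Y] {π π' : Model X Y}
    (hπ : ∀ y, Measurable fun x => π x y) (hπ' : ∀ y, Measurable fun x => π' x y) :
    Measurable fun z : X × Y × Y => logRatio π π' z.1 z.2.2 :=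
  (measurable_logRatio_uncurry hπ hπ').comp
    (measurable_fst.prodMk (measurable_snd.comp measurable_snd))

section Run

variable {X Y : Type*} [MeasurableSpace X] [MeasurableSpace Y] [DiscreteMeasurableSpace Y]
  [Fintype Y] [Nonempty Y] {d : ℕ} {φ : X → Y → EuclideanSpace ℝ (Fin d)}

/-- The first response integrates out, so the conditional mean does not depend on the model being
run: the base responses behave like fresh samples along the adaptive run. -/
theorem integral_logRatio_tripleLaw (μ : Measure X) [IsProbabilityMeasure μ]
    (hφm : ∀ y, Measurable fun x => φ x y) (hφ : ∀ x y, ‖φ x y‖ ≤ 1)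
    (θ θ₁ θ₂ θs : EuclideanSpace ℝ (Fin d)) :
    ∫ z, logRatio (linSoftmax φ θ₁) (linSoftmax φ θ₂) z.1 z.2.2
        ∂(tripleLaw μ (linSoftmax φ θ) (linSoftmax φ θs)) =
      expect μ (linSoftmax φ θs) (logRatio (linSoftmax φ θ₁) (linSoftmax φ θ₂)) := by
  have hm := measurable_logRatio_snd (measurable_linSoftmax hφm θ₁) (measurable_linSoftmax hφm θ₂)
  have h := integral_tripleLaw μ (measurable_linSoftmax hφm θ) (measurable_linSoftmax hφm θs)
    (fun x y => (linSoftmax_pos θ x y).le) (fun x y => (linSoftmax_pos θs x y).le)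
    (linSoftmax_le_one θ) (linSoftmax_le_one θs) hm
    (fun z => abs_log_linSoftmax_div_le hφ θ₁ θ₂ z.1 z.2.2)
  refine h.trans (integral_congr_ae (Filter.Eventually.of_forall fun x => ?_))
  beta_reduce
  simp_rw [mul_assoc, ← Finset.mul_sum]
  rw [← Finset.sum_mul, sum_linSoftmax, one_mul]

/-- The first response is drawn from the model itself and yields the divergence; the second, drawn
from the base model, yields the mean that the optimism term controls. -/
theorem integral_ratioGap_tripleLaw (μ : Measure X) [IsProbabilityMeasure μ]
    (hφm : ∀ y, Measurable fun x => φ x y) (hφ : ∀ x y, ‖φ x y‖ ≤ 1)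
    (θ θb θs : EuclideanSpace ℝ (Fin d)) :
    ∫ z, ratioGap (linSoftmax φ θ) (linSoftmax φ θb) z
        ∂(tripleLaw μ (linSoftmax φ θ) (linSoftmax φ θs)) =
      klExpect μ (linSoftmax φ θ) (linSoftmax φ θb) -
        expect μ (linSoftmax φ θs) (logRatio (linSoftmax φ θ) (linSoftmax φ θb)) := by
  have hm := measurable_logRatio_triple (H := Unit) (π := fun _ => linSoftmax φ θ)
    (fun y => (measurable_linSoftmax hφm θ y).comp measurable_snd)
    (measurable_linSoftmax hφm θb)
  have hm' := (hm.1.sub hm.2).comp (measurable_prodMk_left (x := ()))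
  have hb : ∀ z : X × Y × Y, |ratioGap (linSoftmax φ θ) (linSoftmax φ θb) z| ≤
      2 * ‖θ - θb‖ + 2 * ‖θ - θb‖ := fun z =>
    (abs_sub _ _).trans (add_le_add (abs_log_linSoftmax_div_le hφ θ θb z.1 z.2.1)
      (abs_log_linSoftmax_div_le hφ θ θb z.1 z.2.2))
  have h := integral_tripleLaw μ (measurable_linSoftmax hφm θ) (measurable_linSoftmax hφm θs)
    (fun x y => (linSoftmax_pos θ x y).le) (fun x y => (linSoftmax_pos θs x y).le)
    (linSoftmax_le_one θ) (linSoftmax_le_one θs) hm' hb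
  refine h.trans ?_
  have hi : ∀ θ', Integrable (fun x => ∑ y, linSoftmax φ θ' x y *
      logRatio (linSoftmax φ θ) (linSoftmax φ θb) x y) μ := fun θ' =>
    integrable_expect μ hφm θ' (fun y => measurable_log_linSoftmax_div hφm θ θb y)
      fun x y => abs_log_linSoftmax_div_le hφ θ θb x y
  rw [klExpect, expect, expect]
  refine Eq.trans ?_ (integral_sub (hi θ) (hi θs))
  refine integral_congr_ae (Filter.Eventually.of_forall fun x => ?_)
  simp only [Function.comp_apply, Pi.sub_apply]
  simp_rw [mul_assoc, ← Finset.mul_sum, mul_sub, Finset.sum_sub_distrib, ← Finset.sum_mul,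
    sum_linSoftmax, one_mul, mul_sub, Finset.sum_sub_distrib]
  rw [← Finset.sum_mul, sum_linSoftmax, one_mul]
  rfl

end Run

/-! ### The regret of XPO -/

/-- The term at `0` vanishes by the convention `0⁻¹ = 0`; the rest is a harmonic number. -/
theorem sum_range_inv_le_one_add_log (T : ℕ) :
    ∑ s ∈ Finset.range T, (s : ℝ)⁻¹ ≤ 1 + Real.log T := by
  rcases T with _ | T
  · simp
  · rw [Finset.sum_range_succ']
    have h := harmonic_le_one_add_log T
    rw [harmonic] at h
    push_cast at h ⊢
    have h2 : Real.log T ≤ Real.log (T + 1) := by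
      rcases T with _ | T
      · simp
      · exact Real.log_le_log (by positivity) (by linarith)
    simp only [inv_zero, add_zero]
    linarith

/-- The deterministic core. Here `K s` is the divergence of the `s`-th iterate and `h s` its mean
log-ratio under the base model. Optimality `hopt` gives `h s ≤ E/s - (β²/(α s)) Q`, with `Q` the
past squared gaps, and this negative term pays for the part of the elliptic bound on `⟨ψ s, v s⟩`
that involves `Q`. -/
theorem regret_sum_le {d T : ℕ} (hd : 0 < d) (hT : 0 < T) {α β B E Az : ℝ} (hα : 0 < α)
    (hβ : 0 < β) (hE : 0 ≤ E) {ψ v : ℕ → EuclideanSpace ℝ (Fin d)}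
    (hψ : ∀ i, ‖ψ i‖ ≤ 2) (hv : ∀ s, ‖v s‖ ≤ 2 * B) {K h : ℕ → ℝ}
    (hopt : ∀ s ∈ Finset.range T, α * (s * h s - E) +
      β ^ 2 * ∑ i ∈ Finset.range s, inner ℝ (ψ i) (v s) ^ 2 ≤ 0)
    (h0 : h 0 ≤ 4 * B)
    (hAz : ∑ s ∈ Finset.range T, (K s - h s - inner ℝ (ψ s) (v s)) ≤ Az) :
    ∑ s ∈ Finset.range T, K s ≤ Az + 4 * B + E * (1 + Real.log T) + 16 * B ^ 2 * β ^ 2 / α +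
      α * T / (2 * β ^ 2) * (d * Real.log (d * (T + 1))) := by
  obtain ⟨u, hu0, hu, hpot⟩ := exists_elliptic_potential hd ψ hψ T
  have hT' : (0 : ℝ) < T := by exact_mod_cast hT
  have hB : 0 ≤ B := by linarith [norm_nonneg (v 0), hv 0]
  -- The largest `η` with `η/2 ≤ β²/(α s)` for every `s ≤ T`, so that the `Q` terms cancel at all
  -- steps.
  set η : ℝ := 2 * β ^ 2 / (α * T) with hη
  have hη0 : 0 < η := by positivity
  have hstep : ∀ s ∈ Finset.range T, h s + inner ℝ (ψ s) (v s) ≤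
      (if s = 0 then 4 * B else 0) + E * (s : ℝ)⁻¹ + 16 * B ^ 2 * β ^ 2 / (α * T) +
        α * T / (4 * β ^ 2) * u s := by
    intro s hs
    set Q := ∑ i ∈ Finset.range s, inner ℝ (ψ i) (v s) ^ 2 with hQ
    have hQ0 : 0 ≤ Q := Finset.sum_nonneg fun i _ => sq_nonneg _
    have h1 := hpot s (v s) η hη0
    rw [← hQ] at h1
    have h2 : ‖v s‖ ^ 2 ≤ (2 * B) ^ 2 := pow_le_pow_left₀ (norm_nonneg _) (hv s) 2
    have h3 : h s ≤ (if s = 0 then 4 * B else 0) + E * (s : ℝ)⁻¹ - η / 2 * Q := by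
      rcases Nat.eq_zero_or_pos s with rfl | hs0
      · simpa [hQ] using h0
      · have hs' : (0 : ℝ) < s := by exact_mod_cast hs0
        have hsT : (s : ℝ) ≤ T := by exact_mod_cast (Finset.mem_range.mp hs).le
        rw [if_neg hs0.ne', zero_add]
        have h4 := hopt s hs
        have h5 : η / 2 * Q * s ≤ β ^ 2 / α * Q := by
          have : η / 2 * Q * s = β ^ 2 / α * Q * (s / T) := by rw [hη]; field_simp
          rw [this]
          exact mul_le_of_le_one_right (by positivity) ((div_le_one hT').mpr hsT)
        have h6 : s * h s ≤ E - β ^ 2 / α * Q := by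
          have : α * (s * h s - E + β ^ 2 / α * Q) ≤ α * 0 := by
            rw [mul_add, mul_zero]
            have : α * (β ^ 2 / α * Q) = β ^ 2 * Q := by field_simp
            rw [this]; exact h4
          linarith [le_of_mul_le_mul_left this hα]
        have h7 : h s * s ≤ (E * (s : ℝ)⁻¹ - η / 2 * Q) * s := by
          rw [sub_mul, inv_mul_cancel_right₀ hs'.ne']
          linarith
        exact le_of_mul_le_mul_right h7 hs'
    have h8 : u s / (2 * η) = α * T / (4 * β ^ 2) * u s := by rw [hη]; field_simp; ring
    have h9 : η / 2 * (4 * (2 * B) ^ 2) = 16 * B ^ 2 * β ^ 2 / (α * T) := by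
      rw [hη]; field_simp; ring
    have h10 : η / 2 * (4 * ‖v s‖ ^ 2) ≤ η / 2 * (4 * (2 * B) ^ 2) := by gcongr
    rw [h8, mul_add] at h1
    linarith
  have hsum := Finset.sum_le_sum hstep
  rw [Finset.sum_add_distrib, Finset.sum_add_distrib, Finset.sum_add_distrib,
    Finset.sum_add_distrib, ← Finset.mul_sum, ← Finset.mul_sum, Finset.sum_const,
    Finset.card_range, nsmul_eq_mul, Finset.sum_ite_eq' (Finset.range T) 0 fun _ => 4 * B,
    if_pos (Finset.mem_range.mpr hT)] at hsum
  have hT2 : (T : ℝ) * (16 * B ^ 2 * β ^ 2 / (α * T)) = 16 * B ^ 2 * β ^ 2 / α := by field_simp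
  have hu2 : α * T / (4 * β ^ 2) * ∑ s ∈ Finset.range T, u s ≤
      α * T / (2 * β ^ 2) * (d * Real.log (d * (T + 1))) := by
    calc _ ≤ α * T / (4 * β ^ 2) * (2 * (d * Real.log (d * (T + 1)))) := by gcongr
      _ = _ := by field_simp; ring
  have hE2 : E * ∑ s ∈ Finset.range T, (s : ℝ)⁻¹ ≤ E * (1 + Real.log T) :=
    mul_le_mul_of_nonneg_left (sum_range_inv_le_one_add_log T) hE
  rw [Finset.sum_sub_distrib, Finset.sum_sub_distrib] at hAz
  linarith

/-! ### The optimality inequality of the update rule and the deterministic regret bound. -/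

section Rule

variable {X Y : Type*} [MeasurableSpace X] [MeasurableSpace Y]
  [Fintype Y] {d : ℕ} {φ : X → Y → EuclideanSpace ℝ (Fin d)} {B β α : ℝ}
  {θs : EuclideanSpace ℝ (Fin d)} {A : (t : ℕ) → (Fin t → X × Y × Y) → Model X Y}

theorem IsXPORule.exists_param {r : X → Y → ℝ} (hθs : ‖θs‖ ≤ B)
    (hA : IsXPORule (softmaxClass φ B) (linSoftmax φ θs) r β α A) (t : ℕ)
    (D : Fin t → X × Y × Y) : ∃ θ, ‖θ‖ ≤ B ∧ A t D = linSoftmax φ θ := by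
  rcases Nat.eq_zero_or_pos t with rfl | ht
  · exact ⟨θs, hθs, hA.init D⟩
  · exact hA.mem t ht D

theorem IsXPORule.measurable_update {r : X → Y → ℝ} {C : Set (Model X Y)} {πb : Model X Y}
    (hA : IsXPORule C πb r β α A) (hπb : ∀ y, Measurable fun x => πb x y) (μ : Measure X)
    [SFinite μ] (t : ℕ) : Measurable fun D => tripleLaw μ (A t D) πb :=
  measurable_tripleLaw μ (hA.measurable t) hπb

variable [Nonempty Y]

/-- The reward is `β` times the log-ratio of the tilted model to `πb`, up to a term in the prompt
that differences remove. Hence the regression is noise-free and the tilted model has zero squared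
loss. -/
theorem xpoLoss_linSoftmax {X Y : Type*} [Fintype Y] [Nonempty Y]
    {φ : X → Y → EuclideanSpace ℝ (Fin d)} (hβ : β ≠ 0) (θ : EuclideanSpace ℝ (Fin d)) {t : ℕ}
    (D : Fin t → X × Y × Y) :
    xpoLoss (linSoftmax φ θs) (fun x y => Real.log (linSoftmax φ θs x y)) β α D (linSoftmax φ θ) =
      α * ∑ i, Real.log (linSoftmax φ θ (D i).1 (D i).2.2) +
        β ^ 2 * ∑ i, ratioGap (linSoftmax φ θ) (linSoftmax φ ((1 + 1 / β) • θs)) (D i) ^ 2 := by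
  rw [xpoLoss, Finset.mul_sum (a := β ^ 2)]
  congr 1
  refine Finset.sum_congr rfl fun i _ => ?_
  rw [ratioGap_linSoftmax, ← mul_sub, log_linSoftmax_div_sub, log_linSoftmax, log_linSoftmax,
    inner_sub_right, inner_sub_right, real_inner_smul_right, inner_sub_left (x := φ _ _) (z := θs)]
  field_simp
  ring

/-- The minimizer is compared with the tilted model, which `hθb` places in the class; only the
optimism term of the comparator survives. -/
theorem IsXPORule.optimality (hβ : β ≠ 0) (hθb : ‖(1 + 1 / β) • θs‖ ≤ B)
    (hA : IsXPORule (softmaxClass φ B) (linSoftmax φ θs)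
      (fun x y => Real.log (linSoftmax φ θs x y)) β α A) {t : ℕ} (ht : 1 ≤ t)
    (D : Fin t → X × Y × Y) {θ : EuclideanSpace ℝ (Fin d)} (hθ : A t D = linSoftmax φ θ) :
    α * ∑ i, logRatio (linSoftmax φ θ) (linSoftmax φ ((1 + 1 / β) • θs)) (D i).1 (D i).2.2 +
      β ^ 2 * ∑ i, ratioGap (linSoftmax φ θ) (linSoftmax φ ((1 + 1 / β) • θs)) (D i) ^ 2 ≤ 0 := by
  have h := hA.isMin t ht D _ ⟨_, hθb, rfl⟩
  rw [hθ, xpoLoss_linSoftmax hβ, xpoLoss_linSoftmax hβ] at h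
  have h0 : ∑ i, ratioGap (linSoftmax φ ((1 + 1 / β) • θs)) (linSoftmax φ ((1 + 1 / β) • θs))
      (D i) ^ 2 = 0 := Finset.sum_eq_zero fun i _ => by rw [ratioGap_linSoftmax]; simp
  have h1 : ∑ i, logRatio (linSoftmax φ θ) (linSoftmax φ ((1 + 1 / β) • θs)) (D i).1 (D i).2.2 =
      ∑ i, Real.log (linSoftmax φ θ (D i).1 (D i).2.2) -
        ∑ i, Real.log (linSoftmax φ ((1 + 1 / β) • θs) (D i).1 (D i).2.2) := by
    rw [← Finset.sum_sub_distrib]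
    exact Finset.sum_congr rfl fun i _ =>
      Real.log_div (linSoftmax_pos _ _ _).ne' (linSoftmax_pos _ _ _).ne'
  rw [h0] at h
  rw [h1]
  linarith

/-- The regret bound on the event where the two concentration inequalities hold. -/
theorem IsXPORule.sum_klExpect_le {μ : Measure X} [IsProbabilityMeasure μ]
    (hφ : ∀ x y, ‖φ x y‖ ≤ 1) (hd : 0 < d)
    (hα : 0 < α) (hβ : 0 < β) (hθs : ‖θs‖ ≤ B) (hθb : ‖(1 + 1 / β) • θs‖ ≤ B)
    (hA : IsXPORule (softmaxClass φ B) (linSoftmax φ θs)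
      (fun x y => Real.log (linSoftmax φ θs x y)) β α A) {T : ℕ} (hT : 0 < T) {E Az : ℝ}
    (hE : 0 ≤ E) (D : Fin T → X × Y × Y)
    (hDE : ∀ (s : ℕ) (hs : s < T) (θ : EuclideanSpace ℝ (Fin d)), ‖θ‖ ≤ B →
      s * expect μ (linSoftmax φ θs)
          (logRatio (linSoftmax φ θ) (linSoftmax φ ((1 + 1 / β) • θs))) -
        ∑ i, logRatio (linSoftmax φ θ) (linSoftmax φ ((1 + 1 / β) • θs))
          (history D s hs.le i).1 (history D s hs.le i).2.2 ≤ E)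
    (hDA : ∑ s : Fin T, (klExpect μ (A s (history D s s.isLt.le))
          (linSoftmax φ ((1 + 1 / β) • θs)) -
        expect μ (linSoftmax φ θs)
          (logRatio (A s (history D s s.isLt.le)) (linSoftmax φ ((1 + 1 / β) • θs))) -
        ratioGap (A s (history D s s.isLt.le)) (linSoftmax φ ((1 + 1 / β) • θs)) (D s)) ≤ Az) :
    ∑ s : Fin T, klExpect μ (A s (history D s s.isLt.le)) (linSoftmax φ ((1 + 1 / β) • θs)) ≤
      Az + 4 * B + E * (1 + Real.log T) + 16 * B ^ 2 * β ^ 2 / α +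
      α * T / (2 * β ^ 2) * (d * Real.log (d * (T + 1))) := by
  set θb := (1 + 1 / β) • θs with hθbdef
  -- The data are extended to all of `ℕ` by repeating the last triple, as `regret_sum_le` works with
  -- infinite sequences.
  let z : ℕ → X × Y × Y := fun i => D ⟨min i (T - 1), by omega⟩
  have hz : ∀ i : Fin T, z i = D i := fun i => congrArg D (Fin.ext (min_eq_left (by omega)))
  have hzh : ∀ (s : ℕ) (hs : s ≤ T) (i : Fin s), history D s hs i = z i := fun s hs i =>
    congrArg D (Fin.ext (min_eq_left (by change (i : ℕ) ≤ T - 1; omega)).symm)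
  let M : ℕ → Model X Y := fun s => A s fun i : Fin s => z i
  have hM : ∀ (s : ℕ) (hs : s ≤ T), A s (history D s hs) = M s := fun s hs =>
    congrArg (A s) (funext fun i => hzh s hs i)
  choose θ hθB hθ using fun s => hA.exists_param hθs s fun i : Fin s => z i
  have hMθ : ∀ s, M s = linSoftmax φ (θ s) := hθ
  have key := regret_sum_le (d := d) (T := T) (α := α) (β := β) (B := B) (E := E) (Az := Az)
    (ψ := fun i => φ (z i).1 (z i).2.1 - φ (z i).1 (z i).2.2) (v := fun s => θ s - θb)
    (K := fun s => klExpect μ (M s) (linSoftmax φ θb))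
    (h := fun s => expect μ (linSoftmax φ θs) (logRatio (M s) (linSoftmax φ θb)))
    hd hT hα hβ hE
    (fun i => (norm_sub_le _ _).trans (by linarith [hφ (z i).1 (z i).2.1, hφ (z i).1 (z i).2.2]))
    (fun s => (norm_sub_le _ _).trans (by linarith [hθB s])) ?_ ?_ ?_
  · rw [Finset.sum_range] at key
    simpa only [hM] using key
  · intro s hs
    have hsT := Finset.mem_range.mp hs
    rcases Nat.eq_zero_or_pos s with rfl | hs0
    -- The initial model `πb` minimizes nothing, but without data the inequality reads `-α E ≤ 0`.
    · simp only [Nat.cast_zero, zero_mul, zero_sub, Finset.range_zero, Finset.sum_empty, mul_zero,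
        add_zero]
      nlinarith
    · have h1 := hA.optimality hβ.ne' hθb hs0 _ (hθ s)
      have h2 := hDE s hsT (θ s) (hθB s)
      simp only [hzh] at h2
      simp only [ratioGap_linSoftmax] at h1
      rw [Finset.sum_range]
      rw [hMθ s]
      have h3 := mul_le_mul_of_nonneg_left h2 hα.le
      rw [mul_sub] at h3 ⊢
      linarith
  · simp only [hMθ 0]
    refine (le_abs_self _).trans ?_
    have : ∀ x, |∑ y, linSoftmax φ θs x y * logRatio (linSoftmax φ (θ 0)) (linSoftmax φ θb) x y| ≤
        4 * B := fun x => abs_sum_mul_le (fun y => (linSoftmax_pos θs x y).le) (sum_linSoftmax θs x)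
      (abs_logRatio_le hφ (hθB 0) hθb x)
    have h := norm_integral_le_of_norm_le_const (μ := μ) (f := fun x => ∑ y, linSoftmax φ θs x y *
      logRatio (linSoftmax φ (θ 0)) (linSoftmax φ θb) x y) (Filter.Eventually.of_forall this)
    simpa [expect] using h
  · rw [Finset.sum_range]
    refine le_trans (le_of_eq (Finset.sum_congr rfl fun s _ => ?_)) hDA
    rw [hM, ← hz s]
    simp only [hMθ, ratioGap_linSoftmax]

end Rule

/-! ### Concentration for the triples of a run, and the regret with high probability. -/

section Concentration

variable {X Y : Type*} [MeasurableSpace X] [MeasurableSpace Y]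
  [Fintype Y] [Nonempty Y] {d : ℕ} {φ : X → Y → EuclideanSpace ℝ (Fin d)} {B β α : ℝ}
  {θs : EuclideanSpace ℝ (Fin d)} {A : (t : ℕ) → (Fin t → X × Y × Y) → Model X Y}

theorem sum_fin_ite_lt {M : Type*} [AddCommMonoid M] {s T : ℕ} (hs : s ≤ T) (g : Fin T → M) :
    ∑ i : Fin T, (if (i : ℕ) < s then g i else 0) = ∑ i : Fin s, g (Fin.castLE hs i) := by
  rw [← Finset.sum_filter]
  symm
  refine Finset.sum_nbij (Fin.castLE hs) (fun i _ => by simp)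
    (fun i _ j _ h => Fin.castLE_injective hs h) (fun i hi => ?_) fun i _ => rfl
  simp only [Finset.coe_filter, Finset.mem_univ, true_and] at hi
  exact ⟨⟨i, hi⟩, by simp, rfl⟩

theorem logRatio_expect_sub_le {X Y : Type*} [MeasurableSpace X] [Fintype Y] [Nonempty Y]
    {φ : X → Y → EuclideanSpace ℝ (Fin d)} {μ : Measure X} [IsProbabilityMeasure μ]
    (hφm : ∀ y, Measurable fun x => φ x y) (hφ : ∀ x y, ‖φ x y‖ ≤ 1)
    (θ θ' θb : EuclideanSpace ℝ (Fin d)) :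
    expect μ (linSoftmax φ θs) (logRatio (linSoftmax φ θ) (linSoftmax φ θb)) -
      expect μ (linSoftmax φ θs) (logRatio (linSoftmax φ θ') (linSoftmax φ θb)) ≤
        2 * ‖θ - θ'‖ := by
  have hi : ∀ θ', Integrable (fun x => ∑ y, linSoftmax φ θs x y *
      logRatio (linSoftmax φ θ') (linSoftmax φ θb) x y) μ := fun θ' =>
    integrable_expect μ hφm θs (fun y => measurable_log_linSoftmax_div hφm θ' θb y)
      fun x y => abs_log_linSoftmax_div_le hφ θ' θb x y
  rw [expect, expect, ← integral_sub (hi θ) (hi θ')]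
  have hpt : ∀ x, ‖(∑ y, linSoftmax φ θs x y * logRatio (linSoftmax φ θ) (linSoftmax φ θb) x y) -
      ∑ y, linSoftmax φ θs x y * logRatio (linSoftmax φ θ') (linSoftmax φ θb) x y‖ ≤
      2 * ‖θ - θ'‖ := by
    intro x
    rw [← Finset.sum_sub_distrib, Real.norm_eq_abs]
    simp_rw [← mul_sub]
    refine abs_sum_mul_le (fun y => (linSoftmax_pos θs x y).le) (sum_linSoftmax θs x) fun y => ?_
    exact (le_of_eq (by rw [logRatio_sub])).trans (abs_log_linSoftmax_div_le hφ θ θ' x y)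
  have h := norm_integral_le_of_norm_le_const (μ := μ) (Filter.Eventually.of_forall hpt)
  rw [probReal_univ, mul_one] at h
  exact (le_abs_self _).trans h

theorem IsXPORule.isProbabilityMeasure_tripleLaw {μ : Measure X} [IsProbabilityMeasure μ]
    {r : X → Y → ℝ} (hφm : ∀ y, Measurable fun x => φ x y) (hθs : ‖θs‖ ≤ B)
    (hA : IsXPORule (softmaxClass φ B) (linSoftmax φ θs) r β α A) (t : ℕ)
    (D : Fin t → X × Y × Y) : IsProbabilityMeasure (tripleLaw μ (A t D) (linSoftmax φ θs)) := by
  obtain ⟨θ, -, hθ⟩ := hA.exists_param hθs t D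
  rw [hθ]
  exact Sharpening.isProbabilityMeasure_tripleLaw μ (measurable_linSoftmax hφm θ)
    (measurable_linSoftmax hφm θs) (fun x y => (linSoftmax_pos θ x y).le)
    (fun x y => (linSoftmax_pos θs x y).le) (sum_linSoftmax θ) (sum_linSoftmax θs)

theorem IsXPORule.isProbabilityMeasure_trainLaw {μ : Measure X} [IsProbabilityMeasure μ]
    {r : X → Y → ℝ} (hφm : ∀ y, Measurable fun x => φ x y) (hθs : ‖θs‖ ≤ B)
    (hA : IsXPORule (softmaxClass φ B) (linSoftmax φ θs) r β α A) (T : ℕ) :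
    IsProbabilityMeasure (trainLaw μ (linSoftmax φ θs) A T) := by
  rw [trainLaw_eq_adaptiveLaw]
  exact isProbabilityMeasure_adaptiveLaw (hA.measurable_update (measurable_linSoftmax hφm θs) μ)
    (hA.isProbabilityMeasure_tripleLaw hφm hθs) T

variable [DiscreteMeasurableSpace Y]

/-- Concentration of the log-likelihood of a fixed model on the base responses. -/
theorem IsXPORule.logRatio_concentration {μ : Measure X} [IsProbabilityMeasure μ]
    {r : X → Y → ℝ} (hφm : ∀ y, Measurable fun x => φ x y) (hφ : ∀ x y, ‖φ x y‖ ≤ 1) (hB : 0 < B)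
    (hθs : ‖θs‖ ≤ B)
    (hA : IsXPORule (softmaxClass φ B) (linSoftmax φ θs) r β α A) {T : ℕ} (hT : 0 < T)
    {θ θb : EuclideanSpace ℝ (Fin d)} (hθ : ‖θ‖ ≤ B) (hθb : ‖θb‖ ≤ B)
    {s : ℕ} (hs : s ≤ T) {E : ℝ} (hE : 0 ≤ E) :
    trainLaw μ (linSoftmax φ θs) A T {D | E ≤ s * expect μ (linSoftmax φ θs)
          (logRatio (linSoftmax φ θ) (linSoftmax φ θb)) -
        ∑ i, logRatio (linSoftmax φ θ) (linSoftmax φ θb)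
          (history D s hs i).1 (history D s hs i).2.2} ≤
      ENNReal.ofReal (Real.exp (-(E ^ 2 / (2 * T * (8 * B) ^ 2)))) := by
  have hm : Measurable fun z : X × Y × Y =>
      logRatio (linSoftmax φ θ) (linSoftmax φ θb) z.1 z.2.2 :=
    measurable_logRatio_snd (measurable_linSoftmax hφm θ) (measurable_linSoftmax hφm θb)
  -- Switching the increments off from time `s` on turns a statement about a prefix into one about
  -- the law of all `T` triples.
  let f : (t : ℕ) → (Fin t → X × Y × Y) → X × Y × Y → ℝ := fun t _ z =>
    if t < s then logRatio (linSoftmax φ θ) (linSoftmax φ θb) z.1 z.2.2 else 0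
  have hf : ∀ t, Measurable fun p : (Fin t → X × Y × Y) × (X × Y × Y) => f t p.1 p.2 := by
    intro t
    by_cases h : t < s
    · simpa only [f, if_pos h, Function.comp_def] using hm.comp measurable_snd
    · simpa only [f, if_neg h] using measurable_const
  have hb : ∀ t D z, |f t D z| ≤ 4 * B := by
    intro t D z
    by_cases h : t < s
    · simpa only [f, if_pos h] using abs_logRatio_le hφ hθ hθb z.1 z.2.2
    · simpa only [f, if_neg h, abs_zero] using by linarith
  have key := adaptiveLaw_centeredSum_ge_le
    (hA.measurable_update (measurable_linSoftmax hφm θs) μ)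
    (hA.isProbabilityMeasure_tripleLaw hφm hθs) hf (by linarith) hb hT hE
  rw [← trainLaw_eq_adaptiveLaw, show 2 * (4 * B) = 8 * B by ring] at key
  refine le_trans (le_of_eq (congrArg _ (Set.ext fun D => ?_))) key
  have hsum : adaptedSum (fun t D z => ∫ z', f t D z' ∂(tripleLaw μ (A t D) (linSoftmax φ θs)) -
      f t D z) D = s * expect μ (linSoftmax φ θs)
          (logRatio (linSoftmax φ θ) (linSoftmax φ θb)) -
        ∑ i, logRatio (linSoftmax φ θ) (linSoftmax φ θb)
          (history D s hs i).1 (history D s hs i).2.2 := by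
    rw [adaptedSum]
    have hterm : ∀ i : Fin T, ∫ z', f i (history D i i.isLt.le) z'
        ∂(tripleLaw μ (A i (history D i i.isLt.le)) (linSoftmax φ θs)) -
        f i (history D i i.isLt.le) (D i) =
        if (i : ℕ) < s then expect μ (linSoftmax φ θs)
          (logRatio (linSoftmax φ θ) (linSoftmax φ θb)) -
          logRatio (linSoftmax φ θ) (linSoftmax φ θb) (D i).1 (D i).2.2 else 0 := by
      intro i
      by_cases h : (i : ℕ) < s
      · simp only [f, if_pos h]
        obtain ⟨θ', -, hθ'⟩ := hA.exists_param hθs i (history D i i.isLt.le)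
        rw [hθ', integral_logRatio_tripleLaw μ hφm hφ]
      · simp only [f, if_neg h, integral_zero, sub_zero]
    rw [Finset.sum_congr rfl fun i _ => hterm i, sum_fin_ite_lt hs, Finset.sum_sub_distrib]
    simp [history]
  change _ ↔ E ≤ _
  rw [hsum]
  rfl

/-- Concentration of the sampled log-ratio gaps around their conditional expectations. -/
theorem IsXPORule.ratioGap_concentration {μ : Measure X} [IsProbabilityMeasure μ]
    {r : X → Y → ℝ} (hφm : ∀ y, Measurable fun x => φ x y) (hφ : ∀ x y, ‖φ x y‖ ≤ 1) (hB : 0 < B)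
    (hθs : ‖θs‖ ≤ B)
    (hA : IsXPORule (softmaxClass φ B) (linSoftmax φ θs) r β α A) {T : ℕ} (hT : 0 < T)
    {θb : EuclideanSpace ℝ (Fin d)} (hθb : ‖θb‖ ≤ B) {a : ℝ} (ha : 0 ≤ a) :
    trainLaw μ (linSoftmax φ θs) A T {D | a ≤ ∑ s : Fin T,
        (klExpect μ (A s (history D s s.isLt.le)) (linSoftmax φ θb) -
        expect μ (linSoftmax φ θs)
          (logRatio (A s (history D s s.isLt.le)) (linSoftmax φ θb)) -
        ratioGap (A s (history D s s.isLt.le)) (linSoftmax φ θb) (D s))} ≤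
      ENNReal.ofReal (Real.exp (-(a ^ 2 / (2 * T * (16 * B) ^ 2)))) := by
  have hm : ∀ t, Measurable fun p : (Fin t → X × Y × Y) × (X × Y × Y) =>
      ratioGap (A t p.1) (linSoftmax φ θb) p.2 := fun t =>
    have h := measurable_logRatio_triple (hA.measurable t) (measurable_linSoftmax hφm θb)
    h.1.sub h.2
  have hb : ∀ t D z, |ratioGap (A t D) (linSoftmax φ θb) z| ≤ 8 * B := by
    intro t D z
    obtain ⟨θ, hθB, hθ⟩ := hA.exists_param hθs t D
    rw [hθ]
    have h1 := abs_logRatio_le hφ hθB hθb z.1 z.2.1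
    have h2 := abs_logRatio_le hφ hθB hθb z.1 z.2.2
    exact (abs_sub _ _).trans (by linarith)
  have key := adaptiveLaw_centeredSum_ge_le
    (hA.measurable_update (measurable_linSoftmax hφm θs) μ)
    (hA.isProbabilityMeasure_tripleLaw hφm hθs)
    (f := fun t D z => ratioGap (A t D) (linSoftmax φ θb) z) hm (by linarith) hb hT ha
  rw [← trainLaw_eq_adaptiveLaw, show 2 * (8 * B) = 16 * B by ring] at key
  refine le_trans (le_of_eq (congrArg _ (Set.ext fun D => ?_))) key
  have hsum : adaptedSum (fun t D z => ∫ z', ratioGap (A t D) (linSoftmax φ θb) z'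
      ∂(tripleLaw μ (A t D) (linSoftmax φ θs)) - ratioGap (A t D) (linSoftmax φ θb) z) D =
      ∑ s : Fin T, (klExpect μ (A s (history D s s.isLt.le)) (linSoftmax φ θb) -
        expect μ (linSoftmax φ θs)
          (logRatio (A s (history D s s.isLt.le)) (linSoftmax φ θb)) -
        ratioGap (A s (history D s s.isLt.le)) (linSoftmax φ θb) (D s)) := by
    refine Finset.sum_congr rfl fun i _ => ?_
    obtain ⟨θ', -, hθ'⟩ := hA.exists_param hθs i (history D i i.isLt.le)
    beta_reduce
    rw [hθ', integral_ratioGap_tripleLaw μ hφm hφ]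
  change _ ↔ a ≤ _
  rw [hsum]
  rfl

/-- With high probability, the total divergence of the iterates from the optimal policy is
sublinear. -/
theorem IsXPORule.trainLaw_regret_le {μ : Measure X} [IsProbabilityMeasure μ]
    (hφm : ∀ y, Measurable fun x => φ x y) (hφ : ∀ x y, ‖φ x y‖ ≤ 1) (hd : 0 < d) (hB : 1 ≤ B)
    (hα : 0 < α) (hβ : 0 < β) (hθs : ‖θs‖ ≤ B) (hθb : ‖(1 + 1 / β) • θs‖ ≤ B)
    (hA : IsXPORule (softmaxClass φ B) (linSoftmax φ θs)
      (fun x y => Real.log (linSoftmax φ θs x y)) β α A) {T : ℕ} (hT : 0 < T) {E Az : ℝ}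
    (hE : 0 ≤ E) (hAz : 0 ≤ Az) :
    trainLaw μ (linSoftmax φ θs) A T {D | ¬ ∑ s : Fin T, klExpect μ (A s (history D s s.isLt.le))
          (linSoftmax φ ((1 + 1 / β) • θs)) ≤
      Az + 4 * B + (E + 4) * (1 + Real.log T) + 16 * B ^ 2 * β ^ 2 / α +
      α * T / (2 * β ^ 2) * (d * Real.log (d * (T + 1)))} ≤
    ENNReal.ofReal (T * (3 * (B * d * T)) ^ d * Real.exp (-(E ^ 2 / (2 * T * (8 * B) ^ 2))) +
      Real.exp (-(Az ^ 2 / (2 * T * (16 * B) ^ 2)))) := by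
  set θb := (1 + 1 / β) • θs with hθbdef
  have hB0 : 0 < B := by linarith
  have hT' : (1 : ℝ) ≤ T := by exact_mod_cast hT
  have hd' : (1 : ℝ) ≤ d := by exact_mod_cast hd
  -- Resolution `1/T`: log-ratios are `2`-Lipschitz in the parameter, so the scaled mean and the sum
  -- of at most `T` terms move by at most `2` each. This is the `4` added to `E`.
  obtain ⟨F, hFB, hF, hFc⟩ := exists_net hd hB0 (show (0 : ℝ) < T by linarith)
    (one_le_mul_of_one_le_of_one_le (one_le_mul_of_one_le_of_one_le hB hd') hT')
  let dev : (s : ℕ) → s ≤ T → EuclideanSpace ℝ (Fin d) → (Fin T → X × Y × Y) → ℝ :=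
    fun s hs θ D => s * expect μ (linSoftmax φ θs)
          (logRatio (linSoftmax φ θ) (linSoftmax φ θb)) -
        ∑ i, logRatio (linSoftmax φ θ) (linSoftmax φ θb)
          (history D s hs i).1 (history D s hs i).2.2
  let reg : (Fin T → X × Y × Y) → ℝ := fun D => ∑ s : Fin T,
        (klExpect μ (A s (history D s s.isLt.le)) (linSoftmax φ θb) -
        expect μ (linSoftmax φ θs)
          (logRatio (A s (history D s s.isLt.le)) (linSoftmax φ θb)) -
        ratioGap (A s (history D s s.isLt.le)) (linSoftmax φ θb) (D s))
  have hdev : ∀ (s : ℕ) (hs : s ≤ T) (θ θ' : EuclideanSpace ℝ (Fin d)) (D : Fin T → X × Y × Y),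
      ‖θ - θ'‖ ≤ 1 / T → dev s hs θ D ≤ dev s hs θ' D + 4 := by
    intro s hs θ θ' D h
    have h1 := logRatio_expect_sub_le (μ := μ) (θs := θs) hφm hφ θ θ' θb
    have h2 : ∑ i, logRatio (linSoftmax φ θ') (linSoftmax φ θb)
          (history D s hs i).1 (history D s hs i).2.2 -
        ∑ i, logRatio (linSoftmax φ θ) (linSoftmax φ θb)
          (history D s hs i).1 (history D s hs i).2.2 ≤ s * (2 * ‖θ - θ'‖) := by
      rw [← Finset.sum_sub_distrib]
      refine (Finset.sum_le_card_nsmul _ _ (2 * ‖θ - θ'‖) fun i _ => ?_).trans (by simp)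
      rw [logRatio_sub, norm_sub_rev]
      exact (le_abs_self _).trans (abs_log_linSoftmax_div_le hφ θ' θ _ _)
    have h3 : (s : ℝ) * (2 * ‖θ - θ'‖) ≤ 2 := by
      have hsT : (s : ℝ) ≤ T := by exact_mod_cast hs
      calc (s : ℝ) * (2 * ‖θ - θ'‖) ≤ T * (2 * (1 / T)) := by gcongr
        _ = 2 := by field_simp
    have h4 := mul_le_mul_of_nonneg_left h1 (Nat.cast_nonneg (α := ℝ) s)
    rw [mul_sub] at h4
    simp only [dev]
    linarith
  have hsub : {D | ¬ ∑ s : Fin T, klExpect μ (A s (history D s s.isLt.le)) (linSoftmax φ θb) ≤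
      Az + 4 * B + (E + 4) * (1 + Real.log T) + 16 * B ^ 2 * β ^ 2 / α +
      α * T / (2 * β ^ 2) * (d * Real.log (d * (T + 1)))} ⊆
      (⋃ p ∈ (Finset.univ : Finset (Fin T)) ×ˢ F, {D | E ≤ dev p.1 p.1.isLt.le p.2 D}) ∪
        {D | Az ≤ reg D} := by
    intro D hD
    by_contra hc
    simp only [Set.mem_union, Set.mem_iUnion, not_or, not_exists] at hc
    refine hD (hA.sum_klExpect_le hφ hd hα hβ hθs hθb hT (by linarith) D (fun s hs θ hθ => ?_)
      (not_le.mp hc.2).le)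
    obtain ⟨θ', hθ', hdist⟩ := hF θ hθ
    have h1 := hdev s hs.le θ θ' D hdist
    have h2 := hc.1 (⟨s, hs⟩, θ') (Finset.mem_product.mpr ⟨Finset.mem_univ _, hθ'⟩)
    have h3 : dev s hs.le θ' D < E := not_le.mp h2
    exact h1.trans (by linarith)
  refine (measure_mono hsub).trans ((measure_union_le _ _).trans ?_)
  rw [ENNReal.ofReal_add (by positivity) (by positivity)]
  refine add_le_add ((measure_biUnion_finset_le _ _).trans ?_)
    (hA.ratioGap_concentration hφm hφ hB0 hθs hT hθb hAz)
  refine (Finset.sum_le_card_nsmul _ _ _ fun p hp => hA.logRatio_concentration hφm hφ hB0 hθs hT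
    (hFB _ (Finset.mem_product.mp hp).2) hθb p.1.isLt.le hE).trans ?_
  rw [Finset.card_product, Finset.card_univ, Fintype.card_fin, nsmul_eq_mul,
    ← ENNReal.ofReal_natCast, ← ENNReal.ofReal_mul (by positivity)]
  refine ENNReal.ofReal_le_ofReal ?_
  push_cast
  gcongr

end Concentration

/-! ### Success probabilities -/

/-- Only subadditivity is used, so `S` may be non-measurable, as success events may be. -/
theorem ofReal_one_sub_le_measure {Ω : Type*} [MeasurableSpace Ω] {ν : Measure Ω}
    [IsProbabilityMeasure ν] {S : Set Ω} {p : ℝ} (hp : 0 ≤ p) (h : ν Sᶜ ≤ ENNReal.ofReal p) :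
    ENNReal.ofReal (1 - p) ≤ ν S := by
  have h1 : (1 : ℝ≥0∞) ≤ ν S + ν Sᶜ := by
    rw [← measure_univ (μ := ν), ← Set.union_compl_self S]
    exact measure_union_le _ _
  rw [ENNReal.ofReal_sub _ hp, ENNReal.ofReal_one]
  exact tsub_le_iff_right.mpr (h1.trans (by gcongr))

/-- Combines the failure probabilities of training and validation. Passing to a measurable hull of
the bad set avoids measurability of `S` and `F`. -/
theorem ofReal_le_lintegral_of_forall {Ω : Type*} [MeasurableSpace Ω] {ν : Measure Ω}
    [IsProbabilityMeasure ν] {S : Set Ω} {p q : ℝ} (hp : 0 ≤ p) (hp1 : p ≤ 1) (hq : 0 ≤ q)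
    (h : ν Sᶜ ≤ ENNReal.ofReal p) {F : Ω → ℝ≥0∞}
    (hF : ∀ ω ∈ S, ENNReal.ofReal (1 - q) ≤ F ω) :
    ENNReal.ofReal (1 - (p + q)) ≤ ∫⁻ ω, F ω ∂ν := by
  set S' := (toMeasurable ν Sᶜ)ᶜ with hS'
  have hm : MeasurableSet S' := (measurableSet_toMeasurable _ _).compl
  have hsub : S' ⊆ S := by
    rw [hS', Set.compl_subset_comm]; exact subset_toMeasurable _ _
  have hS1 : ENNReal.ofReal (1 - p) ≤ ν S' := ofReal_one_sub_le_measure hp (by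
    rw [hS', compl_compl, measure_toMeasurable]; exact h)
  calc ENNReal.ofReal (1 - (p + q)) ≤ ENNReal.ofReal ((1 - p) * (1 - q)) :=
        ENNReal.ofReal_le_ofReal (by nlinarith [mul_nonneg hp hq])
    _ = ENNReal.ofReal (1 - p) * ENNReal.ofReal (1 - q) := ENNReal.ofReal_mul (by linarith)
    _ ≤ ν S' * ENNReal.ofReal (1 - q) := by gcongr
    _ = ∫⁻ ω, S'.indicator (fun _ => ENNReal.ofReal (1 - q)) ω ∂ν := by
        rw [lintegral_indicator_const hm, mul_comm]
    _ ≤ ∫⁻ ω, F ω ∂ν := lintegral_mono fun ω => by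
        by_cases hω : ω ∈ S'
        · rw [Set.indicator_of_mem hω]; exact hF ω (hsub hω)
        · rw [Set.indicator_of_notMem hω]; exact zero_le

/-! ### Hoeffding bounds for the validation sample. -/

section Validation

open ProbabilityTheory

/-- Hoeffding's inequality for the averages of the rows of an array of independent variables. -/
theorem pi_sum_row_ge_le {ι W : Type*} [Fintype ι] [MeasurableSpace W] {n : ℕ} (hn : 0 < n)
    {ν : ι → Measure W} [∀ s, IsProbabilityMeasure (ν s)] {g : ι → W → ℝ}
    (hg : ∀ s, Measurable (g s)) {b : ℝ} (hb : ∀ s w, |g s w| ≤ b)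
    (h0 : ∀ s, ∫ w, g s w ∂(ν s) = 0) (s : ι) {τ : ℝ} (hτ : 0 ≤ τ) :
    (Measure.pi fun q : ι × Fin n => ν q.1) {V | n * τ ≤ ∑ i, g s (V (s, i))} ≤
      ENNReal.ofReal (Real.exp (-(n * τ ^ 2 / (2 * b ^ 2)))) := by
  classical
  set P := Measure.pi fun q : ι × Fin n => ν q.1 with hP
  have hm : ∀ q : ι × Fin n, Measurable fun V : ι × Fin n → W => g q.1 (V q) := fun q =>
    (hg q.1).comp (measurable_pi_apply q)
  have hind : iIndepFun (fun (q : ι × Fin n) (V : ι × Fin n → W) => g q.1 (V q)) P :=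
    iIndepFun_pi (X := fun (q : ι × Fin n) w => g q.1 w) fun q => (hg q.1).aemeasurable
  have hsub : ∀ q ∈ ({s} ×ˢ Finset.univ : Finset (ι × Fin n)),
      HasSubgaussianMGF (fun V : ι × Fin n → W => g q.1 (V q)) ((‖b - -b‖₊ / 2) ^ 2) P := by
    intro q _
    refine hasSubgaussianMGF_of_mem_Icc_of_integral_eq_zero (hm q).aemeasurable
      (Filter.Eventually.of_forall fun V => abs_le.mp (hb q.1 (V q))) ?_
    rw [← h0 q.1]
    have hmp := measurePreserving_eval (fun q : ι × Fin n => ν q.1) q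
    rw [← hmp.map_eq, integral_map hmp.measurable.aemeasurable (hg q.1).aestronglyMeasurable]
  have h := HasSubgaussianMGF.measure_sum_ge_le_of_iIndepFun hind hsub
    (show 0 ≤ (n : ℝ) * τ by positivity)
  have hn' : (0 : ℝ) < n := by exact_mod_cast hn
  rw [← ofReal_measureReal]
  refine ENNReal.ofReal_le_ofReal (le_trans (le_of_eq ?_) (h.trans (le_of_eq ?_)))
  · congr 1
    ext V
    simp
  · congr 1
    have hnn : (((‖b - -b‖₊ / 2) ^ 2 : NNReal) : ℝ) = b ^ 2 := by
      push_cast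
      rw [Real.norm_eq_abs, div_pow, sq_abs]
      ring
    have hc : ((∑ _q ∈ ({s} ×ˢ Finset.univ : Finset (ι × Fin n)), (‖b - -b‖₊ / 2) ^ 2 : NNReal) : ℝ)
        = n * b ^ 2 := by
      rw [Finset.sum_const, nsmul_eq_mul, NNReal.coe_mul, hnn]
      simp
    rw [hc]
    -- For `b = 0` both exponents are zero because division by zero gives zero.
    by_cases hb0 : b = 0
    · simp [hb0]
    · field_simp

/-- Two-sided Hoeffding bound, uniformly over the rows. -/
theorem pi_exists_abs_sum_row_ge_le {ι W : Type*} [Fintype ι] [MeasurableSpace W] {n : ℕ}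
    (hn : 0 < n) {ν : ι → Measure W} [∀ s, IsProbabilityMeasure (ν s)] {g : ι → W → ℝ}
    (hg : ∀ s, Measurable (g s)) {b : ℝ} (hb : ∀ s w, |g s w| ≤ b)
    (h0 : ∀ s, ∫ w, g s w ∂(ν s) = 0) {τ : ℝ} (hτ : 0 ≤ τ) :
    (Measure.pi fun q : ι × Fin n => ν q.1) {V | ∃ s, n * τ ≤ |∑ i, g s (V (s, i))|} ≤
      ENNReal.ofReal (Fintype.card ι * (2 * Real.exp (-(n * τ ^ 2 / (2 * b ^ 2))))) := by
  have hsub : {V : ι × Fin n → W | ∃ s, n * τ ≤ |∑ i, g s (V (s, i))|} ⊆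
      ⋃ s ∈ (Finset.univ : Finset ι), ({V | n * τ ≤ ∑ i, g s (V (s, i))} ∪
        {V | n * τ ≤ ∑ i, -g s (V (s, i))}) := by
    rintro V ⟨s, hs⟩
    simp only [Set.mem_iUnion]
    refine ⟨s, Finset.mem_univ _, ?_⟩
    rcases le_abs.mp hs with h | h
    · exact Or.inl h
    · exact Or.inr (by change n * τ ≤ ∑ i, -g s (V (s, i)); rwa [Finset.sum_neg_distrib])
  refine (measure_mono hsub).trans ((measure_biUnion_finset_le _ _).trans ?_)
  refine (Finset.sum_le_card_nsmul _ _
    (ENNReal.ofReal (2 * Real.exp (-(n * τ ^ 2 / (2 * b ^ 2))))) fun s _ => ?_).trans ?_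
  · refine (measure_union_le _ _).trans ?_
    rw [two_mul, ENNReal.ofReal_add (Real.exp_pos _).le (Real.exp_pos _).le]
    refine add_le_add (pi_sum_row_ge_le hn hg hb h0 s hτ) ?_
    exact pi_sum_row_ge_le (g := fun s w => -g s w) hn (fun s => (hg s).neg)
      (fun s w => by rw [abs_neg]; exact hb s w) (fun s => by rw [integral_neg, h0, neg_zero]) s hτ
  · rw [Finset.card_univ, nsmul_eq_mul, ← ENNReal.ofReal_natCast,
      ← ENNReal.ofReal_mul (by positivity)]

end Validation

/-! ### From regret and validation accuracy to the success probability. -/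

section Success

variable {X Y : Type*} [MeasurableSpace X] [MeasurableSpace Y] [DiscreteMeasurableSpace Y]
  [Fintype Y] [Nonempty Y] {d : ℕ} {φ : X → Y → EuclideanSpace ℝ (Fin d)} {B β α : ℝ}
  {θs : EuclideanSpace ℝ (Fin d)} {A : (t : ℕ) → (Fin t → X × Y × Y) → Model X Y}

/-- The summand of `klEstimate` for a linear softmax model. -/
def klSummand (φ : X → Y → EuclideanSpace ℝ (Fin d)) (θs : EuclideanSpace ℝ (Fin d)) (β : ℝ)
    (π : Model X Y) (x : X) (y : Y) : ℝ :=
  Real.log (linSoftmax φ θs x y) - β * Real.log (π x y / linSoftmax φ θs x y)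

theorem abs_klSummand_le {X Y : Type*} [Fintype Y] [Nonempty Y]
    {φ : X → Y → EuclideanSpace ℝ (Fin d)} (hφ : ∀ x y, ‖φ x y‖ ≤ 1) (hβ : 0 < β) (hβ1 : β ≤ 1)
    (hθs : ‖θs‖ ≤ B) {θ : EuclideanSpace ℝ (Fin d)} (hθ : ‖θ‖ ≤ B) (x : X) (y : Y) :
    |klSummand φ θs β (linSoftmax φ θ) x y| ≤ 6 * B + Real.log (Fintype.card Y) := by
  have h1 := abs_log_linSoftmax_le hφ θs x y
  have h2 := abs_logRatio_le hφ hθ hθs x y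
  rw [logRatio] at h2
  have h3 : |β * Real.log (linSoftmax φ θ x y / linSoftmax φ θs x y)| ≤ 4 * B := by
    rw [abs_mul, abs_of_pos hβ]
    exact (mul_le_of_le_one_left (abs_nonneg _) hβ1).trans h2
  exact (abs_sub _ _).trans (by linarith)

theorem klObjective_eq_expect {X Y : Type*} [MeasurableSpace X] [Fintype Y] [Nonempty Y]
    {φ : X → Y → EuclideanSpace ℝ (Fin d)} {μ : Measure X} [IsProbabilityMeasure μ]
    (hφm : ∀ y, Measurable fun x => φ x y) (hφ : ∀ x y, ‖φ x y‖ ≤ 1)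
    (θ : EuclideanSpace ℝ (Fin d)) :
    klObjective μ (linSoftmax φ θs) (fun x y => Real.log (linSoftmax φ θs x y)) β
      (linSoftmax φ θ) = expect μ (linSoftmax φ θ) (klSummand φ θs β (linSoftmax φ θ)) := by
  have hi1 : Integrable (fun x => ∑ y, linSoftmax φ θ x y * Real.log (linSoftmax φ θs x y)) μ :=
    integrable_expect μ hφm θ (fun y => (measurable_linSoftmax hφm θs y).log)
      fun x y => abs_log_linSoftmax_le hφ θs x y
  have hi2 : Integrable (fun x => ∑ y, linSoftmax φ θ x y *
      Real.log (linSoftmax φ θ x y / linSoftmax φ θs x y)) μ :=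
    integrable_expect μ hφm θ (fun y => measurable_log_linSoftmax_div hφm θ θs y)
      fun x y => abs_log_linSoftmax_div_le hφ θ θs x y
  rw [klObjective, expect, expect, expect, ← integral_const_mul,
    ← integral_sub hi1 (hi2.const_mul β)]
  refine integral_congr_ae (Filter.Eventually.of_forall fun x => ?_)
  beta_reduce
  rw [Finset.mul_sum, ← Finset.sum_sub_distrib]
  exact Finset.sum_congr rfl fun y _ => by rw [klSummand]; ring

theorem measurable_klSummand {X Y : Type*} [MeasurableSpace X] [MeasurableSpace Y]
    [DiscreteMeasurableSpace Y] [Fintype Y] {φ : X → Y → EuclideanSpace ℝ (Fin d)} (hφm : ∀ y, Measurable fun x => φ x y)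
    (θ : EuclideanSpace ℝ (Fin d)) :
    Measurable fun z : X × Y => klSummand φ θs β (linSoftmax φ θ) z.1 z.2 :=
  measurable_from_prod_countable_left fun y => ((measurable_linSoftmax hφm θs y).log).sub
    ((measurable_log_linSoftmax_div hφm θ θs y).const_mul β)

/-- Uniform accuracy of the validation estimates. -/
theorem validation_failure_le {μ : Measure X} [IsProbabilityMeasure μ]
    (hφm : ∀ y, Measurable fun x => φ x y) (hφ : ∀ x y, ‖φ x y‖ ≤ 1)
    (hβ : 0 < β) (hβ1 : β ≤ 1) (hθs : ‖θs‖ ≤ B) {ι : Type*} [Fintype ι]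
    {M : ι → Model X Y} (hM : ∀ s, ∃ θ, ‖θ‖ ≤ B ∧ M s = linSoftmax φ θ) {n : ℕ} (hn : 0 < n)
    {τ : ℝ} (hτ : 0 ≤ τ) :
    (Measure.pi fun q : ι × Fin n => pairLaw μ (M q.1)) {V | ∃ s, τ ≤
      |klEstimate (linSoftmax φ θs) (fun x y => Real.log (linSoftmax φ θs x y)) β (M s)
        (fun i => V (s, i)) - klObjective μ (linSoftmax φ θs)
          (fun x y => Real.log (linSoftmax φ θs x y)) β (M s)|} ≤
      ENNReal.ofReal (Fintype.card ι * (2 * Real.exp (-(n * τ ^ 2 /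
        (2 * (2 * (6 * B + Real.log (Fintype.card Y))) ^ 2))))) := by
  choose θ hθB hθ using hM
  obtain rfl : M = fun s => linSoftmax φ (θ s) := funext hθ
  have hn' : (0 : ℝ) < n := by exact_mod_cast hn
  set C := 6 * B + Real.log (Fintype.card Y) with hC
  have hprob : ∀ s, IsProbabilityMeasure (pairLaw μ (linSoftmax φ (θ s))) := fun s =>
    isProbabilityMeasure_pairLaw μ (measurable_linSoftmax hφm _)
      (fun x y => (linSoftmax_pos _ x y).le) (sum_linSoftmax _)
  let J : ι → ℝ := fun s => klObjective μ (linSoftmax φ θs)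
          (fun x y => Real.log (linSoftmax φ θs x y)) β (linSoftmax φ (θ s))
  have hbd : ∀ s x y, |klSummand φ θs β (linSoftmax φ (θ s)) x y| ≤ C := fun s =>
    abs_klSummand_le hφ hβ hβ1 hθs (hθB s)
  have hmean : ∀ s, ∫ z : X × Y, klSummand φ θs β (linSoftmax φ (θ s)) z.1 z.2
      ∂(pairLaw μ (linSoftmax φ (θ s))) = J s := by
    intro s
    rw [integral_pairLaw μ (measurable_linSoftmax hφm _) (fun x y => (linSoftmax_pos _ x y).le)
      (linSoftmax_le_one _) (measurable_klSummand hφm (θ s)) (hbd s)]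
    exact (klObjective_eq_expect hφm hφ (θ s)).symm
  have hJ : ∀ s, |J s| ≤ C := by
    intro s
    rw [← hmean s]
    have h := norm_integral_le_of_norm_le_const (μ := pairLaw μ (linSoftmax φ (θ s)))
      (f := fun z : X × Y => klSummand φ θs β (linSoftmax φ (θ s)) z.1 z.2)
      (Filter.Eventually.of_forall fun z => hbd s z.1 z.2)
    rwa [probReal_univ, mul_one] at h
  have key := pi_exists_abs_sum_row_ge_le (ι := ι) hn
    (ν := fun s => pairLaw μ (linSoftmax φ (θ s)))
    (g := fun s z => klSummand φ θs β (linSoftmax φ (θ s)) z.1 z.2 - J s) (b := 2 * C)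
    (fun s => (measurable_klSummand hφm (θ s)).sub_const _)
    (fun s z => (abs_sub _ _).trans (by linarith [hbd s z.1 z.2, hJ s]))
    (fun s => by
      rw [integral_sub (integrable_of_bounded (measurable_klSummand hφm (θ s)) C
        fun z => hbd s z.1 z.2) (integrable_const _), hmean]
      simp) hτ
  refine le_trans (measure_mono ?_) key
  rintro V ⟨s, hs⟩
  refine ⟨s, ?_⟩
  have : ∑ i, (klSummand φ θs β (linSoftmax φ (θ s)) (V (s, i)).1 (V (s, i)).2 - J s) =
      n * (klEstimate (linSoftmax φ θs) (fun x y => Real.log (linSoftmax φ θs x y)) β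
        (linSoftmax φ (θ s)) (fun i => V (s, i)) - J s) := by
    rw [Finset.sum_sub_distrib, Finset.sum_const, Finset.card_univ, Fintype.card_fin, nsmul_eq_mul,
      klEstimate, mul_sub, mul_div_cancel₀ _ hn'.ne']
    rfl
  rw [this, abs_mul, abs_of_pos hn']
  exact mul_le_mul_of_nonneg_left hs hn'.le

/-- Selecting an approximate maximizer of the objective among models one of which is close to
optimal gives a sharpened model. -/
theorem isSharpened_of_klObjective_ge {X Y : Type*} [MeasurableSpace X] [Fintype Y] [Nonempty Y]
    {φ : X → Y → EuclideanSpace ℝ (Fin d)} {μ : Measure X} [IsProbabilityMeasure μ]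
    (hφm : ∀ y, Measurable fun x => φ x y) (hφ : ∀ x y, ‖φ x y‖ ≤ 1) {γ δ ε : ℝ} (hγ : 0 < γ)
    (hγ1 : γ < 1) (hδ : 0 < δ) (hδ1 : δ < 1) (hm : MarginCondition μ (linSoftmax φ θs) γ)
    (hβ : β = xpoBeta (Fintype.card Y) δ γ) (hβ0 : 0 < β)
    {θ θ' : EuclideanSpace ℝ (Fin d)}
    (hθ' : klExpect μ (linSoftmax φ θ') (linSoftmax φ ((1 + 1 / β) • θs)) ≤ ε * δ / 20)
    (h : klObjective μ (linSoftmax φ θs) (fun x y => Real.log (linSoftmax φ θs x y)) β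
        (linSoftmax φ θ') - β * (ε * δ / 20) ≤
      klObjective μ (linSoftmax φ θs) (fun x y => Real.log (linSoftmax φ θs x y)) β
        (linSoftmax φ θ)) :
    IsSharpened μ (linSoftmax φ θs) ε δ (linSoftmax φ θ) := by
  obtain ⟨C, hC⟩ := klObjective_linSoftmax μ hφm hφ θs hβ0.ne'
  rw [hC, hC] at h
  refine isSharpened_of_klExpect_le hφm hφ hγ hγ1 hδ hδ1 hm ?_
  rw [← hβ]
  have : β * klExpect μ (linSoftmax φ θ) (linSoftmax φ ((1 + 1 / β) • θs)) ≤
      β * (klExpect μ (linSoftmax φ θ') (linSoftmax φ ((1 + 1 / β) • θs)) + ε * δ / 20) := by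
    rw [mul_add]; linarith
  linarith [le_of_mul_le_mul_left this hβ0]

/-- Success of XPO, given numerical conditions on the number of iterations. -/
theorem IsXPORule.success {μ : Measure X} [IsProbabilityMeasure μ]
    (hφm : ∀ y, Measurable fun x => φ x y) (hφ : ∀ x y, ‖φ x y‖ ≤ 1) (hd : 0 < d) (hB : 1 ≤ B)
    {γ δ ε ρ : ℝ} (hγ : 0 < γ) (hγ1 : γ < 1) (hδ : 0 < δ) (hδ1 : δ < 1) (hε : 0 < ε)
    (hρ : 0 < ρ) (hρ1 : ρ < 1)
    (hm : MarginCondition μ (linSoftmax φ θs) γ) (hβ : β = xpoBeta (Fintype.card Y) δ γ)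
    (hβ0 : 0 < β) (hβ1 : β ≤ 1) (hα : 0 < α)
    (hθs : ‖θs‖ ≤ B) (hθb : ‖(1 + 1 / β) • θs‖ ≤ B)
    (hA : IsXPORule (softmaxClass φ B) (linSoftmax φ θs)
      (fun x y => Real.log (linSoftmax φ θs x y)) β α A) {T n : ℕ} (hT : 0 < T) (hn : 0 < n)
    {E Az : ℝ} (hE : 0 ≤ E) (hAz : 0 ≤ Az)
    (hreg : Az + 4 * B + (E + 4) * (1 + Real.log T) + 16 * B ^ 2 * β ^ 2 / α +
      α * T / (2 * β ^ 2) * (d * Real.log (d * (T + 1))) ≤ T * (ε * δ / 20))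
    (hfail : T * (3 * (B * d * T)) ^ d * Real.exp (-(E ^ 2 / (2 * T * (8 * B) ^ 2))) +
      Real.exp (-(Az ^ 2 / (2 * T * (16 * B) ^ 2))) ≤ ρ / 2)
    (hval : (T + 1) * (2 * Real.exp (-(n * (β * (ε * δ / 40)) ^ 2 /
        (2 * (2 * (6 * B + Real.log (Fintype.card Y))) ^ 2)))) ≤ ρ / 2) :
    ENNReal.ofReal (1 - ρ) ≤ xpoSuccess μ (linSoftmax φ θs)
        (fun x y => Real.log (linSoftmax φ θs x y)) β ε δ A T ∧
      ENNReal.ofReal (1 - ρ) ≤ xpoSuccessVal μ (linSoftmax φ θs)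
        (fun x y => Real.log (linSoftmax φ θs x y)) β ε δ A T n := by
  have hprob := hA.isProbabilityMeasure_trainLaw (μ := μ) hφm hθs T
  set G : Set (Fin T → X × Y × Y) := {D | ∑ s : Fin T,
    klExpect μ (A s (history D s s.isLt.le)) (linSoftmax φ ((1 + 1 / β) • θs)) ≤
      Az + 4 * B + (E + 4) * (1 + Real.log T) + 16 * B ^ 2 * β ^ 2 / α +
      α * T / (2 * β ^ 2) * (d * Real.log (d * (T + 1)))} with hG
  have hGc : trainLaw μ (linSoftmax φ θs) A T Gᶜ ≤ ENNReal.ofReal (ρ / 2) :=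
    (hA.trainLaw_regret_le hφm hφ hd hB hα hβ0 hθs hθb hT hE hAz).trans
      (ENNReal.ofReal_le_ofReal hfail)
  have hiter : ∀ D : Fin T → X × Y × Y, ∀ s : Fin (T + 1),
      ∃ θ, ‖θ‖ ≤ B ∧ iterate A D s = linSoftmax φ θ := fun D s => hA.exists_param hθs _ _
  have hgood : ∀ D ∈ G, ∃ s : Fin (T + 1), klExpect μ (iterate A D s)
      (linSoftmax φ ((1 + 1 / β) • θs)) ≤ ε * δ / 20 := by
    intro D hD
    have hle : ∑ s : Fin T, klExpect μ (A s (history D s s.isLt.le))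
        (linSoftmax φ ((1 + 1 / β) • θs)) ≤ ∑ _s : Fin T, ε * δ / 20 := by
      rw [Finset.sum_const, Finset.card_univ, Fintype.card_fin, nsmul_eq_mul]
      exact le_trans hD hreg
    have : Nonempty (Fin T) := ⟨⟨0, hT⟩⟩
    obtain ⟨s, -, hs⟩ := Finset.exists_le_of_sum_le Finset.univ_nonempty hle
    -- The regret covers only the first `T` of the `T + 1` candidates; the last one may also be
    -- selected, but is not needed as a witness.
    exact ⟨s.castSucc, hs⟩
  have hselect : ∀ D ∈ G, ∀ s : Fin (T + 1), (∀ s',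
      klObjective μ (linSoftmax φ θs) (fun x y => Real.log (linSoftmax φ θs x y)) β
        (iterate A D s') - β * (ε * δ / 20) ≤
      klObjective μ (linSoftmax φ θs) (fun x y => Real.log (linSoftmax φ θs x y)) β
        (iterate A D s)) → IsSharpened μ (linSoftmax φ θs) ε δ (iterate A D s) := by
    intro D hD s hs
    obtain ⟨s', hs'⟩ := hgood D hD
    have h := hs s'
    obtain ⟨θ, -, hθ⟩ := hiter D s
    obtain ⟨θ', -, hθ'⟩ := hiter D s'
    rw [hθ, hθ'] at h
    rw [hθ'] at hs'
    rw [hθ]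
    exact isSharpened_of_klObjective_ge hφm hφ hγ hγ1 hδ hδ1 hm hβ hβ0 hs' h
  constructor
  · refine (ENNReal.ofReal_le_ofReal (by linarith)).trans
      ((ofReal_one_sub_le_measure (by linarith) hGc).trans (measure_mono fun D hD s hs => ?_))
    refine hselect D hD s fun s' => (hs s').trans' ?_
    have : 0 ≤ β * (ε * δ / 20) := by positivity
    linarith
  · rw [xpoSuccessVal, show 1 - ρ = 1 - (ρ / 2 + ρ / 2) by ring]
    refine ofReal_le_lintegral_of_forall (by linarith) (by linarith) (by linarith) hGc
      fun D hD => ?_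
    have hprob' : ∀ q : Fin (T + 1) × Fin n,
        IsProbabilityMeasure (pairLaw μ (iterate A D q.1)) := fun q => by
      obtain ⟨θ, -, hθ⟩ := hiter D q.1
      rw [hθ]
      exact isProbabilityMeasure_pairLaw μ (measurable_linSoftmax hφm _)
        (fun x y => (linSoftmax_pos _ x y).le) (sum_linSoftmax _)
    -- Accuracy `β εδ/40` is used twice, for the selected and for the good model, which gives the
    -- slack `β εδ/20` allowed in `hselect`.
    have hv := validation_failure_le (μ := μ) hφm hφ hβ0 hβ1 hθs (hiter D) hn
      (show 0 ≤ β * (ε * δ / 40) by positivity)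
    rw [Fintype.card_fin] at hv
    push_cast at hv
    refine ofReal_one_sub_le_measure (by linarith) (le_trans (measure_mono ?_)
      (hv.trans (ENNReal.ofReal_le_ofReal hval)))
    intro V hV
    by_contra hcon
    refine hV fun s hs => hselect D hD s fun s' => ?_
    change ¬ ∃ s, _ ≤ _ at hcon
    push Not at hcon
    have h1 := abs_lt.mp (hcon s)
    have h2 := abs_lt.mp (hcon s')
    have h3 := hs s'
    linarith [h1.1, h1.2, h2.1, h2.2]

end Success

/-! ### The choice of parameters -/

/-- A common upper bound for all the parameters. -/
def paramSum (c : ℝ) (d N : ℕ) (ε δ γ ρ B : ℝ) : ℝ :=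
  2 + c + c⁻¹ + (ε⁻¹ + δ⁻¹ + γ⁻¹ + d + B + Real.log (N / ρ))

theorem xpoBeta_pos {N : ℕ} {δ γ : ℝ} (hδ : δ ∈ Set.Ioo (0 : ℝ) 1) (hγ : γ ∈ Set.Ioo (0 : ℝ) 1)
    (hN : 2 ≤ N) : 0 < xpoBeta N δ γ := by
  have hN' : (2 : ℝ) ≤ N := by exact_mod_cast hN
  have : 0 < Real.log (2 * N / δ) :=
    Real.log_pos (by rw [lt_div_iff₀ hδ.1]; linarith [hδ.2])
  have := hγ.1
  rw [xpoBeta]; positivity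

/-- The argument is at least `4`. The value `4/3` is chosen so that `γ B / (3 log (2N/δ)) ≤ γ B /
4`, which settles the case `B < 1`. -/
theorem log_two_mul_div_ge {N : ℕ} {δ : ℝ} (hδ : δ ∈ Set.Ioo (0 : ℝ) 1) (hN : 2 ≤ N) :
    4 / 3 ≤ Real.log (2 * N / δ) := by
  have hN' : (2 : ℝ) ≤ N := by exact_mod_cast hN
  have h4 : Real.log 4 = 2 * Real.log 2 := by
    rw [show (4 : ℝ) = 2 ^ 2 by norm_num, Real.log_pow]; norm_num
  have h : Real.log 4 ≤ Real.log (2 * N / δ) :=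
    Real.log_le_log (by norm_num) (by rw [le_div_iff₀ hδ.1]; nlinarith [hδ.1, hδ.2])
  linarith [Real.log_two_gt_d9]

theorem xpoBeta_le_one {N : ℕ} {δ γ : ℝ} (hδ : δ ∈ Set.Ioo (0 : ℝ) 1)
    (hγ : γ ∈ Set.Ioo (0 : ℝ) 1) (hN : 2 ≤ N) : xpoBeta N δ γ ≤ 1 := by
  have := log_two_mul_div_ge hδ hN
  rw [xpoBeta, div_le_one (by linarith)]
  linarith [hγ.2]

/-- The optimal policy belongs to the model class. -/
theorem norm_tilt_le {E : Type*} [NormedAddCommGroup E] [NormedSpace ℝ E] {θs : E} {N : ℕ}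
    {δ γ B : ℝ} (hδ : δ ∈ Set.Ioo (0 : ℝ) 1) (hγ : γ ∈ Set.Ioo (0 : ℝ) 1) (hN : 2 ≤ N)
    (hB : 0 < B) (hθ : ‖θs‖ ≤ γ * B / (3 * Real.log (2 * N / δ))) :
    ‖θs‖ ≤ B ∧ ‖(1 + 1 / xpoBeta N δ γ) • θs‖ ≤ B := by
  have hL := log_two_mul_div_ge hδ hN
  have hβ := xpoBeta_pos hδ hγ hN
  obtain ⟨hγ0, hγ1⟩ := hγ
  set L := Real.log (2 * N / δ) with hLdef
  have hL0 : 0 < L := by linarith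
  -- The factor is `(γ + 2L)/(3L)`, at most one since `γ < 1 < L`; this accounts for the `3` in the
  -- norm condition.
  have hmul : (1 + 1 / xpoBeta N δ γ) * (γ * B / (3 * L)) ≤ B := by
    have : (1 + 1 / xpoBeta N δ γ) * (γ * B / (3 * L)) = (γ + 2 * L) / (3 * L) * B := by
      rw [xpoBeta, ← hLdef]; field_simp
    rw [this]
    exact mul_le_of_le_one_left hB.le ((div_le_one (by positivity)).mpr (by linarith))
  have h1 : 0 < 1 / xpoBeta N δ γ := by positivity
  have h2 : ‖(1 + 1 / xpoBeta N δ γ) • θs‖ ≤ B := by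
    rw [norm_smul, Real.norm_of_nonneg (by linarith)]
    exact (mul_le_mul_of_nonneg_left hθ (by linarith)).trans hmul
  refine ⟨le_trans ?_ h2, h2⟩
  rw [norm_smul, Real.norm_of_nonneg (by linarith)]
  exact le_mul_of_one_le_left (norm_nonneg _) (by linarith)

section Bounds

variable {c : ℝ} {d N : ℕ} {ε δ γ ρ B : ℝ}

theorem log_le_log_div (hN : 2 ≤ N) (hρ : ρ ∈ Set.Ioo (0 : ℝ) 1) :
    0 ≤ Real.log N ∧ Real.log N ≤ Real.log (N / ρ) ∧ Real.log ρ⁻¹ ≤ Real.log (N / ρ) := by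
  have hN' : (2 : ℝ) ≤ N := by exact_mod_cast hN
  have h1 := Real.log_nonpos hρ.1.le hρ.2.le
  have h2 : 0 ≤ Real.log N := Real.log_nonneg (by linarith)
  rw [Real.log_div (by linarith) hρ.1.ne', Real.log_inv]
  exact ⟨h2, by linarith, by linarith⟩

theorem one_le_inv_of_mem {x : ℝ} (hx : x ∈ Set.Ioo (0 : ℝ) 1) : 1 ≤ x⁻¹ :=
  (one_le_inv₀ hx.1).mpr hx.2.le

/-- With every parameter bounded by one number `W`, the numerical conditions become comparisons of
monomials in `W` and `R`. -/
theorem paramSum_bounds (hc : 0 < c) (hε : ε ∈ Set.Ioo (0 : ℝ) 1) (hδ : δ ∈ Set.Ioo (0 : ℝ) 1)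
    (hγ : γ ∈ Set.Ioo (0 : ℝ) 1) (hρ : ρ ∈ Set.Ioo (0 : ℝ) 1) (hd : 0 < d) (hN : 2 ≤ N)
    (hB : 1 ≤ B) :
    5 ≤ paramSum c d N ε δ γ ρ B ∧ c ≤ paramSum c d N ε δ γ ρ B ∧
      c⁻¹ ≤ paramSum c d N ε δ γ ρ B ∧ ε⁻¹ ≤ paramSum c d N ε δ γ ρ B ∧
      δ⁻¹ ≤ paramSum c d N ε δ γ ρ B ∧ γ⁻¹ ≤ paramSum c d N ε δ γ ρ B ∧
      d ≤ paramSum c d N ε δ γ ρ B ∧ B + Real.log N ≤ paramSum c d N ε δ γ ρ B ∧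
      Real.log (2 * N / δ) ≤ paramSum c d N ε δ γ ρ B ∧
      Real.log (4 / ρ) ≤ paramSum c d N ε δ γ ρ B ∧
      2 + (B + d + ε⁻¹ + δ⁻¹) + Real.log ρ⁻¹ ≤ paramSum c d N ε δ γ ρ B := by
  have hN' : (2 : ℝ) ≤ N := by exact_mod_cast hN
  have hd' : (1 : ℝ) ≤ d := by exact_mod_cast hd
  obtain ⟨h1, h2, h3⟩ := log_le_log_div hN hρ
  have h4 := one_le_inv_of_mem hε
  have h5 := one_le_inv_of_mem hδ
  have h6 := one_le_inv_of_mem hγ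
  have h7 : 0 < c⁻¹ := by positivity
  have h8 : Real.log (2 * N / δ) ≤ 1 + Real.log N + δ⁻¹ := by
    rw [div_eq_mul_inv, Real.log_mul (by linarith) (by linarith),
      Real.log_mul (by norm_num) (by linarith)]
    have := Real.log_le_self (by linarith : 0 ≤ δ⁻¹)
    linarith [Real.log_two_lt_d9]
  have h9 : Real.log (4 / ρ) ≤ 2 + Real.log ρ⁻¹ := by
    have h4 : Real.log 4 = 2 * Real.log 2 := by
      rw [show (4 : ℝ) = 2 ^ 2 by norm_num, Real.log_pow]; norm_num
    rw [div_eq_mul_inv, Real.log_mul (by norm_num) (inv_ne_zero hρ.1.ne')]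
    linarith [Real.log_two_lt_d9]
  rw [paramSum]
  refine ⟨?_, ?_, ?_, ?_, ?_, ?_, ?_, ?_, ?_, ?_, ?_⟩ <;> linarith

/-- Two-sided bounds for the optimism parameter. -/
theorem xpoAlpha_bounds (hc : 0 < c) (hε : ε ∈ Set.Ioo (0 : ℝ) 1) (hδ : δ ∈ Set.Ioo (0 : ℝ) 1)
    (hγ : γ ∈ Set.Ioo (0 : ℝ) 1) (hρ : ρ ∈ Set.Ioo (0 : ℝ) 1) (hd : 0 < d) (hN : 2 ≤ N)
    (hB : 1 ≤ B) {R : ℕ} (hR : 3 ≤ R) :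
    c * xpoBeta N δ γ / (paramSum c d N ε δ γ ρ B ^ 2 * R ^ 4) ≤
        xpoAlpha c d N ε δ γ ρ B (R ^ 8) ∧
      xpoAlpha c d N ε δ γ ρ B (R ^ 8) ≤
        c * xpoBeta N δ γ * paramSum c d N ε δ γ ρ B / R ^ 4 := by
  obtain ⟨hW5, -, -, -, -, -, hWd, hWB, -, -, hWs⟩ :=
    paramSum_bounds hc hε hδ hγ hρ hd hN hB
  have hβ := xpoBeta_pos hδ hγ hN
  have hlogN := (log_le_log_div hN hρ).1
  set W := paramSum c d N ε δ γ ρ B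
  set β := xpoBeta N δ γ
  have hd' : (1 : ℝ) ≤ d := by exact_mod_cast hd
  have hR' : (3 : ℝ) ≤ R := by exact_mod_cast hR
  set T : ℝ := ((R ^ 8 : ℕ) : ℝ) with hTdef
  have hTR : T = (R ^ 4 : ℝ) ^ 2 := by rw [hTdef]; push_cast; ring
  have hT3 : (3 : ℝ) ≤ T := by
    have : (3 : ℝ) ^ 8 ≤ (R : ℝ) ^ 8 := by gcongr
    rw [hTdef]; push_cast; linarith
  have hlogT : 1 ≤ Real.log T := by
    rw [Real.le_log_iff_exp_le (by linarith)]
    linarith [Real.exp_one_lt_d9]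
  set Q := (d * Real.log (B * d * T / (ε * δ)) + Real.log (T / ρ)) / (d * T * Real.log T) with hQ
  have hεi := one_le_inv_of_mem hε
  have hδi := one_le_inv_of_mem hδ
  have hρi := one_le_inv_of_mem hρ
  have hlogB := Real.log_le_self (by linarith : 0 ≤ B)
  have hlogd := Real.log_le_self (by linarith : 0 ≤ (d : ℝ))
  have hlogε := Real.log_le_self (by linarith : 0 ≤ ε⁻¹)
  have hlogδ := Real.log_le_self (by linarith : 0 ≤ δ⁻¹)
  have hl1 : Real.log (B * d * T / (ε * δ)) =
      Real.log B + Real.log d + Real.log ε⁻¹ + Real.log δ⁻¹ + Real.log T := by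
    rw [show B * d * T / (ε * δ) = B * d * ε⁻¹ * δ⁻¹ * T by
        have := hε.1.ne'; have := hδ.1.ne'; field_simp,
      Real.log_mul (by positivity) (by positivity), Real.log_mul (by positivity) (by positivity),
      Real.log_mul (by positivity) (by positivity), Real.log_mul (by positivity) (by positivity)]
  have hl2 : Real.log (T / ρ) = Real.log T + Real.log ρ⁻¹ := by
    rw [div_eq_mul_inv, Real.log_mul (by positivity) (by positivity)]
  have hB0 := Real.log_nonneg hB
  have hd0 := Real.log_nonneg hd'
  have hε0 := Real.log_nonneg hεi
  have hδ0 := Real.log_nonneg hδi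
  have hρ0 := Real.log_nonneg hρi
  have hQlow : 1 / (W * R ^ 4) ≤ Real.sqrt Q := by
    refine Real.le_sqrt_of_sq_le ?_
    have h1 : 1 / (d * T) ≤ Q := by
      have : 1 / (d * T) = Real.log T / (d * T * Real.log T) := by field_simp
      rw [this, hQ]
      refine div_le_div_of_nonneg_right ?_ (by positivity)
      rw [hl1, hl2]
      have : 0 ≤ (d : ℝ) * (Real.log B + Real.log d + Real.log ε⁻¹ + Real.log δ⁻¹ + Real.log T) := by
        positivity
      linarith
    refine le_trans ?_ h1
    rw [div_pow, one_pow, mul_pow, ← hTR]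
    refine one_div_le_one_div_of_le (by positivity) ?_
    have : (d : ℝ) ≤ W ^ 2 := by nlinarith
    gcongr
  have hQhigh : Real.sqrt Q ≤ W / R ^ 4 := by
    refine Real.sqrt_le_iff.mpr ⟨by positivity, ?_⟩
    rw [div_pow, ← hTR, hQ, div_le_div_iff₀ (by positivity) (by positivity)]
    have h1 : d * Real.log (B * d * T / (ε * δ)) + Real.log (T / ρ) ≤
        d * Real.log T * W ^ 2 := by
      rw [hl1, hl2]
      set S := Real.log B + Real.log d + Real.log ε⁻¹ + Real.log δ⁻¹ with hS
      have hS0 : 0 ≤ S := by positivity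
      have hS1 : S + 2 + Real.log ρ⁻¹ ≤ W := by linarith
      calc d * (S + Real.log T) + (Real.log T + Real.log ρ⁻¹)
          ≤ d * (S * Real.log T + Real.log T) + d * (Real.log T + Real.log ρ⁻¹ * Real.log T) := by
            have h2 : S ≤ S * Real.log T := le_mul_of_one_le_right hS0 hlogT
            have h3 : Real.log ρ⁻¹ ≤ Real.log ρ⁻¹ * Real.log T := le_mul_of_one_le_right hρ0 hlogT
            have h4 : Real.log T + Real.log ρ⁻¹ * Real.log T ≤
              d * (Real.log T + Real.log ρ⁻¹ * Real.log T) :=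
              le_mul_of_one_le_left (by positivity) hd'
            have h5 : d * (S + Real.log T) ≤ d * (S * Real.log T + Real.log T) := by gcongr
            linarith
        _ = d * Real.log T * (S + 2 + Real.log ρ⁻¹) := by ring
        _ ≤ d * Real.log T * W ^ 2 := by
            have : W ≤ W ^ 2 := by nlinarith
            gcongr
            linarith
    calc _ ≤ d * Real.log T * W ^ 2 * T := by gcongr
      _ = W ^ 2 * (d * T * Real.log T) := by ring
  have hα : xpoAlpha c d N ε δ γ ρ B (R ^ 8) = c * (β / (B + Real.log N)) * Real.sqrt Q := rfl
  have hW0 : 0 < W := by linarith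
  rw [hα]
  constructor
  · calc c * β / (W ^ 2 * R ^ 4) = c * (β / W) * (1 / (W * R ^ 4)) := by field_simp
      _ ≤ c * (β / (B + Real.log N)) * Real.sqrt Q := by
        have : 0 < B + Real.log N := by linarith
        gcongr
  · calc c * (β / (B + Real.log N)) * Real.sqrt Q ≤ c * β * (W / R ^ 4) := by
          have : β / (B + Real.log N) ≤ β := div_le_self hβ.le (by linarith)
          gcongr
      _ = c * β * W / R ^ 4 := by ring

theorem log_pow_eight_le {R : ℕ} : Real.log ((R ^ 8 : ℕ) : ℝ) ≤ 8 * R := by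
  push_cast
  rw [Real.log_pow]
  have := Real.log_le_self (Nat.cast_nonneg (α := ℝ) R)
  push_cast
  linarith

theorem log_pow_eight_add_one_le {R : ℕ} (hR : 3 ≤ R) :
    Real.log (((R ^ 8 : ℕ) : ℝ) + 1) ≤ 8 * R + 1 := by
  have hR' : (3 : ℝ) ≤ R := by exact_mod_cast hR
  have h1 : (1 : ℝ) ≤ ((R ^ 8 : ℕ) : ℝ) := by exact_mod_cast Nat.one_le_pow _ _ (by omega)
  have h2 : Real.log (((R ^ 8 : ℕ) : ℝ) + 1) ≤ Real.log (2 * ((R ^ 8 : ℕ) : ℝ)) :=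
    Real.log_le_log (by linarith) (by linarith)
  rw [Real.log_mul (by norm_num) (by linarith)] at h2
  linarith [log_pow_eight_le (R := R), Real.log_two_lt_d9]

/-- The five terms are at most `32`, `4`, `180`, `16` and `10` times `W^5 R^6`, in total `242`. The
right side is at least `R^8 / (20 W²)`, so `4840 W^7 ≤ R²` suffices. -/
theorem regret_numeric (hc : 0 < c) (hε : ε ∈ Set.Ioo (0 : ℝ) 1) (hδ : δ ∈ Set.Ioo (0 : ℝ) 1)
    (hγ : γ ∈ Set.Ioo (0 : ℝ) 1) (hρ : ρ ∈ Set.Ioo (0 : ℝ) 1) (hd : 0 < d) (hN : 2 ≤ N)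
    (hB : 1 ≤ B) {R : ℕ} (hR : 100 * paramSum c d N ε δ γ ρ B ^ 4 ≤ R) :
    32 * B * R ^ 5 + 4 * B + (16 * B * R ^ 5 + 4) * (1 + Real.log ((R ^ 8 : ℕ) : ℝ)) +
      16 * B ^ 2 * xpoBeta N δ γ ^ 2 / xpoAlpha c d N ε δ γ ρ B (R ^ 8) +
      xpoAlpha c d N ε δ γ ρ B (R ^ 8) * ((R ^ 8 : ℕ) : ℝ) / (2 * xpoBeta N δ γ ^ 2) *
        (d * Real.log (d * (((R ^ 8 : ℕ) : ℝ) + 1))) ≤ ((R ^ 8 : ℕ) : ℝ) * (ε * δ / 20) := by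
  obtain ⟨hW5, hWc, hWc', hWε, hWδ, hWγ, hWd, hWB, hWL, -, -⟩ :=
    paramSum_bounds hc hε hδ hγ hρ hd hN hB
  have hlogN := (log_le_log_div hN hρ).1
  have hβ := xpoBeta_pos hδ hγ hN
  have hβ1 := xpoBeta_le_one hδ hγ hN
  have hβi : 1 / (2 * xpoBeta N δ γ) ≤ paramSum c d N ε δ γ ρ B ^ 2 := by
    have hL := log_two_mul_div_ge hδ hN
    have : 1 / (2 * xpoBeta N δ γ) = Real.log (2 * N / δ) * γ⁻¹ := by
      have := hγ.1.ne'
      rw [xpoBeta]; field_simp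
    rw [this, sq]
    exact mul_le_mul hWL hWγ (inv_nonneg.mpr hγ.1.le) (by linarith)
  have hR3 : 3 ≤ R := by
    have : (100 : ℝ) * 5 ^ 4 ≤ R := le_trans (by gcongr) hR
    have : (3 : ℝ) ≤ R := by linarith
    exact_mod_cast this
  obtain ⟨hαl, hαu⟩ := xpoAlpha_bounds hc hε hδ hγ hρ hd hN hB hR3
  have hlog := log_pow_eight_le (R := R)
  have hlog1 := log_pow_eight_add_one_le hR3
  have hlog0 : 0 ≤ Real.log ((R ^ 8 : ℕ) : ℝ) := Real.log_natCast_nonneg _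
  set W := paramSum c d N ε δ γ ρ B
  set β := xpoBeta N δ γ
  set α := xpoAlpha c d N ε δ γ ρ B (R ^ 8)
  have hd' : (1 : ℝ) ≤ d := by exact_mod_cast hd
  have hT : ((R ^ 8 : ℕ) : ℝ) = (R : ℝ) ^ 8 := by push_cast; rfl
  have hlogd : Real.log (d * (((R ^ 8 : ℕ) : ℝ) + 1)) ≤ W + (8 * R + 1) := by
    rw [Real.log_mul (by positivity) (by positivity)]
    linarith [Real.log_le_self (by linarith : 0 ≤ (d : ℝ))]
  have hlogd0 : 0 ≤ Real.log (d * (((R ^ 8 : ℕ) : ℝ) + 1)) :=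
    Real.log_nonneg (one_le_mul_of_one_le_of_one_le hd' (le_add_of_nonneg_left (by positivity)))
  rw [hT] at hlog hlog0 hlogd hlogd0 ⊢
  set r : ℝ := (R : ℝ)
  have hWr : W ≤ r := by
    have : W ≤ 100 * W ^ 4 := by nlinarith [pow_le_pow_right₀ (by linarith : 1 ≤ W) (by norm_num : 1 ≤ 4)]
    linarith
  have hr1 : 1 ≤ r := by linarith
  have hW0 : 0 < W := by linarith
  have hr0 : 0 < r := by linarith
  have hα0 : 0 < α := lt_of_lt_of_le (by positivity) hαl
  have hBW : B ≤ W := by linarith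
  have hpow : ∀ k ≤ 6, r ^ k ≤ r ^ 6 := fun k hk => pow_le_pow_right₀ hr1 hk
  have hWpow : ∀ k ≤ 5, W ^ k ≤ W ^ 5 := fun k hk => pow_le_pow_right₀ (by linarith) hk
  have hW1 : W ≤ W ^ 5 := by simpa using hWpow 1 (by norm_num)
  have t1 : 32 * B * r ^ 5 ≤ 32 * (W ^ 5 * r ^ 6) := by
    have := hpow 5 (by norm_num)
    calc 32 * B * r ^ 5 = 32 * (B * r ^ 5) := by ring
      _ ≤ 32 * (W ^ 5 * r ^ 6) := by gcongr; linarith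
  have hr6 : 1 ≤ r ^ 6 := one_le_pow₀ hr1
  have hW51 : 1 ≤ W ^ 5 := one_le_pow₀ (by linarith)
  have t2 : 4 * B ≤ 4 * (W ^ 5 * r ^ 6) := by
    have : B * 1 ≤ W ^ 5 * r ^ 6 := by gcongr; linarith
    linarith
  have t3 : (16 * B * r ^ 5 + 4) * (1 + Real.log (r ^ 8)) ≤ 180 * (W ^ 5 * r ^ 6) := by
    have h1 : 4 ≤ 4 * (W * r ^ 5) := by
      have : (1 : ℝ) * 1 ≤ W * r ^ 5 :=
        mul_le_mul (by linarith) (one_le_pow₀ hr1) zero_le_one hW0.le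
      linarith
    have h2 : 16 * B * r ^ 5 ≤ 16 * (W * r ^ 5) := by
      rw [mul_assoc]; gcongr
    calc (16 * B * r ^ 5 + 4) * (1 + Real.log (r ^ 8)) ≤ (20 * (W * r ^ 5)) * (9 * r) := by
          refine mul_le_mul (by linarith) (by linarith) (by linarith) (by positivity)
      _ = 180 * (W * r ^ 6) := by ring
      _ ≤ _ := by gcongr
  have t4 : 16 * B ^ 2 * β ^ 2 / α ≤ 16 * (W ^ 5 * r ^ 6) := by
    have h1 : β ^ 2 / α ≤ W ^ 3 * r ^ 4 := by
      rw [div_le_iff₀ hα0]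
      calc β ^ 2 ≤ β * 1 := by rw [sq]; gcongr
        _ = (W ^ 2 * r ^ 4 * c⁻¹) * (c * β / (W ^ 2 * r ^ 4)) := by field_simp
        _ ≤ (W ^ 2 * r ^ 4 * W) * α := by gcongr
        _ = _ := by ring
    calc 16 * B ^ 2 * β ^ 2 / α = 16 * (B ^ 2 * (β ^ 2 / α)) := by ring
      _ ≤ 16 * (W ^ 2 * (W ^ 3 * r ^ 4)) := by gcongr
      _ = 16 * (W ^ 5 * r ^ 4) := by ring
      _ ≤ _ := by have := hpow 4 (by norm_num); gcongr
  have t5 : α * r ^ 8 / (2 * β ^ 2) * (d * Real.log (d * (r ^ 8 + 1))) ≤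
      10 * (W ^ 5 * r ^ 6) := by
    have h1 : α * r ^ 8 / (2 * β ^ 2) ≤ W ^ 4 * r ^ 4 := by
      calc α * r ^ 8 / (2 * β ^ 2) ≤ (c * β * W / r ^ 4) * r ^ 8 / (2 * β ^ 2) := by gcongr
        _ = c * W * r ^ 4 * (1 / (2 * β)) := by field_simp
        _ ≤ W * W * r ^ 4 * W ^ 2 := by gcongr
        _ = _ := by ring
    have h2 : d * Real.log (d * (r ^ 8 + 1)) ≤ W * (10 * r) := by
      refine mul_le_mul hWd (by linarith) hlogd0 hW0.le
    calc _ ≤ (W ^ 4 * r ^ 4) * (W * (10 * r)) := by gcongr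
      _ = 10 * (W ^ 5 * r ^ 5) := by ring
      _ ≤ _ := by have := hpow 5 (by norm_num); gcongr
  have hεδ : 1 / W ^ 2 ≤ ε * δ := by
    have h1 : (ε * δ)⁻¹ ≤ W ^ 2 := by
      rw [mul_inv, sq]
      exact mul_le_mul hWε hWδ (inv_nonneg.mpr hδ.1.le) hW0.le
    rw [one_div]
    exact inv_le_of_inv_le₀ (mul_pos hε.1 hδ.1) h1
  have hfin : 242 * (W ^ 5 * r ^ 6) ≤ r ^ 8 * (ε * δ / 20) := by
    have h1 : 4840 * W ^ 7 ≤ r ^ 2 := by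
      calc 4840 * W ^ 7 ≤ 10000 * W ^ 8 := by
            have : W ^ 7 ≤ W ^ 8 := pow_le_pow_right₀ (by linarith) (by norm_num)
            have : 0 ≤ W ^ 7 := by positivity
            linarith
        _ = (100 * W ^ 4) ^ 2 := by ring
        _ ≤ r ^ 2 := by gcongr
    calc 242 * (W ^ 5 * r ^ 6) = r ^ 6 * (4840 * W ^ 7) * (1 / W ^ 2 / 20) := by field_simp; ring
      _ ≤ r ^ 6 * r ^ 2 * (ε * δ / 20) := by gcongr
      _ = _ := by ring
  linarith

/-- The deviations `16 B R^5` and `32 B R^5` are scaled so that both exponents equal `2 R²`. The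
logarithm of the size of the net is at most `9 W R`, and `R ≥ 100 W`. -/
theorem failure_numeric (hc : 0 < c) (hε : ε ∈ Set.Ioo (0 : ℝ) 1) (hδ : δ ∈ Set.Ioo (0 : ℝ) 1)
    (hγ : γ ∈ Set.Ioo (0 : ℝ) 1) (hρ : ρ ∈ Set.Ioo (0 : ℝ) 1) (hd : 0 < d) (hN : 2 ≤ N)
    (hB : 1 ≤ B) {R : ℕ} (hR : 100 * paramSum c d N ε δ γ ρ B ^ 4 ≤ R) :
    ((R ^ 8 : ℕ) : ℝ) * (3 * (B * d * ((R ^ 8 : ℕ) : ℝ))) ^ d *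
        Real.exp (-((16 * B * R ^ 5) ^ 2 / (2 * ((R ^ 8 : ℕ) : ℝ) * (8 * B) ^ 2))) +
      Real.exp (-((32 * B * R ^ 5) ^ 2 / (2 * ((R ^ 8 : ℕ) : ℝ) * (16 * B) ^ 2))) ≤ ρ / 2 := by
  obtain ⟨hW5, -, -, -, -, -, hWd, -, -, hW4, hWs⟩ :=
    paramSum_bounds hc hε hδ hγ hρ hd hN hB
  have hlog := log_pow_eight_le (R := R)
  have hlog0 : 0 ≤ Real.log ((R ^ 8 : ℕ) : ℝ) := Real.log_natCast_nonneg _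
  have hε0 := one_le_inv_of_mem hε
  have hδ0 := one_le_inv_of_mem hδ
  have hρ0 := Real.log_nonneg (one_le_inv_of_mem hρ)
  have hρpos := hρ.1
  set W := paramSum c d N ε δ γ ρ B
  have hd' : (1 : ℝ) ≤ d := by exact_mod_cast hd
  have hWr : 100 * W ≤ R := by
    have : W ≤ W ^ 4 := by nlinarith [pow_le_pow_right₀ (by linarith : 1 ≤ W) (by norm_num : 1 ≤ 4)]
    linarith
  have hr0 : (0 : ℝ) < R := by linarith
  have hT : ((R ^ 8 : ℕ) : ℝ) = (R : ℝ) ^ 8 := by push_cast; rfl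
  rw [hT] at hlog hlog0 ⊢
  set r : ℝ := (R : ℝ)
  have e1 : (16 * B * r ^ 5) ^ 2 / (2 * r ^ 8 * (8 * B) ^ 2) = 2 * r ^ 2 := by
    field_simp; ring
  have e2 : (32 * B * r ^ 5) ^ 2 / (2 * r ^ 8 * (16 * B) ^ 2) = 2 * r ^ 2 := by
    field_simp; ring
  rw [e1, e2]
  have hlogA : Real.log (3 * (B * d * r ^ 8)) ≤ 9 * r := by
    rw [Real.log_mul (by norm_num) (by positivity), Real.log_mul (by positivity) (by positivity),
      Real.log_mul (by positivity) (by positivity)]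
    have h3 : Real.log 3 ≤ 2 := by
      have := Real.log_le_sub_one_of_pos (by norm_num : (0 : ℝ) < 3); linarith
    linarith [Real.log_le_self (by linarith : 0 ≤ (d : ℝ)), Real.log_le_self (by linarith : 0 ≤ B)]
  have hρexp : ρ / 4 = Real.exp (-Real.log (4 / ρ)) := by
    rw [← Real.log_inv, Real.exp_log (by positivity), inv_div]
  have h1 : r ^ 8 * (3 * (B * d * r ^ 8)) ^ d * Real.exp (-(2 * r ^ 2)) ≤ ρ / 4 := by
    have : r ^ 8 * (3 * (B * d * r ^ 8)) ^ d =
        Real.exp (Real.log (r ^ 8) + d * Real.log (3 * (B * d * r ^ 8))) := by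
      rw [Real.exp_add, Real.exp_log (by positivity), ← Real.log_pow, Real.exp_log (by positivity)]
    rw [this, ← Real.exp_add, hρexp, Real.exp_le_exp]
    have h2 : d * Real.log (3 * (B * d * r ^ 8)) ≤ W * (9 * r) :=
      (mul_le_mul_of_nonneg_left hlogA (by linarith)).trans (by gcongr)
    nlinarith
  have h2 : Real.exp (-(2 * r ^ 2)) ≤ ρ / 4 := by
    rw [hρexp, Real.exp_le_exp]
    nlinarith
  linarith

/-- The accuracy is at least `1/(80 W^4)` and the centered summands are at most `12 W`, so `n = R^5`
makes the exponent at least `10 R`, which beats `log (T + 1) + log (4/ρ)`. -/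
theorem validation_numeric (hc : 0 < c) (hε : ε ∈ Set.Ioo (0 : ℝ) 1) (hδ : δ ∈ Set.Ioo (0 : ℝ) 1)
    (hγ : γ ∈ Set.Ioo (0 : ℝ) 1) (hρ : ρ ∈ Set.Ioo (0 : ℝ) 1) (hd : 0 < d) (hN : 2 ≤ N)
    (hB : 1 ≤ B) {R : ℕ} (hR : 100 * paramSum c d N ε δ γ ρ B ^ 4 ≤ R) :
    (((R ^ 8 : ℕ) : ℝ) + 1) * (2 * Real.exp (-(((R ^ 5 : ℕ) : ℝ) *
      (xpoBeta N δ γ * (ε * δ / 40)) ^ 2 / (2 * (2 * (6 * B + Real.log N)) ^ 2)))) ≤ ρ / 2 := by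
  obtain ⟨hW5, -, -, hWε, hWδ, hWγ, -, hWB, hWL, hW4, -⟩ :=
    paramSum_bounds hc hε hδ hγ hρ hd hN hB
  have hlogN := (log_le_log_div hN hρ).1
  have hβ := xpoBeta_pos hδ hγ hN
  have hL := log_two_mul_div_ge hδ hN
  have hR3 : 3 ≤ R := by
    have : (100 : ℝ) * 5 ^ 4 ≤ R := le_trans (by gcongr) hR
    have : (3 : ℝ) ≤ R := by linarith
    exact_mod_cast this
  have hlog1 := log_pow_eight_add_one_le hR3
  have hεp := hε.1
  have hδp := hδ.1
  have hγp := hγ.1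
  have hρp := hρ.1
  set W := paramSum c d N ε δ γ ρ B
  have hW0 : 0 < W := by linarith
  have hβi : 1 / (2 * W ^ 2) ≤ xpoBeta N δ γ := by
    have h1 : W⁻¹ ≤ γ := inv_le_of_inv_le₀ hγp hWγ
    calc 1 / (2 * W ^ 2) = W⁻¹ / (2 * W) := by field_simp
      _ ≤ γ / (2 * Real.log (2 * N / δ)) := by gcongr
      _ = _ := rfl
  have hεi : W⁻¹ ≤ ε := inv_le_of_inv_le₀ hεp hWε
  have hδi : W⁻¹ ≤ δ := inv_le_of_inv_le₀ hδp hWδ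
  set r : ℝ := (R : ℝ) with hr
  have hWr : W ≤ r := by
    have : W ≤ 100 * W ^ 4 := by nlinarith [pow_le_pow_right₀ (by linarith : 1 ≤ W) (by norm_num : 1 ≤ 4)]
    linarith
  have hr0 : 0 < r := by linarith
  have hτ : 1 / (80 * W ^ 4) ≤ xpoBeta N δ γ * (ε * δ / 40) := by
    calc 1 / (80 * W ^ 4) = 1 / (2 * W ^ 2) * (W⁻¹ * W⁻¹ / 40) := by field_simp; norm_num
      _ ≤ _ := by gcongr
  have hy : 10 * r ≤ ((R ^ 5 : ℕ) : ℝ) * (xpoBeta N δ γ * (ε * δ / 40)) ^ 2 /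
      (2 * (2 * (6 * B + Real.log N)) ^ 2) := by
    have hC : 6 * B + Real.log N ≤ 6 * W := by linarith
    -- The constant is `10 · 80² · 2 · 12²`.
    have hr4 : 18432000 * W ^ 10 ≤ r ^ 4 := by
      calc 18432000 * W ^ 10 ≤ 100000000 * W ^ 16 := by
            have : W ^ 10 ≤ W ^ 16 := pow_le_pow_right₀ (by linarith) (by norm_num)
            have : 0 ≤ W ^ 10 := by positivity
            linarith
        _ = (100 * W ^ 4) ^ 4 := by ring
        _ ≤ r ^ 4 := by gcongr
    calc 10 * r = r * (18432000 * W ^ 10) * (1 / (80 * W ^ 4)) ^ 2 / (2 * (2 * (6 * W)) ^ 2) := by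
          field_simp; norm_num
      _ ≤ r * r ^ 4 * (xpoBeta N δ γ * (ε * δ / 40)) ^ 2 /
          (2 * (2 * (6 * B + Real.log N)) ^ 2) := by
          have : 0 < 6 * B + Real.log N := by linarith
          gcongr
      _ = _ := by rw [hr]; push_cast; ring
  have hexp : (((R ^ 8 : ℕ) : ℝ) + 1) * (4 / ρ) ≤ Real.exp (10 * r) := by
    rw [← Real.log_le_iff_le_exp (by positivity), Real.log_mul (by positivity) (by positivity)]
    linarith
  calc _ ≤ (((R ^ 8 : ℕ) : ℝ) + 1) * (2 * Real.exp (-(10 * r))) := by gcongr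
    _ = (((R ^ 8 : ℕ) : ℝ) + 1) * (4 / ρ) * Real.exp (-(10 * r)) * (ρ / 2) := by field_simp; ring
    _ ≤ Real.exp (10 * r) * Real.exp (-(10 * r)) * (ρ / 2) := by gcongr
    _ = ρ / 2 := by rw [← Real.exp_add]; simp

end Bounds

/-- XPO succeeds trivially when all responses are equally likely. -/
theorem IsXPORule.success_of_argmaxSet_eq_univ {X Y : Type*} [MeasurableSpace X]
    [MeasurableSpace Y] [DiscreteMeasurableSpace Y] [Fintype Y] [Nonempty Y] {d : ℕ}
    {φ : X → Y → EuclideanSpace ℝ (Fin d)} {B β α ε δ ρ : ℝ} {θs : EuclideanSpace ℝ (Fin d)}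
    {A : (t : ℕ) → (Fin t → X × Y × Y) → Model X Y} {μ : Measure X} [IsProbabilityMeasure μ]
    {r r' : X → Y → ℝ} (hφm : ∀ y, Measurable fun x => φ x y) (hθs : ‖θs‖ ≤ B) (hε : 0 ≤ ε)
    (hδ : 0 ≤ δ) (hρ : 0 ≤ ρ) (h : ∀ᵐ x ∂μ, argmaxSet (linSoftmax φ θs) x = Set.univ)
    (hA : IsXPORule (softmaxClass φ B) (linSoftmax φ θs) r β α A) (T n : ℕ) :
    ENNReal.ofReal (1 - ρ) ≤ xpoSuccess μ (linSoftmax φ θs) r' β ε δ A T ∧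
      ENNReal.ofReal (1 - ρ) ≤ xpoSuccessVal μ (linSoftmax φ θs) r' β ε δ A T n := by
  have hprob := hA.isProbabilityMeasure_trainLaw (μ := μ) hφm hθs T
  have hρ1 : ENNReal.ofReal (1 - ρ) ≤ 1 := by
    rw [← ENNReal.ofReal_one]; exact ENNReal.ofReal_le_ofReal (by linarith)
  have hiter : ∀ D : Fin T → X × Y × Y, ∀ s : Fin (T + 1),
      ∃ θ, ‖θ‖ ≤ B ∧ iterate A D s = linSoftmax φ θ := fun D s => hA.exists_param hθs _ _
  have hsh : ∀ D : Fin T → X × Y × Y, ∀ s : Fin (T + 1),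
      IsSharpened μ (linSoftmax φ θs) ε δ (iterate A D s) := fun D s => by
    obtain ⟨θ, -, hθ⟩ := hiter D s
    rw [hθ]
    exact isSharpened_of_argmaxSet_eq_univ hε hδ (sum_linSoftmax θ) h
  constructor
  · refine hρ1.trans (le_of_eq ?_)
    rw [xpoSuccess, ← measure_univ (μ := trainLaw μ (linSoftmax φ θs) A T)]
    exact congrArg _ (Set.eq_univ_of_forall fun D s _ => hsh D s).symm
  · refine hρ1.trans (le_of_eq ?_)
    rw [xpoSuccessVal, ← measure_univ (μ := trainLaw μ (linSoftmax φ θs) A T), ← lintegral_one]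
    refine lintegral_congr fun D => ?_
    have hprob' : ∀ q : Fin (T + 1) × Fin n,
        IsProbabilityMeasure (pairLaw μ (iterate A D q.1)) := fun q => by
      obtain ⟨θ, -, hθ⟩ := hiter D q.1
      rw [hθ]
      exact isProbabilityMeasure_pairLaw μ (measurable_linSoftmax hφm _)
        (fun x y => (linSoftmax_pos _ x y).le) (sum_linSoftmax _)
    rw [← measure_univ (μ := Measure.pi fun q : Fin (T + 1) × Fin n =>
      pairLaw μ (iterate A D q.1))]
    exact congrArg _ (Set.eq_univ_of_forall fun V s _ => hsh D s).symm

/-- In low dimension, or for a small model class or a single response, the margin condition forces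
all responses to be equally likely. -/
theorem argmaxSet_eq_univ_of_degenerate {X Y : Type*} [MeasurableSpace X] [Fintype Y] [Nonempty Y]
    {d : ℕ} {φ : X → Y → EuclideanSpace ℝ (Fin d)} {B δ γ : ℝ} {θs : EuclideanSpace ℝ (Fin d)}
    {μ : Measure X} (hφ : ∀ x y, ‖φ x y‖ ≤ 1) (hδ : δ ∈ Set.Ioo (0 : ℝ) 1)
    (hγ : γ ∈ Set.Ioo (0 : ℝ) 1) (hB : 0 < B)
    (hθs : ‖θs‖ ≤ γ * B / (3 * Real.log (2 * Fintype.card Y / δ)))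
    (hm : MarginCondition μ (linSoftmax φ θs) γ)
    (h : ¬ (0 < d ∧ 2 ≤ Fintype.card Y ∧ 1 ≤ B)) :
    ∀ᵐ x ∂μ, argmaxSet (linSoftmax φ θs) x = Set.univ := by
  by_cases hN : 2 ≤ Fintype.card Y
  · refine argmaxSet_eq_univ_of_margin hφ hγ.1 hγ.2 ?_ hm
    rcases Nat.eq_zero_or_pos d with rfl | hd
    · rw [Subsingleton.elim θs 0, norm_zero]
      linarith [hγ.1]
    · have hB1 : B < 1 := by
        by_contra hB1
        exact h ⟨hd, hN, not_lt.mp hB1⟩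
      have hL := log_two_mul_div_ge hδ hN
      have hγ0 := hγ.1
      refine hθs.trans_lt ?_
      rw [div_lt_div_iff₀ (by positivity) (by norm_num)]
      nlinarith [mul_lt_mul_of_pos_left hB1 hγ0]
  · have : Subsingleton Y := by
      rw [← Fintype.card_le_one_iff_subsingleton]; omega
    refine Filter.Eventually.of_forall fun x => Set.eq_univ_of_forall fun y y' => ?_
    rw [Subsingleton.elim y' y]

/-- The polynomial that bounds the sample complexity. -/
def complexityPoly (c : ℝ) : MvPolynomial (Fin 6) ℝ :=
  MvPolynomial.C (4 * 101 ^ 13) * (MvPolynomial.C (2 + c + c⁻¹) + ∑ i, MvPolynomial.X i) ^ 52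

theorem eval_complexityPoly (c : ℝ) (d N : ℕ) (ε δ γ ρ B : ℝ) :
    MvPolynomial.eval ![ε⁻¹, δ⁻¹, γ⁻¹, (d : ℝ), B, Real.log (N / ρ)] (complexityPoly c) =
      4 * 101 ^ 13 * paramSum c d N ε δ γ ρ B ^ 52 := by
  have h : MvPolynomial.eval ![ε⁻¹, δ⁻¹, γ⁻¹, (d : ℝ), B, Real.log (N / ρ)]
      (MvPolynomial.C (2 + c + c⁻¹) + ∑ i, MvPolynomial.X i) = paramSum c d N ε δ γ ρ B := by
    rw [map_add, map_sum, Fin.sum_univ_six, MvPolynomial.eval_C]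
    simp only [MvPolynomial.eval_X]
    rfl
  rw [complexityPoly, map_mul, map_pow, h, MvPolynomial.eval_C]

/-- The product `n T = R^13` dominates and `R ≤ 101 W^4`; hence the degree `52 = 4 · 13`. -/
theorem xpoSampleComplexity_le {W : ℝ} (hW : 5 ≤ W) :
    (xpoSampleComplexity (⌈100 * W ^ 4⌉₊ ^ 8) (⌈100 * W ^ 4⌉₊ ^ 5) : ℝ) ≤
      4 * 101 ^ 13 * W ^ 52 := by
  set R : ℕ := ⌈100 * W ^ 4⌉₊ with hR
  have h1 : (R : ℝ) ≤ 101 * W ^ 4 := by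
    have h2 := Nat.ceil_lt_add_one (show 0 ≤ 100 * W ^ 4 by positivity)
    have h3 : 1 ≤ W ^ 4 := one_le_pow₀ (by linarith)
    rw [← hR] at h2
    linarith
  have h2 : 1 ≤ R := Nat.one_le_ceil_iff.mpr (by positivity)
  have h3 : xpoSampleComplexity (R ^ 8) (R ^ 5) ≤ 4 * R ^ 13 := by
    have h4 : R ^ 8 ≤ R ^ 13 := Nat.pow_le_pow_right h2 (by norm_num)
    have h5 : R ^ 5 ≤ R ^ 13 := Nat.pow_le_pow_right h2 (by norm_num)
    have h6 : R ^ 5 * (R ^ 8 + 1) = R ^ 13 + R ^ 5 := by ring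
    rw [xpoSampleComplexity, h6]
    omega
  calc (xpoSampleComplexity (R ^ 8) (R ^ 5) : ℝ) ≤ 4 * (R : ℝ) ^ 13 := by exact_mod_cast h3
    _ ≤ 4 * (101 * W ^ 4) ^ 13 := by gcongr
    _ = _ := by ring

end Sharpening

end

/-! ### The theorem. -/

theorem mainTheorem5 (c : ℝ) (hc : 0 < c) :
    -- the guarantee for XPO; the order of the arguments of the polynomial `p` is
    -- `1/ε, 1/δ, 1/γ, d, B, log(N/ρ)`
    (∃ p : MvPolynomial (Fin 6) ℝ,
      ∀ (d N : ℕ) (ε δ γ ρ B : ℝ), ε ∈ Set.Ioo 0 1 → δ ∈ Set.Ioo 0 1 → γ ∈ Set.Ioo 0 1 →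
        ρ ∈ Set.Ioo 0 1 → 0 < B →
      ∃ T n : ℕ,
        (Sharpening.xpoSampleComplexity T n : ℝ) ≤
          MvPolynomial.eval ![ε⁻¹, δ⁻¹, γ⁻¹, (d : ℝ), B, Real.log (N / ρ)] p ∧
        ∀ (X : Type*) (Y : Type*) [MeasurableSpace X] [MeasurableSpace Y]
          [DiscreteMeasurableSpace Y] [Fintype Y] [Nonempty Y],
          Fintype.card Y = N →
        ∀ (μ : Measure X) [IsProbabilityMeasure μ] (φ : X → Y → EuclideanSpace ℝ (Fin d)),
          (∀ y, Measurable fun x => φ x y) → (∀ x y, ‖φ x y‖ ≤ 1) →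
        ∀ (θs : EuclideanSpace ℝ (Fin d)) (πb : Sharpening.Model X Y),
          πb = Sharpening.linSoftmax φ θs →
          ‖θs‖ ≤ γ * B / (3 * Real.log (2 * N / δ)) →
          Sharpening.MarginCondition μ πb γ →
        ∀ A : (t : ℕ) → (Fin t → X × Y × Y) → Sharpening.Model X Y,
          Sharpening.IsXPORule (Sharpening.softmaxClass φ B) πb (fun x y => Real.log (πb x y))
            (Sharpening.xpoBeta N δ γ) (Sharpening.xpoAlpha c d N ε δ γ ρ B T) A →
          ENNReal.ofReal (1 - ρ) ≤
            Sharpening.xpoSuccess μ πb (fun x y => Real.log (πb x y))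
              (Sharpening.xpoBeta N δ γ) ε δ A T ∧
          ENNReal.ofReal (1 - ρ) ≤
            Sharpening.xpoSuccessVal μ πb (fun x y => Real.log (πb x y))
              (Sharpening.xpoBeta N δ γ) ε δ A T n) ∧
    -- the comparison with SFT-Sharpening
    (∃ (c₀ γ₀ C₀ : ℝ) (d₀ : ℕ), 0 < c₀ ∧ γ₀ ∈ Set.Ioo 0 1 ∧
      ∀ d : ℕ, d₀ ≤ d →
      ∃ S : Finset (EuclideanSpace ℝ (Fin d)),
        (∀ y ∈ S, ‖y‖ = 1) ∧ (∀ y ∈ S, ∀ y' ∈ S, y ≠ y' → 1 / 4 ≤ dist y y') ∧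
        Real.exp (c₀ * d) ≤ S.card ∧ (S.card : ℝ) ≤ Real.exp (C₀ * d) ∧
        ∀ (ys : S) (φ : Unit → S → EuclideanSpace ℝ (Fin d)) (πb : Sharpening.Model Unit S),
          (∀ x y, φ x y = (y : EuclideanSpace ℝ (Fin d))) → πb = Sharpening.linSoftmax φ ys →
          (∀ δ ∈ Set.Ioo (0 : ℝ) 1, ‖(ys : EuclideanSpace ℝ (Fin d))‖ ≤
            γ₀ * (C₀ * (d + Real.log (1 / δ))) / (3 * Real.log (2 * S.card / δ))) ∧
          Sharpening.MarginCondition (Measure.dirac ()) πb γ₀ ∧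
          Real.exp (c₀ * d) ≤ Sharpening.coverage (Measure.dirac ()) πb ∧
          ∀ ε ∈ Set.Ioo (0 : ℝ) 1, ∀ δ ∈ Set.Ioo (0 : ℝ) 1,
            ∀ (M : ℕ) (s : Unit → (Fin M → S) → S), Sharpening.IsBestOfN M πb s →
              Sharpening.IsSharpened (Measure.dirac ()) πb ε δ (Sharpening.bestOfN M πb s) →
              (1 - δ) * Real.exp (c₀ * d) ≤ M) := by
  refine ⟨⟨Sharpening.complexityPoly c, ?_⟩, Sharpening.sft_comparison⟩
  intro d N ε δ γ ρ B hε hδ hγ hρ hB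
  by_cases h : 0 < d ∧ 2 ≤ N ∧ 1 ≤ B
  · obtain ⟨hd, hN, hB1⟩ := h
    set W := Sharpening.paramSum c d N ε δ γ ρ B with hW
    have hW5 : 5 ≤ W := (Sharpening.paramSum_bounds hc hε hδ hγ hρ hd hN hB1).1
    set R : ℕ := ⌈100 * W ^ 4⌉₊ with hR
    have hRle : 100 * W ^ 4 ≤ R := Nat.le_ceil _
    have hR1 : 1 ≤ R := Nat.one_le_ceil_iff.mpr (by positivity)
    have hR3 : 3 ≤ R := by
      have : (100 : ℝ) * 5 ^ 4 ≤ R := le_trans (by gcongr) hRle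
      have : (3 : ℝ) ≤ R := by linarith
      exact_mod_cast this
    refine ⟨R ^ 8, R ^ 5, ?_, ?_⟩
    · rw [Sharpening.eval_complexityPoly]
      exact Sharpening.xpoSampleComplexity_le hW5
    intro X Y _ _ _ _ _ hcard μ _ φ hφm hφ θs πb hπb hθs hm A hA
    subst hπb
    subst hcard
    have hβ := Sharpening.xpoBeta_pos hδ hγ hN
    have hα : 0 < Sharpening.xpoAlpha c d (Fintype.card Y) ε δ γ ρ B (R ^ 8) :=
      lt_of_lt_of_le (by positivity) (Sharpening.xpoAlpha_bounds hc hε hδ hγ hρ hd hN hB1 hR3).1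
    obtain ⟨h1, h2⟩ := Sharpening.norm_tilt_le hδ hγ hN hB hθs
    exact hA.success hφm hφ hd hB1 hγ.1 hγ.2 hδ.1 hδ.2 hε.1 hρ.1 hρ.2 hm rfl hβ
      (Sharpening.xpoBeta_le_one hδ hγ hN) hα h1 h2 (pow_pos hR1 8) (pow_pos hR1 5)
      (E := 16 * B * R ^ 5) (Az := 32 * B * R ^ 5) (by positivity) (by positivity)
      (Sharpening.regret_numeric hc hε hδ hγ hρ hd hN hB1 hRle)
      (Sharpening.failure_numeric hc hε hδ hγ hρ hd hN hB1 hRle)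
      (Sharpening.validation_numeric hc hε hδ hγ hρ hd hN hB1 hRle)
  -- In the degenerate cases every model in play is sharpened, so no samples are drawn and the only
  -- candidate is `πb`.
  · refine ⟨0, 0, ?_, ?_⟩
    · rw [Sharpening.eval_complexityPoly]
      -- An even exponent makes the polynomial nonnegative with no discussion of the sign of
      -- `paramSum`.
      have h52 : Even 52 := ⟨26, rfl⟩
      have := h52.pow_nonneg (Sharpening.paramSum c d N ε δ γ ρ B)
      simp only [Sharpening.xpoSampleComplexity, mul_zero, zero_mul, add_zero, Nat.cast_zero]
      positivity
    intro X Y _ _ _ _ _ hcard μ _ φ hφm hφ θs πb hπb hθs hm A hA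
    subst hπb
    subst hcard
    have hθB : ‖θs‖ ≤ B := by
      have hN1 : (1 : ℝ) ≤ Fintype.card Y := by exact_mod_cast Fintype.card_pos
      have hL : 2 / 3 ≤ Real.log (2 * Fintype.card Y / δ) := by
        have : Real.log 2 ≤ Real.log (2 * Fintype.card Y / δ) :=
          Real.log_le_log two_pos (by rw [le_div_iff₀ hδ.1]; nlinarith [hδ.1, hδ.2])
        linarith [Real.log_two_gt_d9]
      refine hθs.trans ?_
      rw [div_le_iff₀ (by linarith)]
      nlinarith [mul_lt_mul_of_pos_left hγ.2 hB]
    exact hA.success_of_argmaxSet_eq_univ hφm hθB hε.1.le hδ.1.le hρ.1.le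
      (Sharpening.argmaxSet_eq_univ_of_degenerate hφ hδ hγ hB hθs hm h) 0 0
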